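/- Let $T,\alpha\in\mathbb R$, $q_0>0$, $q_\pm\in\mathbb C$ with $|q_\pm|=q_0$, and let $q(x,t)$ ($x\in\mathbb R$, $t$ in a time interval $S\ni 0$) be a classical solution of the focusing Kundu--Eckhaus equation $$iq_t+q_{xx}+2|q|^2q+4T^2|q|^4q-4iT(|q|^2)_xq=0 .$$ Put $\Upsilon=\alpha x+(2q_0^2+4T^2q_0^4-\alpha^2)t$ and $p=qe^{-i\Upsilon}$, and assume for every $t\in S$ that $p\to q_\pm$ as $x\to\pm\infty$, $(1+|x|)(p-q_\pm)\in L^1(\mathbb R^\pm)$ and $p_x\in L^1(\mathbb R)$. For $\zeta\ne0$ let $\lambda=\frac12(\zeta+q_0^2/\zeta)$, $\tilde z=\frac12(\zeta-q_0^2/\zeta)$, $z=\tilde z+Tq_0^2-\frac{\alpha}2$, $\Theta(x,t,\zeta)=\lambda\,(x+2(z+Tq_0^2-\frac\alpha2)t)$, and $\sigma_3=\mathrm{diag}(1,-1)$. Let $D_1$, $D_2$ be the sets where $(|\zeta|^2-q_0^2)\operatorname{Im}\zeta$ is $>0$, respectively $<0$, and let $\Sigma_\Omega$ be the union of the real line and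 the circle $|\zeta|=q_0$, without $0,\pm iq_0$, oriented so that $D_1$ lies on its right. Consider the Lax pair $\Psi_x=(U-i(z+\frac\alpha2)\sigma_3)\Psi$, $\Psi_t=(V-2i(z^2+\frac14(2q_0^2+4T^2q_0^4-\alpha^2))\sigma_3)\Psi$, where $$U=\begin{pmatrix} iT|q|^2& qe^{-i\Upsilon}\\ -\bar qe^{i\Upsilon}&-iT|q|^2\end{pmatrix},\qquad V=\begin{pmatrix} d&(iq_x+2zq+2T|q|^2q)e^{-i\Upsilon}\\ (i\bar q_x-2z\bar q-2T|q|^2\bar q)e^{i\Upsilon}&-d\end{pmatrix},$$ $d=i|q|^2+4iT^2|q|^4+T(q\bar q_x-q_x\bar q)$. Let $\psi_\pm=(\psi_{\pm,1},\psi_{\pm,2})$ be the Jost solutions: simultaneous solutions of the Lax pair such that the columns of $\mu_\pm=\psi_\pm e^{i\Theta\sigma_3}$ tend, as $x\to\pm\infty$, to those of $$\tilde E_\pm=\begin{pmatrix}1&-iq_\pm\zeta^{-1}\\-i\bar q_\pm\zeta^{-1}&1\end{pmatrix},$$ for $\zeta\in\Sigma_\Omega$, and moreover for $\zeta\in D_1$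 for the columns $\psi_{-,1},\psi_{+,2}$ and for $\zeta\in D_2$ for the columns $\psi_{+,1},\psi_{-,2}$. On $\Sigma_\Omega$ let $\psi_-=\psi_+s(\zeta)$ with $s=\begin{pmatrix}a&\tilde b\\ b&\tilde a\end{pmatrix}$ independent of $x,t$, and $r=b/a$. Extend $a$ to $D_1$ by $a=\det(\psi_{-,1},\psi_{+,2})/(1+q_0^2\zeta^{-2})$ and $\tilde a$ to $D_2$ by $\tilde a=\det(\psi_{+,1},\psi_{-,2})/(1+q_0^2\zeta^{-2})$. Assume that the zeros of $a$ in $\{|\zeta|>q_0,\ \operatorname{Im}\zeta>0\}$ are finitely many distinct points $\zeta_1,\dots,\zeta_{N_1}$ ($N_1\ge0$), all simple, and that there are no spectral singularities: $a\neq0$ on $\Sigma_\Omega$, and $|a|$ is bounded away from $0$ on $D_1\cup\Sigma_\Omega$ near $\pm iq_0$. Let $\psi_{-,1}=b_j\psi_{+,2}$ at $\zeta_j$ and $\psi_{-,2}=\tilde b_j\psi_{+,1}$ at $\bar\zeta_j$, with $b_j,\tilde b_j$ independent of $x,t$; put $c_j=b_j/a'(\zeta_j)$ and, for $1\le j\le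 N_1$, $$\bar\eta_j=\bar\zeta_j,\quad \tilde c_j=\frac{\tilde b_j}{\tilde a'(\bar\zeta_j)},\qquad \bar\eta_{N_1+j}=-\frac{q_0^2}{\zeta_j},\quad \tilde c_{N_1+j}=\frac{q_0^2}{\zeta_j^2}\,\frac{q_+}{\bar q_+}\,c_j .$$ Let $\omega_+(x,t)=T\int_x^\infty(|q(y,t)|^2-q_0^2)\,dy$ and, on $\Sigma_\Omega$, with $r^*(\zeta)=\overline{r(\bar\zeta)}$, $$M_2=e^{i\omega_+\sigma_3}\Big(\mu_{+,1},\ \frac{\mu_{-,2}}{\tilde a}\Big),\qquad \tilde J=\begin{pmatrix} r\,r^*& r^*e^{-2i\Theta}\\ re^{2i\Theta}&0\end{pmatrix}.$$ Then for all $x\in\mathbb R$, $t\in S$ $$q(x,t)=e^{i(\Upsilon-\omega_+)}\Big\{q_+e^{-i\omega_+}+i\sum_{j=1}^{2N_1}\tilde c_j\,e^{-2i\Theta(x,t,\bar\eta_j)}\,\mu_{+,11}(x,t,\bar\eta_j)+e^{-i\omega_+}\frac1{2\pi}\int_{\Sigma_\Omega}(M_2\tilde J)_{12}(x,t,\eta)\,d\eta\Big\},$$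 where $\mu_{+,11}$ is the first component of $\mu_{+,1}$. Here the integrand is integrable over bounded parts of $\Sigma_\Omega$, and the integral is the (existing) limit as $R\to\infty$ of the integrals over $\Sigma_\Omega\cap\{|\eta|\le R\}$. -/

import Mathlib

open Complex MeasureTheory Filter Topology
open scoped ComplexConjugate Matrix

noncomputable section

namespace KunduEckhaus

/-- The constants of the boundary value problem: the coefficient `T` of the equation, the wave
number `α` of the background, its amplitude `q₀ > 0`, and the boundary values
`q_± = q₀ exp (i θ_±)` (`qp` is `q_+`, `qm` is `q_-`). -/
structure Params where
  T : ℝ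
  α : ℝ
  q0 : ℝ
  qp : ℂ
  qm : ℂ
  q0_pos : 0 < q0
  norm_qp : ‖qp‖ = q0
  norm_qm : ‖qm‖ = q0

variable (P : Params)

/-- The phase `Υ = α x + (2 q₀² + 4 T² q₀⁴ - α²) t` of the background. -/
def Upsilon (x t : ℝ) : ℝ :=
  P.α * x + (2 * P.q0 ^ 2 + 4 * P.T ^ 2 * P.q0 ^ 4 - P.α ^ 2) * t

/-- `q exp (-i Υ)`, the potential relative to the oscillating background. -/
def env (q : ℝ → ℝ → ℂ) (x t : ℝ) : ℂ := q x t * exp (-I * Upsilon P x t)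

/-- Classical solutions, for times in `S`, of the focusing Kundu-Eckhaus equation
`i q_t + q_xx + 2 |q|² q + 4 T² |q|⁴ q - 4 i T (|q|²)_x q = 0`. -/
structure IsSolution (S : Set ℝ) (q : ℝ → ℝ → ℂ) : Prop where
  contDiff : ∀ t ∈ S, ContDiff ℝ 2 (fun x => q x t)
  equation : ∀ x : ℝ, ∀ t ∈ S, ∃ qt : ℂ, HasDerivWithinAt (fun s => q x s) qt S t ∧
    I * qt + deriv (deriv (fun y => q y t)) x + 2 * (‖q x t‖ ^ 2 : ℝ) * q x t
      + 4 * P.T ^ 2 * (‖q x t‖ ^ 4 : ℝ) * q x t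
      - 4 * I * P.T * (deriv (fun y => ‖q y t‖ ^ 2) x : ℝ) * q x t = 0

/-- The nonzero boundary conditions `q ~ q_± exp (i Υ)` as `x → ±∞`, in the weighted `L¹` sense,
with an integrable `x`-derivative of `q exp (-i Υ)`. -/
structure HasNZBC (S : Set ℝ) (q : ℝ → ℝ → ℂ) : Prop where
  tendsto_atTop : ∀ t ∈ S, Tendsto (fun x => env P q x t) atTop (𝓝 P.qp)
  tendsto_atBot : ∀ t ∈ S, Tendsto (fun x => env P q x t) atBot (𝓝 P.qm)
  integrable_right : ∀ t ∈ S,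
    IntegrableOn (fun x : ℝ => (1 + |x|) * ‖env P q x t - P.qp‖) (Set.Ioi 0)
  integrable_left : ∀ t ∈ S,
    IntegrableOn (fun x : ℝ => (1 + |x|) * ‖env P q x t - P.qm‖) (Set.Iio 0)
  integrable_deriv : ∀ t ∈ S, Integrable (fun x => deriv (fun y => env P q y t) x)

/-- `λ = (ζ + q₀² / ζ) / 2`. -/
def lam (ζ : ℂ) : ℂ := (ζ + P.q0 ^ 2 / ζ) / 2

/-- `z̃ = (ζ - q₀² / ζ) / 2`. -/
def zTilde (ζ : ℂ) : ℂ := (ζ - P.q0 ^ 2 / ζ) / 2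

/-- The spectral parameter `z`, where `z̃ = z - T q₀² + α / 2`. -/
def spec (ζ : ℂ) : ℂ := zTilde P ζ + P.T * P.q0 ^ 2 - P.α / 2

/-- `Θ = λ (x + 2 (z + T q₀² - α / 2) t)`. -/
def Theta (x t : ℝ) (ζ : ℂ) : ℂ :=
  lam P ζ * (x + 2 * (spec P ζ + P.T * P.q0 ^ 2 - P.α / 2) * t)

/-- The Pauli matrix `σ₃`. -/
def sigma3 : Matrix (Fin 2) (Fin 2) ℂ := !![1, 0; 0, -1]

/-- `exp (c σ₃)`. -/
def expSigma3 (c : ℂ) : Matrix (Fin 2) (Fin 2) ℂ := !![exp c, 0; 0, exp (-c)]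

/-- The matrix `U` of the space part of the Lax pair. -/
def laxU (q : ℝ → ℝ → ℂ) (x t : ℝ) : Matrix (Fin 2) (Fin 2) ℂ :=
  !![I * P.T * (‖q x t‖ ^ 2 : ℝ), q x t * exp (-I * Upsilon P x t);
     -conj (q x t) * exp (I * Upsilon P x t), -I * P.T * (‖q x t‖ ^ 2 : ℝ)]

/-- The matrix `V` of the time part of the Lax pair, at the spectral parameter `z`. -/
def laxV (q : ℝ → ℝ → ℂ) (x t : ℝ) (z : ℂ) : Matrix (Fin 2) (Fin 2) ℂ :=
  let u : ℂ := q x t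
  let ux : ℂ := deriv (fun y => q y t) x
  let d : ℂ := I * (‖u‖ ^ 2 : ℝ) + 4 * I * P.T ^ 2 * (‖u‖ ^ 4 : ℝ)
    + P.T * (u * conj ux - ux * conj u)
  !![d, (I * ux + 2 * z * u + 2 * P.T * (‖u‖ ^ 2 : ℝ) * u) * exp (-I * Upsilon P x t);
     (I * conj ux - 2 * z * conj u - 2 * P.T * (‖u‖ ^ 2 : ℝ) * conj u)
       * exp (I * Upsilon P x t), -d]

/-- Coefficient matrix of the space part `Ψ_x = (U - i (z + α / 2) σ₃) Ψ`. -/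
def laxX (q : ℝ → ℝ → ℂ) (x t : ℝ) (ζ : ℂ) : Matrix (Fin 2) (Fin 2) ℂ :=
  laxU P q x t - (I * (spec P ζ + P.α / 2)) • sigma3

/-- Coefficient matrix of the time part
`Ψ_t = (V - 2 i (z² + (2 q₀² + 4 T² q₀⁴ - α²) / 4) σ₃) Ψ`. -/
def laxT (q : ℝ → ℝ → ℂ) (x t : ℝ) (ζ : ℂ) : Matrix (Fin 2) (Fin 2) ℂ :=
  laxV P q x t (spec P ζ) - (2 * I * (spec P ζ ^ 2
    + (2 * P.q0 ^ 2 + 4 * P.T ^ 2 * P.q0 ^ 4 - P.α ^ 2) / 4)) • sigma3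

/-- The region `D₁`. -/
def D1 : Set ℂ := {ζ | 0 < (‖ζ‖ ^ 2 - P.q0 ^ 2) * ζ.im}

/-- The region `D₂`. -/
def D2 : Set ℂ := {ζ | (‖ζ‖ ^ 2 - P.q0 ^ 2) * ζ.im < 0}

/-- The contour `Σ_Ω`: the real line and the circle of radius `q₀`, without the branch points
`± i q₀` (and without `0`, where `λ` is infinite). -/
def Sigma : Set ℂ :=
  {ζ | ζ ≠ 0 ∧ ζ ≠ I * P.q0 ∧ ζ ≠ -(I * P.q0) ∧ (ζ.im = 0 ∨ ‖ζ‖ = P.q0)}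

/-- `Ẽ_±(ζ)`, where `Q` is the boundary value `q_±`. -/
def Einf (Q ζ : ℂ) : Matrix (Fin 2) (Fin 2) ℂ :=
  !![1, -I * Q / ζ; -I * conj Q / ζ, 1]

/-- The modified function `μ = ψ exp (i Θ σ₃)`. -/
def mu (ψ : ℝ → ℝ → ℂ → Matrix (Fin 2) (Fin 2) ℂ) (x t : ℝ) (ζ : ℂ) :
    Matrix (Fin 2) (Fin 2) ℂ :=
  ψ x t ζ * expSigma3 (I * Theta P x t ζ)

/-- The `k`-th column of `ψ (·, ·, ζ)` is a simultaneous solution of both parts of the Lax pair,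
and the `k`-th column of `μ` tends to that of `Ẽ` as `x` tends to the infinity `l`. -/
structure IsJostColumn (S : Set ℝ) (q : ℝ → ℝ → ℂ) (l : Filter ℝ) (Q : ℂ)
    (ψ : ℝ → ℝ → ℂ → Matrix (Fin 2) (Fin 2) ℂ) (k : Fin 2) (ζ : ℂ) : Prop where
  space : ∀ x : ℝ, ∀ t ∈ S, HasDerivAt (fun y i => ψ y t ζ i k)
    (laxX P q x t ζ *ᵥ fun i => ψ x t ζ i k) x
  time : ∀ x : ℝ, ∀ t ∈ S, HasDerivWithinAt (fun s i => ψ x s ζ i k)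
    (laxT P q x t ζ *ᵥ fun i => ψ x t ζ i k) S t
  limit : ∀ t ∈ S, Tendsto (fun x i => mu P ψ x t ζ i k) l (𝓝 fun i => Einf Q ζ i k)

/-- `ψp`, `ψm` are the Jost solutions `ψ_+`, `ψ_-`. On `Σ_Ω` all columns are meaningful; off the
contour only those which decay at their own end: `ψ_{-,1}`, `ψ_{+,2}` in `D₁` and
`ψ_{+,1}`, `ψ_{-,2}` in `D₂`. -/
structure IsJost (S : Set ℝ) (q : ℝ → ℝ → ℂ)
    (ψp ψm : ℝ → ℝ → ℂ → Matrix (Fin 2) (Fin 2) ℂ) : Prop where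
  plus_first : ∀ ζ ∈ D2 P ∪ Sigma P, IsJostColumn P S q atTop P.qp ψp 0 ζ
  plus_second : ∀ ζ ∈ D1 P ∪ Sigma P, IsJostColumn P S q atTop P.qp ψp 1 ζ
  minus_first : ∀ ζ ∈ D1 P ∪ Sigma P, IsJostColumn P S q atBot P.qm ψm 0 ζ
  minus_second : ∀ ζ ∈ D2 P ∪ Sigma P, IsJostColumn P S q atBot P.qm ψm 1 ζ

section Scattering

variable (S : Set ℝ) (ψp ψm : ℝ → ℝ → ℂ → Matrix (Fin 2) (Fin 2) ℂ)

/-- The scattering matrix: the `s(ζ)`, independent of `x` and `t`, with `ψ_- = ψ_+ s(ζ)`. -/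
def scat (ζ : ℂ) : Matrix (Fin 2) (Fin 2) ℂ :=
  Classical.epsilon fun s => ∀ x : ℝ, ∀ t ∈ S, ψm x t ζ = ψp x t ζ * s

/-- Wronskian of the `j`-th column of `A` and the `k`-th column of `B`. -/
def wronskian (A B : Matrix (Fin 2) (Fin 2) ℂ) (j k : Fin 2) : ℂ :=
  A 0 j * B 1 k - A 1 j * B 0 k

open Classical in
/-- `a(ζ)`: the entry `s₁₁` on `Σ_Ω`, extended to `D₁` by its Wronskian representation
`W(ψ_{-,1}, ψ_{+,2}) / det Ẽ_+` with `det Ẽ_+ = 1 + q₀² / ζ²`. -/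
def scatA (ζ : ℂ) : ℂ :=
  if ζ ∈ Sigma P then scat S ψp ψm ζ 0 0
  else wronskian (ψm 0 0 ζ) (ψp 0 0 ζ) 0 1 / (1 + P.q0 ^ 2 / ζ ^ 2)

open Classical in
/-- `ã(ζ)`: the entry `s₂₂` on `Σ_Ω`, extended to `D₂` by its Wronskian representation
`W(ψ_{+,1}, ψ_{-,2}) / det Ẽ_+`. -/
def scatAt (ζ : ℂ) : ℂ :=
  if ζ ∈ Sigma P then scat S ψp ψm ζ 1 1
  else wronskian (ψp 0 0 ζ) (ψm 0 0 ζ) 0 1 / (1 + P.q0 ^ 2 / ζ ^ 2)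

/-- The reflection coefficient `r = b / a` on `Σ_Ω`, with `b = s₂₁`. -/
def refl (ζ : ℂ) : ℂ := scat S ψp ψm ζ 1 0 / scatA P S ψp ψm ζ

/-- `b_j`: the constant, independent of `x` and `t`, with `ψ_{-,1} = b_j ψ_{+,2}` at `ζ_j`. -/
def normB (ζ : ℂ) : ℂ :=
  Classical.epsilon fun b => ∀ x : ℝ, ∀ t ∈ S, ∀ i, ψm x t ζ i 0 = b * ψp x t ζ i 1

/-- `b̃_j`: the constant, independent of `x` and `t`, with `ψ_{-,2} = b̃_j ψ_{+,1}` at the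
conjugate of `ζ_j`. -/
def normBt (ζ : ℂ) : ℂ :=
  Classical.epsilon fun b => ∀ x : ℝ, ∀ t ∈ S, ∀ i, ψm x t ζ i 1 = b * ψp x t ζ i 0

/-- The points `ζ_j`, `j = 1, …, N₁`, are the distinct zeros of `a` in
`|ζ| > q₀`, `Im ζ > 0`; they are simple; and there are no spectral singularities: `a` has no zero
on `Σ_Ω` and stays away from zero near the branch points. -/
structure SimpleSpectrum {N : ℕ} (ζs : Fin N → ℂ) : Prop where
  injective : Function.Injective ζs
  zeros : ∀ ζ : ℂ, (P.q0 < ‖ζ‖ ∧ 0 < ζ.im ∧ scatA P S ψp ψm ζ = 0) ↔ ζ ∈ Set.range ζs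
  simple : ∀ j, deriv (scatA P S ψp ψm) (ζs j) ≠ 0
  ne_zero : ∀ ζ ∈ Sigma P, scatA P S ψp ψm ζ ≠ 0
  branch : ∃ c > 0, ∃ δ > 0, ∀ ζ ∈ D1 P ∪ Sigma P,
    (‖ζ - I * P.q0‖ < δ ∨ ‖ζ + I * P.q0‖ < δ) → c ≤ ‖scatA P S ψp ψm ζ‖

/-- The points `η̄_j`, `j = 1, …, 2 N₁`: first `ζ̄_j`, then `-q₀² / ζ_j`. -/
def etaBar {N : ℕ} (ζs : Fin N → ℂ) : Fin N ⊕ Fin N → ℂ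
  | Sum.inl j => conj (ζs j)
  | Sum.inr j => -(P.q0 ^ 2 / ζs j)

/-- The norming constants `c̃_j`, `j = 1, …, 2 N₁`: first `b̃_j / ã'(ζ̄_j)`, then
`(q₀² / ζ_j²) (q_+ / q̄_+) c_j` with `c_j = b_j / a'(ζ_j)`. -/
def cTilde {N : ℕ} (ζs : Fin N → ℂ) : Fin N ⊕ Fin N → ℂ
  | Sum.inl j => normBt S ψp ψm (conj (ζs j)) / deriv (scatAt P S ψp ψm) (conj (ζs j))
  | Sum.inr j => P.q0 ^ 2 / ζs j ^ 2 * (P.qp / conj P.qp)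
      * (normB S ψp ψm (ζs j) / deriv (scatA P S ψp ψm) (ζs j))

/-- `ω_+ = T ∫_x^∞ (|q|² - q₀²) dy`. -/
def omegaPlus (q : ℝ → ℝ → ℂ) (x t : ℝ) : ℝ :=
  P.T * ∫ y in Set.Ioi x, (‖q y t‖ ^ 2 - P.q0 ^ 2)

/-- `M₂ = exp (i ω_+ σ₃) (μ_{+,1}, μ_{-,2} / ã)`. -/
def M2 (q : ℝ → ℝ → ℂ) (x t : ℝ) (ζ : ℂ) : Matrix (Fin 2) (Fin 2) ℂ :=
  expSigma3 (I * omegaPlus P q x t) *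
    !![mu P ψp x t ζ 0 0, mu P ψm x t ζ 0 1 / scatAt P S ψp ψm ζ;
       mu P ψp x t ζ 1 0, mu P ψm x t ζ 1 1 / scatAt P S ψp ψm ζ]

/-- `J̃`, the difference of the jump matrix and the identity. Here the conjugate of `r` is the
Schwarz conjugate `conj (r (conj ζ))`; on the real line it is `conj (r ζ)`. -/
def Jtilde (x t : ℝ) (ζ : ℂ) : Matrix (Fin 2) (Fin 2) ℂ :=
  !![refl P S ψp ψm ζ * conj (refl P S ψp ψm (conj ζ)),
     conj (refl P S ψp ψm (conj ζ)) * exp (-2 * I * Theta P x t ζ);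
     refl P S ψp ψm ζ * exp (2 * I * Theta P x t ζ), 0]

end Scattering

/-- `f (η) dη` along the circle `η = q₀ exp (i φ)`. -/
def circleForm (f : ℂ → ℂ) (φ : ℝ) : ℂ :=
  f (P.q0 * exp (I * φ)) * (I * P.q0 * exp (I * φ))

/-- Integral of `f` over the part `|η| ≤ R` of `Σ_Ω`, oriented so that `D₁` lies on the right: both
semicircles run from `q₀` to `-q₀`, the segment `(-q₀, q₀)` runs to the right, and the two outer
rays run to the left. -/
def sigmaIntegral (f : ℂ → ℂ) (R : ℝ) : ℂ :=
  (∫ φ in (0 : ℝ)..Real.pi, circleForm P f φ) + (∫ φ in (0 : ℝ)..(-Real.pi), circleForm P f φ)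
    + (∫ s in (-P.q0)..P.q0, f (s : ℂ)) - (∫ s in P.q0..R, f (s : ℂ))
    - ∫ s in (-R)..(-P.q0), f (s : ℂ)

/-- The integral of `f` over `Σ_Ω` exists and equals `J`: `f` is Lebesgue integrable over every
bounded part of `Σ_Ω`, and the integrals over the parts `|η| ≤ R` tend to `J` as `R → ∞`. -/
def HasSigmaIntegral (f : ℂ → ℂ) (J : ℂ) : Prop :=
  IntervalIntegrable (circleForm P f) volume (-Real.pi) Real.pi ∧
  (∀ R : ℝ, IntervalIntegrable (fun s : ℝ => f (s : ℂ)) volume (-R) R) ∧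
  Tendsto (sigmaIntegral P f) atTop (𝓝 J)

end KunduEckhaus

end

open KunduEckhaus

/-!
Fix `x` and `t`. With `λ = (ζ + q₀² / ζ) / 2`, the region `D₁ ∪ Σ_Ω` is given by `Im λ ≥ 0`, `λ ≠ 0`,
and `D₂ ∪ Σ_Ω` by `Im λ ≤ 0`, `λ ≠ 0`; the branch points are the zeros of `λ`. The function
`μ_{+,12}` is holomorphic in `D₁` and continuous up to `Σ_Ω`, `μ_{-,12} / ã` is meromorphic in `D₂`,
and `ψ_- = ψ_+ s` says that on `Σ_Ω` their difference, times `exp (i ω_+)`, is the integrand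
`(M₂ J̃)₁₂` (`IsScatteringSetting.integrand_eq`). So the integral can be evaluated by contour
deformation. After the poles at `η̄_j` have been subtracted from both functions, Cauchy's theorem on
the four sectors cut out by the real line and the circle leaves only the contributions of small and
large arcs, which are given by the limits of `ζ` times the functions at `0` and `∞`
(`hasSigmaIntegral_of_isSectional`). The integral over `|η| ≤ R` converges only as a limit, and near
the branch points only boundedness is available; that suffices for the deformation.

What has to be supplied is the behaviour of the Jost columns. All four are instances of one object,
`IsColumn`: conjugating `ζ` (Schwarz symmetry) exchanges the columns of `ψ_+`, and `x → -x` turns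
`ψ_-` into `ψ_+` for the conjugate reflected potential. A column solves a Volterra equation on a
half-line. The first moment condition makes its kernel integrable even where `λ = 0`, so the column
is unique, holomorphic in `D₁`, continuous on `D₁ ∪ Σ_Ω` and bounded near the branch points
(`IsColumn.unique`, `IsColumn.differentiableOn`, `IsColumn.continuousOn`,
`IsColumn.locally_bounded`). At `∞` a gauge transformation removes the diagonal term of the
potential, which produces the factor `exp (i ω_+)`; then the coefficient matrix is diagonalized
pointwise to order `1 / ζ`, and a Riemann-Lebesgue lemma gives `ζ μ_{+,12} → -i p exp (i ω_+)`
(`IsColumn.tendsto_atInfty`), where `p = q exp (-i Υ)` enters. The symmetry `ζ → -q₀² / ζ̄` carries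
this over to `ζ = 0`, where the limit is `-i q_+ exp (-i ω_+)` (`IsColumn.tendsto_zero`).

The poles of `μ_{-,12} / ã` are simple: the two symmetries of `a` show that its zeros in `D₁` are
exactly the `ζ_j` and the `-q₀² / ζ̄_j`. Since Wronskians are constant in `x` and `t`, the columns are
proportional there with a constant factor, and the residues are the summands of the formula
(`IsScatteringSetting.cTilde_eq`). Equating the two evaluations of the integral and solving for `q`
gives the theorem.
-/

namespace KunduEckhaus

/-! ### Volterra equations on a half-line with a parameter -/

/-- The integral of `κ` over `(x, ∞)`. -/
noncomputable def tail (κ : ℝ → ℝ) (x : ℝ) : ℝ := ∫ y in Set.Ioi x, κ y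

theorem hasDerivAt_tail {κ : ℝ → ℝ} (hc : Continuous κ)
    (hi : ∀ a, IntegrableOn κ (Set.Ioi a)) (x : ℝ) : HasDerivAt (tail κ) (-κ x) x := by
  have h1 : tail κ = fun y => tail κ 0 - ∫ s in (0 : ℝ)..y, κ s := by
    funext y
    have := intervalIntegral.integral_Ioi_sub_Ioi' (hi 0) (hi y)
    simp only [tail]
    linarith
  rw [h1]
  have := (intervalIntegral.integral_hasDerivAt_right (hc.intervalIntegrable 0 x)
    (hc.stronglyMeasurableAtFilter _ _) hc.continuousAt)
  simpa using this.const_sub (tail κ 0)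

theorem tendsto_tail (κ : ℝ → ℝ) :
    Tendsto (tail κ) atTop (𝓝 0) :=
  tendsto_integral_Ioi_zero tendsto_id

theorem tail_nonneg {κ : ℝ → ℝ} (h0 : ∀ y, 0 ≤ κ y) (x : ℝ) : 0 ≤ tail κ x :=
  integral_nonneg h0

/-- The weight `exp (2 tail κ)` makes the Volterra operator with kernel bounded by `κ` a
contraction with factor `1 / 2`. -/
theorem integral_mul_exp_tail {κ : ℝ → ℝ} (hc : Continuous κ) (h0 : ∀ y, 0 ≤ κ y)
    (hi : ∀ a, IntegrableOn κ (Set.Ioi a)) (x : ℝ) :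
    IntegrableOn (fun y => κ y * Real.exp (2 * tail κ y)) (Set.Ioi x) ∧
      ∫ y in Set.Ioi x, κ y * Real.exp (2 * tail κ y) = (Real.exp (2 * tail κ x) - 1) / 2 := by
  have hd : ∀ y ∈ Set.Ici x, HasDerivAt (fun y => -(Real.exp (2 * tail κ y) / 2))
      (κ y * Real.exp (2 * tail κ y)) y := by
    intro y _
    have := ((((hasDerivAt_tail hc hi y).const_mul 2).exp).div_const 2).neg
    convert! this using 1
    ring
  have hl : Tendsto (fun y => -(Real.exp (2 * tail κ y) / 2)) atTop (𝓝 (-(1 / 2))) := by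
    have := ((((tendsto_tail κ).const_mul 2).rexp).div_const 2).neg
    simpa using this
  have hn : ∀ y ∈ Set.Ioi x, 0 ≤ κ y * Real.exp (2 * tail κ y) := fun y _ =>
    mul_nonneg (h0 y) (Real.exp_pos _).le
  refine ⟨integrableOn_Ioi_deriv_of_nonneg' hd hn hl, ?_⟩
  rw [integral_Ioi_of_hasDerivAt_of_nonneg' hd hn hl]
  ring

/-- An integral of functions holomorphic in a parameter is holomorphic in it when the integrands
have a common integrable bound. -/
theorem differentiableOn_integral_of_bound {α E : Type*} [MeasurableSpace α] {μ : Measure α}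
    [NormedAddCommGroup E] [NormedSpace ℂ E] [CompleteSpace E] {U : Set ℂ} (hU : IsOpen U)
    {F : ℂ → α → E} {bound : α → ℝ} (hF : ∀ᵐ y ∂μ, DifferentiableOn ℂ (fun ζ => F ζ y) U)
    (hm : ∀ ζ ∈ U, AEStronglyMeasurable (F ζ) μ)
    (hb : ∀ᵐ y ∂μ, ∀ ζ ∈ U, ‖F ζ y‖ ≤ bound y) (hi : Integrable bound μ) :
    DifferentiableOn ℂ (fun ζ => ∫ y, F ζ y ∂μ) U := by
  intro z hz
  obtain ⟨r, hr, hrU⟩ := Metric.isOpen_iff.1 hU z hz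
  have hr2 : 0 < r / 2 := by positivity
  have hsub : ∀ w ∈ Metric.ball z (r / 2), Metric.closedBall w (r / 4) ⊆ U := by
    intro w hw v hv
    apply hrU
    rw [Metric.mem_ball] at hw ⊢
    rw [Metric.mem_closedBall] at hv
    have := dist_triangle v w z
    linarith
  have hball : ∀ w ∈ Metric.ball z (r / 2), w ∈ U := fun w hw =>
    hsub w hw (Metric.mem_closedBall_self (by positivity))
  have hint : ∀ ζ ∈ U, Integrable (F ζ) μ := fun ζ hζ =>
    hi.mono' (hm ζ hζ) (hb.mono fun y hy => hy ζ hζ)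
  have hdm : AEStronglyMeasurable (fun y => deriv (fun ζ => F ζ y) z) μ := by
    have hu : Tendsto (fun n : ℕ => z + ((1 / ((n : ℝ) + 1) : ℝ) : ℂ)) atTop (𝓝[≠] z) := by
      refine tendsto_nhdsWithin_iff.2 ⟨?_, Eventually.of_forall fun n => ?_⟩
      · have h1 : Tendsto (fun n : ℕ => ((1 / ((n : ℝ) + 1) : ℝ) : ℂ)) atTop (𝓝 ((0 : ℝ) : ℂ)) :=
          (continuous_ofReal.tendsto 0).comp tendsto_one_div_add_atTop_nhds_zero_nat
        simpa using h1.const_add z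
      · simp only [Set.mem_compl_iff, Set.mem_singleton_iff, add_eq_left, ofReal_eq_zero]
        positivity
    have huU : ∀ᶠ n : ℕ in atTop, z + ((1 / ((n : ℝ) + 1) : ℝ) : ℂ) ∈ U :=
      (tendsto_nhdsWithin_iff.1 hu).1.eventually (hU.mem_nhds hz)
    obtain ⟨n0, hn0⟩ := eventually_atTop.1 huU
    refine aestronglyMeasurable_of_tendsto_ae (u := (atTop : Filter ℕ))
      (f := fun n y => slope (fun ζ => F ζ y) z (z + ((1 / (((n + n0 : ℕ) : ℝ) + 1) : ℝ) : ℂ)))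
      ?_ ?_
    · intro n
      simp only [slope_def_module]
      exact ((hm _ (hn0 _ (Nat.le_add_left _ _))).sub (hm z hz)).const_smul _
    · filter_upwards [hF] with y hy
      have hd := ((hy z hz).differentiableAt (hU.mem_nhds hz)).hasDerivAt
      have := (hasDerivAt_iff_tendsto_slope.1 hd).comp (hu.comp (tendsto_add_atTop_nat n0))
      exact this
  have := (hasDerivAt_integral_of_dominated_loc_of_deriv_le (μ := μ) (𝕜 := ℂ) (F := F)
    (F' := fun ζ y => deriv (fun ζ => F ζ y) ζ) (x₀ := z) (bound := fun y => bound y / (r / 4))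
    (Metric.ball_mem_nhds z hr2) ?_ (hint z hz) hdm ?_ ?_ ?_).2
  · exact this.differentiableAt.differentiableWithinAt
  · filter_upwards [hU.mem_nhds hz] with w hw using hm w hw
  · filter_upwards [hb, hF] with y hy hd w hw
    refine Complex.norm_deriv_le_of_forall_mem_sphere_norm_le (by positivity) ?_ ?_
    · refine DifferentiableOn.diffContOnCl ?_
      rw [closure_ball _ (by positivity)]
      exact hd.mono (hsub w hw)
    · intro v hv
      exact hy v (hsub w hw (Metric.sphere_subset_closedBall hv))
  · exact hi.div_const _
  · filter_upwards [hF] with y hd w hw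
    exact ((hd w (hball w hw)).differentiableAt (hU.mem_nhds (hball w hw))).hasDerivAt

section Volterra

variable {E : Type*} [NormedAddCommGroup E] [NormedSpace ℂ E]

/-- The Picard iterates, started at `0`, of the Volterra equation
`m ζ x = e ζ - ∫_x^∞ K ζ x y (m ζ y) dy`. -/
noncomputable def volterraIter (K : ℂ → ℝ → ℝ → E →L[ℂ] E) (e : ℂ → E) : ℕ → ℂ → ℝ → E
  | 0, _, _ => 0
  | n + 1, ζ, x => e ζ - ∫ y in Set.Ioi x, K ζ x y (volterraIter K e n ζ y)

/-- On the parameter set `U` the kernel `K` is jointly continuous in the space variables, and it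
is bounded by the integrable function `κ` of the second one on the half-line starting at `x0`. -/
structure IsVolterraKernel (U : Set ℂ) (x0 : ℝ) (κ : ℝ → ℝ) (K : ℂ → ℝ → ℝ → E →L[ℂ] E) :
    Prop where
  cont_bound : Continuous κ
  nonneg : ∀ y, 0 ≤ κ y
  integrable : ∀ a, IntegrableOn κ (Set.Ioi a)
  cont : ∀ ζ ∈ U, Continuous (fun xy : ℝ × ℝ => K ζ xy.1 xy.2)
  bound : ∀ ζ ∈ U, ∀ x y, x0 ≤ x → x < y → ‖K ζ x y‖ ≤ κ y

variable {U : Set ℂ} {x0 : ℝ} {κ : ℝ → ℝ} {K : ℂ → ℝ → ℝ → E →L[ℂ] E} {e : ℂ → E}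

theorem stronglyMeasurable_kernel_apply (hK : IsVolterraKernel U x0 κ K) {ζ : ℂ} (hζ : ζ ∈ U)
    {u : ℝ → E} (hu : StronglyMeasurable u) :
    StronglyMeasurable (fun xy : ℝ × ℝ => K ζ xy.1 xy.2 (u xy.2)) := by
  have h1 : StronglyMeasurable (fun xy : ℝ × ℝ => K ζ xy.1 xy.2) :=
    (hK.cont ζ hζ).stronglyMeasurable
  have h2 : StronglyMeasurable (fun xy : ℝ × ℝ => u xy.2) := hu.comp_measurable measurable_snd
  exact (isBoundedBilinearMap_apply (𝕜 := ℂ) (E := E) (F := E)).continuous.comp_stronglyMeasurable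
    (h1.prodMk h2)

theorem stronglyMeasurable_kernel_apply_right (hK : IsVolterraKernel U x0 κ K) {ζ : ℂ}
    (hζ : ζ ∈ U) {u : ℝ → E} (hu : StronglyMeasurable u) (x : ℝ) :
    StronglyMeasurable (fun y => K ζ x y (u y)) :=
  (stronglyMeasurable_kernel_apply hK hζ hu).comp_measurable measurable_prodMk_left

theorem stronglyMeasurable_volterraIter (hK : IsVolterraKernel U x0 κ K) {ζ : ℂ} (hζ : ζ ∈ U)
    (n : ℕ) : StronglyMeasurable (volterraIter K e n ζ) := by
  induction n with
  | zero => exact stronglyMeasurable_const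
  | succ n ih =>
    have h1 := stronglyMeasurable_kernel_apply hK hζ ih
    have h2 : MeasurableSet {xy : ℝ × ℝ | xy.1 < xy.2} :=
      measurableSet_lt measurable_fst measurable_snd
    have h3 := (h1.indicator h2).integral_prod_right' (ν := (volume : Measure ℝ))
    have h4 : volterraIter K e (n + 1) ζ = fun x => e ζ - ∫ y,
        Set.indicator {xy : ℝ × ℝ | xy.1 < xy.2}
          (fun xy : ℝ × ℝ => K ζ xy.1 xy.2 (volterraIter K e n ζ xy.2)) (x, y) := by
      funext x
      simp only [volterraIter]
      rw [← integral_indicator measurableSet_Ioi]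
      rfl
    rw [h4]
    exact stronglyMeasurable_const.sub h3

/-- If `u` is bounded by a multiple of the weight, so is its image under the Volterra operator,
with half the constant. -/
theorem norm_integral_kernel_le (hK : IsVolterraKernel U x0 κ K) {ζ : ℂ} (hζ : ζ ∈ U)
    {u : ℝ → E} (hm : AEStronglyMeasurable u) {B : ℝ}
    (hu : ∀ x, x0 ≤ x → ‖u x‖ ≤ B * Real.exp (2 * tail κ x)) {x : ℝ} (hx : x0 ≤ x) :
    IntegrableOn (fun y => K ζ x y (u y)) (Set.Ioi x) ∧
    ‖∫ y in Set.Ioi x, K ζ x y (u y)‖ ≤ B / 2 * (Real.exp (2 * tail κ x) - 1) := by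
  obtain ⟨hi, he⟩ := integral_mul_exp_tail hK.cont_bound hK.nonneg hK.integrable x
  have hle : ∀ y ∈ Set.Ioi x, ‖K ζ x y (u y)‖ ≤ B * (κ y * Real.exp (2 * tail κ y)) := by
    intro y hy
    have hy' : x < y := hy
    calc ‖K ζ x y (u y)‖ ≤ ‖K ζ x y‖ * ‖u y‖ := (K ζ x y).le_opNorm _
      _ ≤ κ y * (B * Real.exp (2 * tail κ y)) :=
        mul_le_mul (hK.bound ζ hζ x y hx hy') (hu y (hx.trans hy'.le)) (norm_nonneg _)
          (hK.nonneg y)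
      _ = _ := by ring
  have hkm : StronglyMeasurable (fun y => K ζ x y) :=
    ((hK.cont ζ hζ).comp (Continuous.prodMk_right x)).stronglyMeasurable
  have hmeas : AEStronglyMeasurable (fun y => K ζ x y (u y)) :=
    (isBoundedBilinearMap_apply (𝕜 := ℂ) (E := E) (F := E)).continuous.comp_aestronglyMeasurable
      (hkm.aestronglyMeasurable.prodMk hm)
  have hint : IntegrableOn (fun y => K ζ x y (u y)) (Set.Ioi x) :=
    Integrable.mono' (hi.const_mul B) hmeas.restrict
      ((ae_restrict_mem measurableSet_Ioi).mono hle)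
  refine ⟨hint, ?_⟩
  calc ‖∫ y in Set.Ioi x, K ζ x y (u y)‖
      ≤ ∫ y in Set.Ioi x, B * (κ y * Real.exp (2 * tail κ y)) :=
        norm_integral_le_of_norm_le (hi.const_mul B) ((ae_restrict_mem measurableSet_Ioi).mono hle)
    _ = _ := by rw [integral_const_mul, he]; ring

theorem norm_volterraIter_le (hK : IsVolterraKernel U x0 κ K) {ζ : ℂ} (hζ : ζ ∈ U) {B : ℝ}
    (he : ‖e ζ‖ ≤ B) (n : ℕ) {x : ℝ} (hx : x0 ≤ x) :
    ‖volterraIter K e n ζ x‖ ≤ 2 * B * Real.exp (2 * tail κ x) := by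
  have hB : 0 ≤ B := (norm_nonneg _).trans he
  induction n generalizing x with
  | zero => simp only [volterraIter, norm_zero]; positivity
  | succ n ih =>
    have h1 := (norm_integral_kernel_le hK hζ
      (stronglyMeasurable_volterraIter (e := e) hK hζ n).aestronglyMeasurable
      (fun x hx => ih hx) hx).2
    have h2 : 1 ≤ Real.exp (2 * tail κ x) :=
      Real.one_le_exp (by have := tail_nonneg hK.nonneg x; positivity)
    simp only [volterraIter]
    refine (norm_sub_le _ _).trans ?_
    nlinarith

/-- A bounded solution of the Volterra equation at the parameter `ζ`. -/
structure IsVolterraSol (x0 : ℝ) (K : ℂ → ℝ → ℝ → E →L[ℂ] E) (e : ℂ → E) (ζ : ℂ) (m : ℝ → E) :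
    Prop where
  meas : AEStronglyMeasurable m
  bounded : ∃ C, ∀ x, x0 ≤ x → ‖m x‖ ≤ C
  eq : ∀ x, x0 ≤ x → m x = e ζ - ∫ y in Set.Ioi x, K ζ x y (m y)

theorem norm_sub_volterraIter_le (hK : IsVolterraKernel U x0 κ K) {ζ : ℂ} (hζ : ζ ∈ U)
    {m : ℝ → E} (hm : IsVolterraSol x0 K e ζ m) {B : ℝ} (hB : 0 ≤ B)
    (hmB : ∀ x, x0 ≤ x → ‖m x‖ ≤ B * Real.exp (2 * tail κ x)) {D : ℝ} (he : ‖e ζ‖ ≤ D) (n : ℕ)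
    {x : ℝ} (hx : x0 ≤ x) :
    ‖m x - volterraIter K e n ζ x‖ ≤ B * (1 / 2) ^ n * Real.exp (2 * tail κ x) := by
  induction n generalizing x with
  | zero => simpa [volterraIter] using hmB x hx
  | succ n ih =>
    have hmeas := (stronglyMeasurable_volterraIter (e := e) hK hζ n).aestronglyMeasurable
      (μ := volume)
    have hD : 0 ≤ D := (norm_nonneg _).trans he
    have i1 := (norm_integral_kernel_le hK hζ hm.meas hmB hx).1
    have i2 := (norm_integral_kernel_le hK hζ hmeas (B := 2 * D)
      (fun x hx => norm_volterraIter_le hK hζ he n hx) hx).1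
    have h1 := (norm_integral_kernel_le hK hζ (hm.meas.sub hmeas) (B := B * (1 / 2) ^ n)
      (fun x hx => ih hx) hx).2
    have h2 : m x - volterraIter K e (n + 1) ζ x
        = -∫ y in Set.Ioi x, K ζ x y ((m - volterraIter K e n ζ) y) := by
      rw [hm.eq x hx]
      simp only [volterraIter, Pi.sub_apply, map_sub]
      rw [integral_sub i1 i2]
      abel
    rw [h2, norm_neg]
    refine h1.trans ?_
    have : 0 ≤ B * (1 / 2) ^ n := by positivity
    rw [pow_succ]
    nlinarith

theorem IsVolterraSol.tendsto_iter (hK : IsVolterraKernel U x0 κ K) {ζ : ℂ} (hζ : ζ ∈ U)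
    {m : ℝ → E} (hm : IsVolterraSol x0 K e ζ m) {x : ℝ} (hx : x0 ≤ x) :
    Tendsto (fun n => volterraIter K e n ζ x) atTop (𝓝 (m x)) := by
  obtain ⟨C, hC⟩ := hm.bounded
  have hC0 : 0 ≤ C := (norm_nonneg _).trans (hC x0 le_rfl)
  have hmB : ∀ x, x0 ≤ x → ‖m x‖ ≤ C * Real.exp (2 * tail κ x) := fun x hx => by
    have h2 : 1 ≤ Real.exp (2 * tail κ x) :=
      Real.one_le_exp (by have := tail_nonneg hK.nonneg x; positivity)
    have := hC x hx
    nlinarith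
  rw [tendsto_iff_norm_sub_tendsto_zero]
  refine squeeze_zero (fun _ => norm_nonneg _) (fun n => ?_)
    (g := fun n => C * (1 / 2) ^ n * Real.exp (2 * tail κ x)) ?_
  · rw [norm_sub_rev]
    exact norm_sub_volterraIter_le hK hζ hm hC0 hmB le_rfl n hx
  · have := ((tendsto_pow_atTop_nhds_zero_of_lt_one (r := (1 / 2 : ℝ)) (by norm_num)
      (by norm_num)).const_mul C).mul_const (Real.exp (2 * tail κ x))
    simpa using this

theorem IsVolterraSol.unique (hK : IsVolterraKernel U x0 κ K) {ζ : ℂ} (hζ : ζ ∈ U)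
    {m m' : ℝ → E} (hm : IsVolterraSol x0 K e ζ m) (hm' : IsVolterraSol x0 K e ζ m') {x : ℝ}
    (hx : x0 ≤ x) : m x = m' x :=
  tendsto_nhds_unique (hm.tendsto_iter hK hζ hx) (hm'.tendsto_iter hK hζ hx)

theorem IsVolterraSol.norm_le (hK : IsVolterraKernel U x0 κ K) {ζ : ℂ} (hζ : ζ ∈ U)
    {m : ℝ → E} (hm : IsVolterraSol x0 K e ζ m) {B : ℝ} (he : ‖e ζ‖ ≤ B) {x : ℝ}
    (hx : x0 ≤ x) : ‖m x‖ ≤ 2 * B * Real.exp (2 * tail κ x) :=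
  le_of_tendsto' (hm.tendsto_iter hK hζ hx).norm fun n => norm_volterraIter_le hK hζ he n hx

theorem continuousOn_volterraIter (hK : IsVolterraKernel U x0 κ K)
    (hKc : ∀ x y, ContinuousOn (fun ζ => K ζ x y) U) (hec : ContinuousOn e U) {B : ℝ}
    (he : ∀ ζ ∈ U, ‖e ζ‖ ≤ B) (n : ℕ) {x : ℝ} (hx : x0 ≤ x) :
    ContinuousOn (fun ζ => volterraIter K e n ζ x) U := by
  induction n generalizing x with
  | zero => exact continuousOn_const
  | succ n ih =>
    simp only [volterraIter]
    refine hec.sub (continuousOn_of_dominated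
      (bound := fun y => 2 * B * (κ y * Real.exp (2 * tail κ y))) ?_ ?_ ?_ ?_)
    · intro ζ hζ
      exact (stronglyMeasurable_kernel_apply_right hK hζ
        (stronglyMeasurable_volterraIter hK hζ n) x).aestronglyMeasurable
    · intro ζ hζ
      filter_upwards [ae_restrict_mem measurableSet_Ioi] with y hy
      have hy' : x < y := hy
      calc _ ≤ ‖K ζ x y‖ * ‖volterraIter K e n ζ y‖ := (K ζ x y).le_opNorm _
        _ ≤ κ y * (2 * B * Real.exp (2 * tail κ y)) :=
          mul_le_mul (hK.bound ζ hζ x y hx hy')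
            (norm_volterraIter_le hK hζ (he ζ hζ) n (hx.trans hy'.le)) (norm_nonneg _)
            (hK.nonneg y)
        _ = _ := by ring
    · exact (integral_mul_exp_tail hK.cont_bound hK.nonneg hK.integrable x).1.const_mul _
    · filter_upwards [ae_restrict_mem measurableSet_Ioi] with y hy
      exact (hKc x y).clm_apply (ih (hx.trans (le_of_lt hy)))

theorem differentiableOn_volterraIter [CompleteSpace E] (hU : IsOpen U)
    (hK : IsVolterraKernel U x0 κ K)
    (hKd : ∀ x y, DifferentiableOn ℂ (fun ζ => K ζ x y) U) (hed : DifferentiableOn ℂ e U) {B : ℝ}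
    (he : ∀ ζ ∈ U, ‖e ζ‖ ≤ B) (n : ℕ) {x : ℝ} (hx : x0 ≤ x) :
    DifferentiableOn ℂ (fun ζ => volterraIter K e n ζ x) U := by
  induction n generalizing x with
  | zero => exact differentiableOn_const _
  | succ n ih =>
    simp only [volterraIter]
    refine hed.sub (differentiableOn_integral_of_bound hU
      (bound := fun y => 2 * B * (κ y * Real.exp (2 * tail κ y))) ?_ ?_ ?_ ?_)
    · filter_upwards [ae_restrict_mem measurableSet_Ioi] with y hy
      exact (hKd x y).clm_apply (ih (hx.trans (le_of_lt hy)))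
    · intro ζ hζ
      exact (stronglyMeasurable_kernel_apply_right hK hζ
        (stronglyMeasurable_volterraIter hK hζ n) x).aestronglyMeasurable
    · filter_upwards [ae_restrict_mem measurableSet_Ioi] with y hy ζ hζ
      have hy' : x < y := hy
      calc _ ≤ ‖K ζ x y‖ * ‖volterraIter K e n ζ y‖ := (K ζ x y).le_opNorm _
        _ ≤ κ y * (2 * B * Real.exp (2 * tail κ y)) :=
          mul_le_mul (hK.bound ζ hζ x y hx hy')
            (norm_volterraIter_le hK hζ (he ζ hζ) n (hx.trans hy'.le)) (norm_nonneg _)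
            (hK.nonneg y)
        _ = _ := by ring
    · exact (integral_mul_exp_tail hK.cont_bound hK.nonneg hK.integrable x).1.const_mul _

theorem tendstoUniformlyOn_volterraIter (hK : IsVolterraKernel U x0 κ K) {B : ℝ}
    (he : ∀ ζ ∈ U, ‖e ζ‖ ≤ B) {m : ℂ → ℝ → E} (hm : ∀ ζ ∈ U, IsVolterraSol x0 K e ζ (m ζ))
    {x : ℝ} (hx : x0 ≤ x) :
    TendstoUniformlyOn (fun n ζ => volterraIter K e n ζ x) (fun ζ => m ζ x) atTop U := by
  rcases U.eq_empty_or_nonempty with rfl | ⟨ζ0, hζ0⟩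
  · exact tendstoUniformlyOn_empty
  have hB : 0 ≤ B := (norm_nonneg _).trans (he ζ0 hζ0)
  have hlim : Tendsto (fun n : ℕ => 2 * B * (1 / 2) ^ n * Real.exp (2 * tail κ x)) atTop
      (𝓝 0) := by
    have := ((tendsto_pow_atTop_nhds_zero_of_lt_one (r := (1 / 2 : ℝ)) (by norm_num)
      (by norm_num)).const_mul (2 * B)).mul_const (Real.exp (2 * tail κ x))
    simpa using this
  rw [Metric.tendstoUniformlyOn_iff]
  intro ε hε
  filter_upwards [hlim.eventually_lt_const hε] with n hn ζ hζ
  rw [dist_eq_norm]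
  exact (norm_sub_volterraIter_le hK hζ (hm ζ hζ) (by positivity)
    (fun x hx => (hm ζ hζ).norm_le hK hζ (he ζ hζ) hx) (he ζ hζ) n hx).trans_lt hn

theorem IsVolterraSol.continuousOn (hK : IsVolterraKernel U x0 κ K)
    (hKc : ∀ x y, ContinuousOn (fun ζ => K ζ x y) U) (hec : ContinuousOn e U) {B : ℝ}
    (he : ∀ ζ ∈ U, ‖e ζ‖ ≤ B) {m : ℂ → ℝ → E} (hm : ∀ ζ ∈ U, IsVolterraSol x0 K e ζ (m ζ))
    {x : ℝ} (hx : x0 ≤ x) : ContinuousOn (fun ζ => m ζ x) U :=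
  (tendstoUniformlyOn_volterraIter hK he hm hx).continuousOn
    (Frequently.of_forall fun n => continuousOn_volterraIter hK hKc hec he n hx)

theorem IsVolterraSol.differentiableOn [CompleteSpace E] (hU : IsOpen U)
    (hK : IsVolterraKernel U x0 κ K)
    (hKd : ∀ x y, DifferentiableOn ℂ (fun ζ => K ζ x y) U) (hed : DifferentiableOn ℂ e U) {B : ℝ}
    (he : ∀ ζ ∈ U, ‖e ζ‖ ≤ B) {m : ℂ → ℝ → E} (hm : ∀ ζ ∈ U, IsVolterraSol x0 K e ζ (m ζ))
    {x : ℝ} (hx : x0 ≤ x) : DifferentiableOn ℂ (fun ζ => m ζ x) U :=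
  (tendstoUniformlyOn_volterraIter hK he hm hx).tendstoLocallyUniformlyOn.differentiableOn
    (Eventually.of_forall fun n => differentiableOn_volterraIter hU hK hKd hed he n hx) hU

end Volterra

/-! ### Jost columns on a half-line: Volterra equation, uniqueness, regularity -/

/-- The potentials for which the scattering problem at `+∞` is studied: at a fixed time these are
the envelope `q exp (-iΥ)`, with `Q = q₊`, and its conjugate reflection, with the conjugate of
`q₋`. -/
structure IsPotential (P : Params) (p : ℝ → ℂ) (Q : ℂ) : Prop where
  norm_eq : ‖Q‖ = P.q0
  contDiff : ContDiff ℝ 2 p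
  tendsto : Tendsto p atTop (𝓝 Q)
  integrable : IntegrableOn (fun x : ℝ => (1 + |x|) * ‖p x - Q‖) (Set.Ioi 0)
  integrable_deriv : Integrable (deriv p)

/-- `T (|p|² - q₀²)`, the diagonal part of the perturbation of the constant background. -/
noncomputable def tau (P : Params) (p : ℝ → ℂ) (x : ℝ) : ℝ := P.T * (‖p x‖ ^ 2 - P.q0 ^ 2)

/-- `(m1, m2)` is the second column of `μ₊` at `ζ` for the potential `p` with boundary value `Q`:
it solves the space part of the Lax pair, conjugated by `exp (iΘσ₃)`, and has the limit
`(-iQ/ζ, 1)` at `+∞`. -/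
structure IsColumn (P : Params) (p : ℝ → ℂ) (Q ζ : ℂ) (m1 m2 : ℝ → ℂ) : Prop where
  deriv_fst : ∀ x, HasDerivAt m1 ((I * tau P p x - I * ζ) * m1 x + p x * m2 x) x
  deriv_snd : ∀ x, HasDerivAt m2
    (-conj (p x) * m1 x + (-(I * tau P p x) - I * (P.q0 ^ 2 / ζ)) * m2 x) x
  tendsto_fst : Tendsto m1 atTop (𝓝 (-I * Q / ζ))
  tendsto_snd : Tendsto m2 atTop (𝓝 1)

theorem IsPotential.continuous {P : Params} {p : ℝ → ℂ} {Q : ℂ} (h : IsPotential P p Q) :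
    Continuous p := h.contDiff.continuous

/-- A continuous function with a limit at `+∞` is bounded on every half-line. -/
theorem exists_bound_of_tendsto {E : Type*} [NormedAddCommGroup E] {f : ℝ → E} {c : E}
    (hf : Continuous f) (hl : Tendsto f atTop (𝓝 c)) (a : ℝ) :
    ∃ M, 0 ≤ M ∧ ∀ x, a ≤ x → ‖f x‖ ≤ M := by
  obtain ⟨b, hb⟩ := eventually_atTop.1 (hl.norm.eventually_lt_const (lt_add_one ‖c‖))
  obtain ⟨M, hM⟩ := (isCompact_Icc (a := a) (b := b)).exists_bound_of_continuousOn hf.continuousOn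
  refine ⟨max (‖c‖ + 1) M, le_max_of_le_left (by positivity), fun x hx => ?_⟩
  rcases le_total x b with h | h
  · exact (hM x ⟨hx, h⟩).trans (le_max_right _ _)
  · exact (hb x h).le.trans (le_max_left _ _)

theorem integrableOn_Ioi_of_continuous {E : Type*} [NormedAddCommGroup E] {f : ℝ → E}
    (hf : Continuous f) {b : ℝ} (hi : IntegrableOn f (Set.Ioi b)) (a : ℝ) :
    IntegrableOn f (Set.Ioi a) := by
  refine ((hf.integrableOn_Icc (a := a) (b := b)).union hi).mono_set fun x hx => ?_
  rcases le_or_gt x b with h | h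
  · exact Or.inl ⟨le_of_lt hx, h⟩
  · exact Or.inr h

variable {P : Params} {p : ℝ → ℂ} {Q : ℂ}

theorem continuous_tau (hp : Continuous p) : Continuous (tau P p) := by
  unfold tau; fun_prop

theorem IsPotential.weight_integrable (h : IsPotential P p Q) (a : ℝ) :
    IntegrableOn (fun x : ℝ => (1 + |x|) * ‖p x - Q‖) (Set.Ioi a) := by
  refine integrableOn_Ioi_of_continuous ?_ h.integrable a
  have := h.continuous
  fun_prop

theorem IsPotential.abs_tau_le (h : IsPotential P p Q) (a : ℝ) :
    ∃ C, 0 ≤ C ∧ ∀ x, a ≤ x → |tau P p x| ≤ C * ‖p x - Q‖ := by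
  obtain ⟨M, hM0, hM⟩ := exists_bound_of_tendsto h.continuous h.tendsto a
  have hq := P.q0_pos
  refine ⟨|P.T| * (M + P.q0), by positivity, fun x hx => ?_⟩
  have h1 : |‖p x‖ - P.q0| ≤ ‖p x - Q‖ := by rw [← h.norm_eq]; exact abs_norm_sub_norm_le _ _
  have h2 := hM x hx
  have h3 : |‖p x‖ + P.q0| ≤ M + P.q0 := by
    rw [abs_of_nonneg (by positivity)]; linarith
  have h4 : tau P p x = P.T * ((‖p x‖ + P.q0) * (‖p x‖ - P.q0)) := by unfold tau; ring
  rw [h4, abs_mul, abs_mul, mul_assoc]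
  exact mul_le_mul_of_nonneg_left (mul_le_mul h3 h1 (abs_nonneg _) (by positivity)) (abs_nonneg _)

theorem IsPotential.weight_tau_integrable (h : IsPotential P p Q) (a : ℝ) :
    IntegrableOn (fun x : ℝ => (1 + |x|) * |tau P p x|) (Set.Ioi a) := by
  obtain ⟨C, hC0, hC⟩ := h.abs_tau_le a
  have hc := continuous_tau (P := P) h.continuous
  refine Integrable.mono' ((h.weight_integrable a).const_mul C)
    (Continuous.aestronglyMeasurable (by fun_prop)) ?_
  filter_upwards [ae_restrict_mem measurableSet_Ioi] with x hx
  rw [Real.norm_of_nonneg (by positivity)]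
  have := hC x (le_of_lt hx)
  have h0 : 0 ≤ 1 + |x| := by positivity
  nlinarith

theorem IsPotential.tau_integrable (h : IsPotential P p Q) (a : ℝ) :
    IntegrableOn (tau P p) (Set.Ioi a) := by
  have hc := continuous_tau (P := P) h.continuous
  refine Integrable.mono' (h.weight_tau_integrable a) hc.aestronglyMeasurable
    (Eventually.of_forall fun x => ?_)
  rw [Real.norm_eq_abs]
  nlinarith [abs_nonneg x, abs_nonneg (tau P p x)]

/-- The operator on `ℂ × ℂ` with matrix `(a, b; c, d)`. -/
noncomputable def mat2 (a b c d : ℂ) : ℂ × ℂ →L[ℂ] ℂ × ℂ :=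
  let fst := ContinuousLinearMap.fst ℂ ℂ ℂ
  let snd := ContinuousLinearMap.snd ℂ ℂ ℂ
  let inl := ContinuousLinearMap.inl ℂ ℂ ℂ
  let inr := ContinuousLinearMap.inr ℂ ℂ ℂ
  a • (inl ∘L fst) + b • (inl ∘L snd) + c • (inr ∘L fst) + d • (inr ∘L snd)

@[simp] theorem mat2_apply (a b c d : ℂ) (v : ℂ × ℂ) :
    mat2 a b c d v = (a * v.1 + b * v.2, c * v.1 + d * v.2) := by
  simp [mat2]

theorem norm_mat2_le (a b c d : ℂ) : ‖mat2 a b c d‖ ≤ ‖a‖ + ‖b‖ + ‖c‖ + ‖d‖ := by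
  refine ContinuousLinearMap.opNorm_le_bound _ (by positivity) fun v => ?_
  have h1 : ‖v.1‖ ≤ ‖v‖ := norm_fst_le v
  have h2 : ‖v.2‖ ≤ ‖v‖ := norm_snd_le v
  have ha := mul_le_mul_of_nonneg_left h1 (norm_nonneg a)
  have hb := mul_le_mul_of_nonneg_left h2 (norm_nonneg b)
  have hc := mul_le_mul_of_nonneg_left h1 (norm_nonneg c)
  have hd := mul_le_mul_of_nonneg_left h2 (norm_nonneg d)
  have ha0 := mul_nonneg (norm_nonneg a) (norm_nonneg v)
  have hb0 := mul_nonneg (norm_nonneg b) (norm_nonneg v)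
  have hc0 := mul_nonneg (norm_nonneg c) (norm_nonneg v)
  have hd0 := mul_nonneg (norm_nonneg d) (norm_nonneg v)
  rw [mat2_apply, Prod.norm_mk]
  refine max_le ((norm_add_le _ _).trans ?_) ((norm_add_le _ _).trans ?_) <;>
    rw [norm_mul, norm_mul] <;> linarith

/-- The constant coefficient matrix of the column equation for the background `Q`. It annihilates
`(-iQ/ζ, 1)`, and its other eigenvalue is `-2iλ`. -/
noncomputable def bgMat (P : Params) (Q ζ : ℂ) : ℂ × ℂ →L[ℂ] ℂ × ℂ :=
  mat2 (-(I * ζ)) Q (-conj Q) (-(I * (P.q0 ^ 2 / ζ)))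

/-- The deviation of the coefficient matrix from that of the background. -/
noncomputable def pertMat (P : Params) (p : ℝ → ℂ) (Q : ℂ) (y : ℝ) : ℂ × ℂ →L[ℂ] ℂ × ℂ :=
  mat2 (I * tau P p y) (p y - Q) (-conj (p y - Q)) (-(I * tau P p y))

/-- `(exp (w s) - 1) / w`; for `A² = w A` one has `exp (s A) = 1 + expQuot w s • A`. -/
noncomputable def expQuot (w : ℂ) (s : ℝ) : ℂ := (exp (w * s) - 1) / w

theorem norm_exp_sub_one_le_of_re_nonpos {z : ℂ} (hz : z.re ≤ 0) : ‖exp z - 1‖ ≤ ‖z‖ := by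
  have := Convex.norm_image_sub_le_of_norm_deriv_le (𝕜 := ℂ) (f := exp) (C := 1)
    (s := {z : ℂ | z.re ≤ 0}) (x := 0) (y := z) (fun _ _ => differentiableAt_exp) ?_
    (convex_halfSpace_re_le 0) (by simp) hz
  · simpa using this
  · intro w hw
    rw [Complex.deriv_exp, norm_exp]
    exact Real.exp_le_one_iff.2 hw

theorem norm_expQuot_le {w : ℂ} (hw : 0 ≤ w.re) {s : ℝ} (hs : s ≤ 0) : ‖expQuot w s‖ ≤ |s| := by
  rcases eq_or_ne w 0 with rfl | h0
  · simp [expQuot]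
  have h1 : (w * s).re ≤ 0 := by
    simp only [mul_re, ofReal_re, ofReal_im, mul_zero, sub_zero]
    exact mul_nonpos_of_nonneg_of_nonpos hw hs
  rw [expQuot, norm_div, div_le_iff₀ (norm_pos_iff.2 h0)]
  refine (norm_exp_sub_one_le_of_re_nonpos h1).trans ?_
  rw [norm_mul, norm_real, Real.norm_eq_abs, mul_comm]

theorem norm_expQuot_le' {w : ℂ} (hw : 0 ≤ w.re) {s : ℝ} (hs : s ≤ 0) :
    ‖expQuot w s‖ ≤ 2 / ‖w‖ := by
  have h1 : (w * s).re ≤ 0 := by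
    simp only [mul_re, ofReal_re, ofReal_im, mul_zero, sub_zero]
    exact mul_nonpos_of_nonneg_of_nonpos hw hs
  rw [expQuot, norm_div]
  gcongr
  refine (norm_sub_le _ _).trans ?_
  rw [norm_exp, norm_one]
  have := Real.exp_le_one_iff.2 h1
  linarith

/-- `-2iλ`, the decay exponent of the column equation. -/
noncomputable def wexp (P : Params) (ζ : ℂ) : ℂ := -(2 * I * lam P ζ)

theorem wexp_re (ζ : ℂ) : (wexp P ζ).re = 2 * (lam P ζ).im := by
  simp [wexp]

theorem wexp_ne_zero {ζ : ℂ} (h : lam P ζ ≠ 0) : wexp P ζ ≠ 0 := by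
  simp [wexp, h]

theorem mul_conj_eq (h : IsPotential P p Q) : Q * conj Q = P.q0 ^ 2 := by
  rw [mul_conj, normSq_eq_norm_sq, h.norm_eq]; push_cast; rfl

theorem bgMat_bgMat (h : IsPotential P p Q) {ζ : ℂ} (hζ : ζ ≠ 0) (v : ℂ × ℂ) :
    bgMat P Q ζ (bgMat P Q ζ v) = wexp P ζ • bgMat P Q ζ v := by
  have hQ := mul_conj_eq h
  ext
  · simp only [bgMat, mat2_apply, wexp, lam, Prod.smul_fst, smul_eq_mul]
    field_simp
    linear_combination (-ζ * v.1) * hQ + (-ζ * P.q0 ^ 2 * v.1) * I_sq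
  · simp only [bgMat, mat2_apply, wexp, lam, Prod.smul_snd, smul_eq_mul]
    field_simp
    linear_combination (-ζ ^ 2 * v.2) * hQ - (ζ ^ 2 * P.q0 ^ 2 * v.2) * I_sq

/-- The kernel `exp ((x - y) A) Δ(y)` of the Volterra equation of the columns. -/
noncomputable def colKernel (P : Params) (p : ℝ → ℂ) (Q ζ : ℂ) (x y : ℝ) : ℂ × ℂ →L[ℂ] ℂ × ℂ :=
  (1 + expQuot (wexp P ζ) (x - y) • bgMat P Q ζ) * pertMat P p Q y

/-- The limit at `+∞` of the columns. -/
noncomputable def colLimit (Q ζ : ℂ) : ℂ × ℂ := (-I * Q / ζ, 1)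

theorem bgMat_colLimit (h : IsPotential P p Q) {ζ : ℂ} (hζ : ζ ≠ 0) :
    bgMat P Q ζ (colLimit Q ζ) = 0 := by
  have hQ := mul_conj_eq h
  ext
  · simp only [bgMat, mat2_apply, colLimit, Prod.fst_zero]
    field_simp
    linear_combination Q * I_sq
  · simp only [bgMat, mat2_apply, colLimit, Prod.snd_zero]
    field_simp
    linear_combination I * hQ

theorem hasDerivAt_expQuot {w : ℂ} (hw : w ≠ 0) (x y : ℝ) :
    HasDerivAt (fun y : ℝ => expQuot w (x - y)) (-(1 + w * expQuot w (x - y))) y := by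
  have h1 : HasDerivAt (fun y : ℝ => w * ((x - y : ℝ) : ℂ)) (w * (-1)) y := by
    have : HasDerivAt (fun y : ℝ => ((x - y : ℝ) : ℂ)) (((-1 : ℝ)) : ℂ) y :=
      ((hasDerivAt_id y).const_sub x).ofReal_comp
    simpa using this.const_mul w
  have := (h1.cexp.sub_const 1).div_const w
  refine this.congr_deriv ?_
  simp only [expQuot]
  field_simp
  ring

theorem IsColumn.hasDerivAt_pair {ζ : ℂ} {m1 m2 : ℝ → ℂ} (h : IsColumn P p Q ζ m1 m2) (x : ℝ) :
    HasDerivAt (fun y => (m1 y, m2 y))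
      (bgMat P Q ζ (m1 x, m2 x) + pertMat P p Q x (m1 x, m2 x)) x := by
  refine ((h.deriv_fst x).prodMk (h.deriv_snd x)).congr_deriv ?_
  simp only [bgMat, pertMat, mat2_apply, Prod.mk_add_mk, map_sub]
  ext <;> simp only <;> ring

theorem IsColumn.continuous_pair {ζ : ℂ} {m1 m2 : ℝ → ℂ} (h : IsColumn P p Q ζ m1 m2) :
    Continuous (fun y => (m1 y, m2 y)) :=
  continuous_iff_continuousAt.2 fun x => (h.hasDerivAt_pair x).continuousAt

theorem IsColumn.tendsto_pair {ζ : ℂ} {m1 m2 : ℝ → ℂ} (h : IsColumn P p Q ζ m1 m2) :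
    Tendsto (fun y => (m1 y, m2 y)) atTop (𝓝 (colLimit Q ζ)) :=
  h.tendsto_fst.prodMk_nhds h.tendsto_snd

/-- The set where the columns exist: the closed half-plane `Im λ ≥ 0` in the variable `ζ`, without
the branch points. It equals `D₁ ∪ Σ_Ω`. -/
def closedD1 (P : Params) : Set ℂ := {ζ | ζ ≠ 0 ∧ lam P ζ ≠ 0 ∧ 0 ≤ (lam P ζ).im}

theorem continuous_pertMat (hp : Continuous p) : Continuous (pertMat P p Q) := by
  have := continuous_tau (P := P) hp
  have h2 : Continuous fun y => conj (p y - Q) := continuous_conj.comp (hp.sub continuous_const)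
  unfold pertMat mat2
  fun_prop

theorem IsPotential.pertMat_integrable (h : IsPotential P p Q) (a : ℝ) :
    IntegrableOn (fun y : ℝ => (1 + |y|) * ‖pertMat P p Q y‖) (Set.Ioi a) := by
  have hc := continuous_pertMat (P := P) (Q := Q) h.continuous
  refine Integrable.mono' (((h.weight_tau_integrable a).const_mul 2).add
    ((h.weight_integrable a).const_mul 2)) (Continuous.aestronglyMeasurable (by fun_prop)) ?_
  refine Eventually.of_forall fun y => ?_
  rw [Real.norm_of_nonneg (by positivity)]
  have h1 : ‖pertMat P p Q y‖ ≤ 2 * |tau P p y| + 2 * ‖p y - Q‖ := by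
    refine (norm_mat2_le _ _ _ _).trans (le_of_eq ?_)
    simp only [norm_mul, norm_I, norm_real, norm_neg, RCLike.norm_conj, Real.norm_eq_abs]
    ring
  have h0 : 0 ≤ 1 + |y| := by positivity
  simp only [Pi.add_apply]
  nlinarith

/-- The integrable bound of the Volterra kernel on `[x0, ∞)`, where `a` bounds the coefficient
matrix of the background. -/
noncomputable def kernelBound (P : Params) (p : ℝ → ℂ) (Q : ℂ) (a x0 y : ℝ) : ℝ :=
  (1 + a) * (1 + |x0|) * ((1 + |y|) * ‖pertMat P p Q y‖)

theorem norm_one_add_expQuot_le {ζ : ℂ} (hζ : 0 ≤ (lam P ζ).im) {a : ℝ}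
    (ha : ‖bgMat P Q ζ‖ ≤ a) {x0 x y : ℝ} (hx : x0 ≤ x) (hy : x < y) :
    ‖1 + expQuot (wexp P ζ) (x - y) • bgMat P Q ζ‖ ≤ (1 + a) * (1 + |x0|) * (1 + |y|) := by
  have ha0 : 0 ≤ a := (norm_nonneg _).trans ha
  have h1 : ‖expQuot (wexp P ζ) (x - y)‖ ≤ |x0| + |y| := by
    refine (norm_expQuot_le (by rw [wexp_re]; positivity) (by linarith)).trans ?_
    rw [abs_of_neg (by linarith)]
    have := neg_abs_le x0
    have := le_abs_self y
    linarith
  have h2 : ‖expQuot (wexp P ζ) (x - y) • bgMat P Q ζ‖ ≤ (|x0| + |y|) * a := by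
    rw [norm_smul]
    exact mul_le_mul h1 ha (norm_nonneg _) (by positivity)
  have h3 : ‖(1 : ℂ × ℂ →L[ℂ] ℂ × ℂ)‖ ≤ 1 := ContinuousLinearMap.norm_id_le
  refine (norm_add_le _ _).trans ?_
  nlinarith [abs_nonneg x0, abs_nonneg y, mul_nonneg (abs_nonneg x0) (abs_nonneg y),
    mul_nonneg ha0 (mul_nonneg (abs_nonneg x0) (abs_nonneg y))]

theorem isVolterraKernel_colKernel (h : IsPotential P p Q) {U : Set ℂ} (hU : U ⊆ closedD1 P)
    {a : ℝ} (ha : 0 ≤ a) (hUa : ∀ ζ ∈ U, ‖bgMat P Q ζ‖ ≤ a) (x0 : ℝ) :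
    IsVolterraKernel U x0 (kernelBound P p Q a x0) (colKernel P p Q) := by
  have hc := continuous_pertMat (P := P) (Q := Q) h.continuous
  refine ⟨?_, fun y => ?_, fun b => (h.pertMat_integrable b).const_mul _, fun ζ _ => ?_,
    fun ζ hζ x y hx hy => ?_⟩
  · unfold kernelBound; fun_prop
  · unfold kernelBound; positivity
  · unfold colKernel expQuot; fun_prop
  · refine (norm_mul_le _ _).trans ?_
    refine (mul_le_mul_of_nonneg_right
      (norm_one_add_expQuot_le (hU hζ).2.2 (hUa ζ hζ) hx hy) (norm_nonneg _)).trans (le_of_eq ?_)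
    unfold kernelBound; ring

/-- A column solves the Volterra equation with kernel `colKernel`. -/
theorem IsColumn.isVolterraSol (h : IsPotential P p Q) {ζ : ℂ} (hζ : ζ ∈ closedD1 P)
    {m1 m2 : ℝ → ℂ} (hm : IsColumn P p Q ζ m1 m2) (x0 : ℝ) :
    IsVolterraSol x0 (colKernel P p Q) (colLimit Q) ζ (fun y => (m1 y, m2 y)) := by
  set A := bgMat P Q ζ with hA
  set w := wexp P ζ with hw
  have hw0 : w ≠ 0 := wexp_ne_zero hζ.2.1
  have hwre : 0 ≤ w.re := by rw [hw, wexp_re]; linarith [hζ.2.2]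
  set v : ℝ → ℂ × ℂ := fun y => (m1 y, m2 y) with hv
  have hvc : Continuous v := hm.continuous_pair
  have hbd : ∀ x0, ∃ C, ∀ x, x0 ≤ x → ‖v x‖ ≤ C := fun x0 => by
    obtain ⟨C, _, hC⟩ := exists_bound_of_tendsto hvc hm.tendsto_pair x0
    exact ⟨C, hC⟩
  refine ⟨hvc.aestronglyMeasurable, hbd x0, fun x hx => ?_⟩
  have hK := isVolterraKernel_colKernel h (U := {ζ}) (by simpa using hζ) (norm_nonneg A)
    (by simp [hA]) x
  obtain ⟨C, hC⟩ := hbd x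
  have hint : IntegrableOn (fun y => colKernel P p Q ζ x y (v y)) (Set.Ioi x) := by
    refine (norm_integral_kernel_le hK (Set.mem_singleton ζ) hvc.aestronglyMeasurable (B := C)
      (fun y hy => (hC y hy).trans ?_) le_rfl).1
    have hC0 : 0 ≤ C := (norm_nonneg _).trans (hC x le_rfl)
    have := Real.one_le_exp (x := 2 * tail (kernelBound P p Q ‖A‖ x) y)
      (by have := tail_nonneg hK.nonneg y; positivity)
    nlinarith
  have hder : ∀ y ∈ Set.Ici x, HasDerivAt (fun y => v y + expQuot w (x - y) • A (v y))
      (colKernel P p Q ζ x y (v y)) y := by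
    intro y _
    have h1 := hm.hasDerivAt_pair y
    have h2 : HasDerivAt (fun y => A (v y)) (A (A (v y) + pertMat P p Q y (v y))) y :=
      (A.restrictScalars ℝ).hasFDerivAt.comp_hasDerivAt y h1
    have h3 := h1.add ((hasDerivAt_expQuot hw0 x y).smul h2)
    refine h3.congr_deriv ?_
    simp only [colKernel, mul_apply_eq_comp, add_apply,
      one_apply_eq_self, smul_apply, map_add]
    rw [← hA, bgMat_bgMat h hζ.1]
    simp only [← hw, hv]
    module
  have hlim : Tendsto (fun y => v y + expQuot w (x - y) • A (v y)) atTop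
      (𝓝 (colLimit Q ζ)) := by
    have h1 : Tendsto (fun y => A (v y)) atTop (𝓝 0) := by
      rw [← bgMat_colLimit h hζ.1]
      exact (A.continuous.tendsto _).comp hm.tendsto_pair
    have h2 : Tendsto (fun y => expQuot w (x - y) • A (v y)) atTop (𝓝 0) := by
      refine squeeze_zero_norm' (a := fun y => 2 / ‖w‖ * ‖A (v y)‖) ?_ ?_
      · filter_upwards [eventually_ge_atTop x] with y hy
        rw [norm_smul]
        exact mul_le_mul_of_nonneg_right (norm_expQuot_le' hwre (by linarith)) (norm_nonneg _)
      · simpa using h1.norm.const_mul (2 / ‖w‖)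
    simpa using hm.tendsto_pair.add h2
  have := integral_Ioi_of_hasDerivAt_of_tendsto' hder hint hlim
  rw [this]
  simp [expQuot]

/-- A column is determined by its potential and the spectral parameter. -/
theorem IsColumn.unique (h : IsPotential P p Q) {ζ : ℂ} (hζ : ζ ∈ closedD1 P)
    {m1 m2 n1 n2 : ℝ → ℂ} (hm : IsColumn P p Q ζ m1 m2) (hn : IsColumn P p Q ζ n1 n2) (x : ℝ) :
    m1 x = n1 x ∧ m2 x = n2 x := by
  have hK := isVolterraKernel_colKernel h (U := {ζ}) (by simpa using hζ)
    (norm_nonneg (bgMat P Q ζ)) (by simp) x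
  have := IsVolterraSol.unique hK (Set.mem_singleton ζ) (hm.isVolterraSol h hζ x)
    (hn.isVolterraSol h hζ x) le_rfl
  exact Prod.mk.inj this

theorem differentiableAt_bgMat {ζ : ℂ} (hζ : ζ ≠ 0) :
    DifferentiableAt ℂ (bgMat P Q) ζ := by
  unfold bgMat mat2
  fun_prop (disch := assumption)

theorem differentiableAt_colLimit {ζ : ℂ} (hζ : ζ ≠ 0) :
    DifferentiableAt ℂ (colLimit Q) ζ := by
  unfold colLimit
  fun_prop (disch := assumption)

theorem differentiableAt_lam {ζ : ℂ} (hζ : ζ ≠ 0) : DifferentiableAt ℂ (lam P) ζ := by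
  unfold lam
  fun_prop (disch := assumption)

theorem differentiableAt_colKernel {ζ : ℂ} (hζ : ζ ≠ 0) (hl : lam P ζ ≠ 0) (x y : ℝ) :
    DifferentiableAt ℂ (fun ζ => colKernel P p Q ζ x y) ζ := by
  have h1 := differentiableAt_bgMat (P := P) (Q := Q) hζ
  have h2 : DifferentiableAt ℂ (wexp P) ζ := by
    have := differentiableAt_lam (P := P) hζ
    unfold wexp
    fun_prop
  have h3 : DifferentiableAt ℂ (fun ζ => expQuot (wexp P ζ) (x - y)) ζ := by
    have h0 := wexp_ne_zero hl
    unfold expQuot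
    fun_prop (disch := assumption)
  unfold colKernel
  fun_prop

/-- Near every `ζ₀ ≠ 0` the coefficient matrix of the background and the limit of the columns are
bounded. -/
theorem exists_bound_bgMat {z : ℂ} (hz : z ≠ 0) :
    ∃ a, 0 ≤ a ∧ ∀ᶠ ζ in 𝓝 z, ‖bgMat P Q ζ‖ ≤ a ∧ ‖colLimit Q ζ‖ ≤ a := by
  have h1 := (differentiableAt_bgMat (P := P) (Q := Q) hz).continuousAt.norm
  have h2 := (differentiableAt_colLimit (Q := Q) hz).continuousAt.norm
  refine ⟨max (‖bgMat P Q z‖ + 1) (‖colLimit Q z‖ + 1), by positivity, ?_⟩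
  filter_upwards [h1.eventually_lt continuousAt_const (lt_add_one _),
    h2.eventually_lt continuousAt_const (lt_add_one _)] with ζ h1 h2
  exact ⟨h1.le.trans (le_max_left _ _), h2.le.trans (le_max_right _ _)⟩

variable {f1 f2 : ℂ → ℝ → ℂ}

/-- The columns are bounded near every nonzero point, the branch points included. -/
theorem IsColumn.locally_bounded (h : IsPotential P p Q)
    (hf : ∀ ζ ∈ closedD1 P, IsColumn P p Q ζ (f1 ζ) (f2 ζ)) (x : ℝ) {z : ℂ} (hz : z ≠ 0) :
    ∃ C, ∀ᶠ ζ in 𝓝[closedD1 P] z, ‖f1 ζ x‖ ≤ C ∧ ‖f2 ζ x‖ ≤ C := by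
  obtain ⟨a, ha0, ha⟩ := exists_bound_bgMat (P := P) (Q := Q) hz
  have hK := isVolterraKernel_colKernel h
    (U := {ζ | ζ ∈ closedD1 P ∧ ‖bgMat P Q ζ‖ ≤ a ∧ ‖colLimit Q ζ‖ ≤ a}) (fun ζ hζ => hζ.1) ha0
    (fun ζ hζ => hζ.2.1) x
  refine ⟨2 * a * Real.exp (2 * tail (kernelBound P p Q a x) x), ?_⟩
  filter_upwards [self_mem_nhdsWithin, nhdsWithin_le_nhds ha] with ζ h1 h2
  have := IsVolterraSol.norm_le hK ⟨h1, h2⟩ ((hf ζ h1).isVolterraSol h h1 x) h2.2 le_rfl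
  exact ⟨(norm_fst_le _).trans this, (norm_snd_le _).trans this⟩

theorem IsColumn.continuousOn (h : IsPotential P p Q)
    (hf : ∀ ζ ∈ closedD1 P, IsColumn P p Q ζ (f1 ζ) (f2 ζ)) (x : ℝ) :
    ContinuousOn (fun ζ => (f1 ζ x, f2 ζ x)) (closedD1 P) := by
  intro z hz
  obtain ⟨a, ha0, ha⟩ := exists_bound_bgMat (P := P) (Q := Q) hz.1
  have hK := isVolterraKernel_colKernel h
    (U := {ζ | ζ ∈ closedD1 P ∧ ‖bgMat P Q ζ‖ ≤ a ∧ ‖colLimit Q ζ‖ ≤ a}) (fun ζ hζ => hζ.1) ha0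
    (fun ζ hζ => hζ.2.1) x
  have := IsVolterraSol.continuousOn hK
    (fun x y ζ hζ => (differentiableAt_colKernel hζ.1.1 hζ.1.2.1 x
      y).continuousAt.continuousWithinAt)
    (fun ζ hζ => (differentiableAt_colLimit hζ.1.1).continuousAt.continuousWithinAt)
    (fun ζ hζ => hζ.2.2) (fun ζ hζ => (hf ζ hζ.1).isVolterraSol h hζ.1 x) le_rfl
  refine (this z ⟨hz, ha.self_of_nhds⟩).mono_of_mem_nhdsWithin ?_
  filter_upwards [self_mem_nhdsWithin, nhdsWithin_le_nhds ha] with ζ h1 h2 using ⟨h1, h2⟩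

theorem IsColumn.differentiableOn (h : IsPotential P p Q)
    (hf : ∀ ζ ∈ closedD1 P, IsColumn P p Q ζ (f1 ζ) (f2 ζ)) (x : ℝ) {U : Set ℂ} (hU : IsOpen U)
    (hUD : U ⊆ closedD1 P) :
    DifferentiableOn ℂ (fun ζ => (f1 ζ x, f2 ζ x)) U := by
  intro z hz
  obtain ⟨a, ha0, ha⟩ := exists_bound_bgMat (P := P) (Q := Q) (hUD hz).1
  obtain ⟨V, hV, hVo, hzV⟩ := eventually_nhds_iff.1 ha
  have hK := isVolterraKernel_colKernel h (U := U ∩ V) (fun ζ hζ => hUD hζ.1) ha0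
    (fun ζ hζ => (hV ζ hζ.2).1) x
  have := IsVolterraSol.differentiableOn (hU.inter hVo) hK
    (fun x y ζ hζ => (differentiableAt_colKernel (hUD hζ.1).1 (hUD hζ.1).2.1 x
      y).differentiableWithinAt)
    (fun ζ hζ => (differentiableAt_colLimit (hUD hζ.1).1).differentiableWithinAt)
    (fun ζ hζ => (hV ζ hζ.2).2) (fun ζ hζ => (hf ζ (hUD hζ.1)).isVolterraSol h (hUD hζ.1) x) le_rfl
  exact ((this z ⟨hz, hzV⟩).differentiableAt
    ((hU.inter hVo).mem_nhds ⟨hz, hzV⟩)).differentiableWithinAt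

theorem _root_.Filter.Tendsto.congr_right {α β : Type*} [TopologicalSpace β] {f : α → β}
    {l : Filter α} {a b : β} (h : Tendsto f l (𝓝 a)) (hab : a = b) : Tendsto f l (𝓝 b) :=
  hab ▸ h

/-! ### Asymptotics of the Jost columns at `ζ = ∞` -/

theorem norm_exp_mul_sub_le_one {w : ℂ} (hw : 0 ≤ w.re) {y s : ℝ} (hs : y ≤ s) :
    ‖exp (w * ((y - s : ℝ) : ℂ))‖ ≤ 1 := by
  rw [norm_exp]
  refine Real.exp_le_one_iff.2 ?_
  simp only [mul_re, ofReal_re, ofReal_im, mul_zero, sub_zero]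
  exact mul_nonpos_of_nonneg_of_nonpos hw (by linarith)

theorem integrableOn_exp_mul {w : ℂ} (hw : 0 ≤ w.re) {g : ℝ → ℂ} {y : ℝ}
    (hg : IntegrableOn g (Set.Ioi y)) :
    IntegrableOn (fun s : ℝ => exp (w * ((y - s : ℝ) : ℂ)) * g s) (Set.Ioi y) := by
  refine Integrable.mono hg ?_ ?_
  · refine AEStronglyMeasurable.mul ?_ hg.aestronglyMeasurable
    exact (Continuous.aestronglyMeasurable (by fun_prop))
  · filter_upwards [ae_restrict_mem measurableSet_Ioi] with s hs
    rw [norm_mul]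
    exact mul_le_of_le_one_left (norm_nonneg _) (norm_exp_mul_sub_le_one hw (le_of_lt hs))

theorem norm_integral_exp_mul_le {w : ℂ} (hw : 0 ≤ w.re) {g : ℝ → ℂ} {y : ℝ}
    (hg : IntegrableOn g (Set.Ioi y)) :
    ‖∫ s in Set.Ioi y, exp (w * ((y - s : ℝ) : ℂ)) * g s‖ ≤ ∫ s in Set.Ioi y, ‖g s‖ := by
  refine norm_integral_le_of_norm_le hg.norm ?_
  filter_upwards [ae_restrict_mem measurableSet_Ioi] with s hs
  rw [norm_mul]
  exact mul_le_of_le_one_left (norm_nonneg _) (norm_exp_mul_sub_le_one hw (le_of_lt hs))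

/-- Variation of constants from `+∞` for `u' = w u + g`. -/
theorem eq_sub_integral_of_hasDerivAt {w c : ℂ} (hw : 0 ≤ w.re) (hc : w = 0 ∨ c = 0)
    {u g : ℝ → ℂ} (hu : ∀ y, HasDerivAt u (w * u y + g y) y) (hl : Tendsto u atTop (𝓝 c))
    {y : ℝ} (hg : IntegrableOn g (Set.Ioi y)) :
    u y = c - ∫ s in Set.Ioi y, exp (w * ((y - s : ℝ) : ℂ)) * g s := by
  have hd : ∀ s ∈ Set.Ici y, HasDerivAt (fun s : ℝ => exp (w * ((y - s : ℝ) : ℂ)) * u s)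
      (exp (w * ((y - s : ℝ) : ℂ)) * g s) s := by
    intro s _
    have h1 : HasDerivAt (fun s : ℝ => w * ((y - s : ℝ) : ℂ)) (w * (-1)) s := by
      have : HasDerivAt (fun s : ℝ => ((y - s : ℝ) : ℂ)) (((-1 : ℝ)) : ℂ) s :=
        ((hasDerivAt_id s).const_sub y).ofReal_comp
      simpa using this.const_mul w
    refine (h1.cexp.mul (hu s)).congr_deriv ?_
    ring
  have hlim : Tendsto (fun s : ℝ => exp (w * ((y - s : ℝ) : ℂ)) * u s) atTop (𝓝 c) := by
    rcases hc with rfl | rfl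
    · simpa using hl
    · refine squeeze_zero_norm' (a := fun s => ‖u s‖) ?_ (by simpa using hl.norm)
      filter_upwards [eventually_ge_atTop y] with s hs
      rw [norm_mul]
      exact mul_le_of_le_one_left (norm_nonneg _) (norm_exp_mul_sub_le_one hw hs)
  rw [integral_Ioi_of_hasDerivAt_of_tendsto' hd (integrableOn_exp_mul hw hg) hlim]
  simp

/-- A Riemann-Lebesgue lemma for exponents in the closed right half-plane. -/
theorem riemannLebesgue_Ioi {g : ℝ → ℂ} (hg : ContDiff ℝ 1 g) {x : ℝ}
    (hi : IntegrableOn g (Set.Ioi x)) {ε : ℝ} (hε : 0 < ε) :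
    ∃ R : ℝ, ∀ w : ℂ, 0 ≤ w.re → R ≤ ‖w‖ →
      ‖∫ s in Set.Ioi x, exp (w * ((x - s : ℝ) : ℂ)) * g s‖ ≤ ε := by
  have ht : Tendsto (fun L => ∫ s in Set.Ioi L, ‖g s‖) atTop (𝓝 0) :=
    tendsto_integral_Ioi_zero tendsto_id
  obtain ⟨L, hL, hxL⟩ := ((ht.eventually_lt_const (half_pos hε)).and
    (eventually_ge_atTop x)).exists
  have hgd : ∀ s, HasDerivAt g (deriv g s) s := fun s =>
    (hg.differentiable one_ne_zero s).hasDerivAt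
  have hg'c : Continuous (deriv g) := hg.continuous_deriv le_rfl
  have hgc := hg.continuous
  set B : ℝ := ‖g L‖ + ‖g x‖ + ∫ s in x..L, ‖deriv g s‖ with hB
  have hI0 : 0 ≤ ∫ s in x..L, ‖deriv g s‖ :=
    intervalIntegral.integral_nonneg hxL fun _ _ => norm_nonneg _
  have hB0 : 0 ≤ B := by positivity
  refine ⟨2 * B / ε + 1, fun w hw hR => ?_⟩
  have hwpos : 0 < ‖w‖ := by
    have : 0 ≤ 2 * B / ε := by positivity
    linarith
  have hw0 : w ≠ 0 := norm_pos_iff.1 hwpos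
  have hsplit : ∫ s in Set.Ioi x, exp (w * ((x - s : ℝ) : ℂ)) * g s
      = (∫ s in x..L, exp (w * ((x - s : ℝ) : ℂ)) * g s)
        + ∫ s in Set.Ioi L, exp (w * ((x - s : ℝ) : ℂ)) * g s := by
    have hint := integrableOn_exp_mul hw hi
    rw [intervalIntegral.integral_interval_add_Ioi hint
      (hint.mono_set (Set.Ioi_subset_Ioi hxL))]
  have h2 : ‖∫ s in Set.Ioi L, exp (w * ((x - s : ℝ) : ℂ)) * g s‖ ≤ ε / 2 := by
    refine (norm_integral_le_of_norm_le (hi.mono_set (Set.Ioi_subset_Ioi hxL)).norm ?_).trans hL.le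
    filter_upwards [ae_restrict_mem measurableSet_Ioi] with s hs
    rw [norm_mul]
    exact mul_le_of_le_one_left (norm_nonneg _)
      (norm_exp_mul_sub_le_one hw (hxL.trans (le_of_lt hs)))
  have h1 : ‖∫ s in x..L, exp (w * ((x - s : ℝ) : ℂ)) * g s‖ ≤ B / ‖w‖ := by
    have hE : ∀ s : ℝ, HasDerivAt (fun s : ℝ => -exp (w * ((x - s : ℝ) : ℂ)) / w)
        (exp (w * ((x - s : ℝ) : ℂ))) s := by
      intro s
      have h1 : HasDerivAt (fun s : ℝ => w * ((x - s : ℝ) : ℂ)) (w * (-1)) s := by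
        have : HasDerivAt (fun s : ℝ => ((x - s : ℝ) : ℂ)) (((-1 : ℝ)) : ℂ) s :=
          ((hasDerivAt_id s).const_sub x).ofReal_comp
        simpa using this.const_mul w
      refine (h1.cexp.neg.div_const w).congr_deriv ?_
      field_simp
    have hparts := intervalIntegral.integral_deriv_mul_eq_sub
      (a := x) (b := L) (fun s _ => (hE s)) (fun s _ => hgd s)
      (Continuous.intervalIntegrable (by fun_prop) _ _)
      (hg'c.intervalIntegrable _ _)
    have hi1 : IntervalIntegrable (fun s : ℝ => exp (w * ((x - s : ℝ) : ℂ)) * g s) volume x L :=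
      Continuous.intervalIntegrable (by fun_prop) _ _
    have hi2 : IntervalIntegrable
        (fun s : ℝ => -exp (w * ((x - s : ℝ) : ℂ)) / w * deriv g s) volume x L :=
      Continuous.intervalIntegrable (by fun_prop) _ _
    rw [intervalIntegral.integral_add hi1 hi2] at hparts
    have hsub : ‖∫ s in x..L, -exp (w * ((x - s : ℝ) : ℂ)) / w * deriv g s‖
        ≤ (∫ s in x..L, ‖deriv g s‖) / ‖w‖ := by
      rw [← intervalIntegral.integral_div]
      refine intervalIntegral.norm_integral_le_of_norm_le hxL ?_
        ((hg'c.norm.div_const _).intervalIntegrable _ _)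
      refine Eventually.of_forall fun s hs => ?_
      rw [norm_mul, norm_div, norm_neg, div_mul_eq_mul_div]
      gcongr
      exact mul_le_of_le_one_left (norm_nonneg _) (norm_exp_mul_sub_le_one hw hs.1.le)
    have he : ∀ s, x ≤ s → ‖-exp (w * ((x - s : ℝ) : ℂ)) / w * g s‖ ≤ ‖g s‖ / ‖w‖ := by
      intro s hs
      rw [norm_mul, norm_div, norm_neg, div_mul_eq_mul_div]
      gcongr
      exact mul_le_of_le_one_left (norm_nonneg _) (norm_exp_mul_sub_le_one hw hs)
    rw [eq_sub_of_add_eq hparts]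
    refine (norm_sub_le _ _).trans ?_
    refine (add_le_add ((norm_sub_le _ _).trans (add_le_add (he L hxL) (he x le_rfl)))
      hsub).trans (le_of_eq ?_)
    rw [hB]; ring
  rw [hsplit]
  have h3 : B / ‖w‖ ≤ ε / 2 := by
    rw [div_le_iff₀ hwpos]
    have : 2 * B / ε ≤ ‖w‖ := by linarith
    rw [div_le_iff₀ hε] at this
    linarith
  refine (norm_add_le _ _).trans ?_
  linarith

/-- A bounded family that is bounded by half of each of its bounds plus `a` is bounded by
`2 a`. -/
theorem le_two_mul_of_bound_imp {ι : Type*} {u : ι → ℝ} (hb : BddAbove (Set.range u)) {a : ℝ}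
    (h : ∀ M, (∀ i, u i ≤ M) → ∀ i, u i ≤ a + M / 2) (i : ι) : u i ≤ 2 * a := by
  have : Nonempty ι := ⟨i⟩
  have h1 := h (⨆ i, u i) (fun i => le_ciSup hb i)
  have h2 : (⨆ i, u i) ≤ a + (⨆ i, u i) / 2 := ciSup_le h1
  have h3 := le_ciSup hb i
  linarith

/-- The column equation for a potential `G` after the gauge transformation that removes the
diagonal term `i T |q|² σ₃`. -/
structure IsGaugedColumn (P : Params) (G : ℝ → ℂ) (Q ζ : ℂ) (n1 n2 : ℝ → ℂ) : Prop where
  deriv_fst : ∀ x, HasDerivAt n1 (-(I * ζ) * n1 x + G x * n2 x) x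
  deriv_snd : ∀ x, HasDerivAt n2 (-conj (G x) * n1 x - I * (P.q0 ^ 2 / ζ) * n2 x) x
  tendsto_fst : Tendsto n1 atTop (𝓝 (-I * Q / ζ))
  tendsto_snd : Tendsto n2 atTop (𝓝 1)

section Gauged

variable {P : Params} {G : ℝ → ℂ} {Q ζ : ℂ} {n1 n2 : ℝ → ℂ}

/-- Diagonalizing the coefficient matrix at each point leaves an integrable perturbation with a
factor `1 / ζ`; first component. -/
theorem IsGaugedColumn.hasDerivAt_diag_fst (hG : Differentiable ℝ G) (hζ : ζ ≠ 0)
    (h : IsGaugedColumn P G Q ζ n1 n2) (y : ℝ) :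
    HasDerivAt (fun y => n1 y + I * G y * n2 y / ζ)
      (wexp P ζ * (n1 y + I * G y * n2 y / ζ) + 1 / ζ *
        (-(I * ((‖G y‖ ^ 2 - P.q0 ^ 2 : ℝ) : ℂ) * n1 y) + I * deriv G y * n2 y)) y := by
  have hGd := (hG y).hasDerivAt
  refine ((h.deriv_fst y).add (((hGd.const_mul I).mul (h.deriv_snd y)).div_const ζ)).congr_deriv ?_
  have hGG : ((‖G y‖ ^ 2 : ℝ) : ℂ) = G y * conj (G y) := by
    rw [mul_conj, normSq_eq_norm_sq]
  push_cast at hGG ⊢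
  rw [hGG, wexp, lam]
  field_simp
  linear_combination (ζ ^ 2 * G y * n2 y) * I_sq

theorem IsGaugedColumn.hasDerivAt_diag_snd (hG : Differentiable ℝ G) (hζ : ζ ≠ 0)
    (h : IsGaugedColumn P G Q ζ n1 n2) (y : ℝ) :
    HasDerivAt (fun y => n2 y + I * conj (G y) * n1 y / ζ)
      (1 / ζ * (I * ((‖G y‖ ^ 2 - P.q0 ^ 2 : ℝ) : ℂ) * n2 y + I * conj (deriv G y) * n1 y)) y := by
  have hGd : HasDerivAt (fun y => conj (G y)) (conj (deriv G y)) y :=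
    ((conjCLE : ℂ →L[ℝ] ℂ).hasFDerivAt.comp_hasDerivAt y (hG y).hasDerivAt)
  refine ((h.deriv_snd y).add (((hGd.const_mul I).mul (h.deriv_fst y)).div_const ζ)).congr_deriv ?_
  have hGG : ((‖G y‖ ^ 2 : ℝ) : ℂ) = G y * conj (G y) := by
    rw [mul_conj, normSq_eq_norm_sq]
  push_cast at hGG ⊢
  rw [hGG]
  field_simp
  linear_combination (-ζ * conj (G y) * n1 y) * I_sq

theorem IsGaugedColumn.continuous (h : IsGaugedColumn P G Q ζ n1 n2) :
    Continuous n1 ∧ Continuous n2 :=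
  ⟨continuous_iff_continuousAt.2 fun x => (h.deriv_fst x).continuousAt,
    continuous_iff_continuousAt.2 fun x => (h.deriv_snd x).continuousAt⟩

theorem integrableOn_mul_of_bounded {g u : ℝ → ℂ} (hu : Continuous u) {c : ℂ}
    (hl : Tendsto u atTop (𝓝 c)) {y : ℝ} (hg : IntegrableOn g (Set.Ioi y)) :
    IntegrableOn (fun s => g s * u s) (Set.Ioi y) := by
  obtain ⟨M, _, hM⟩ := exists_bound_of_tendsto hu hl y
  refine Integrable.mul_bdd (c := M) hg hu.aestronglyMeasurable ?_
  filter_upwards [ae_restrict_mem measurableSet_Ioi] with s hs using hM s (le_of_lt hs)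

/-- The forcing terms of the diagonalized equations are integrable. -/
theorem IsGaugedColumn.forcing_integrable (h : IsGaugedColumn P G Q ζ n1 n2) {y : ℝ}
    (hδ : IntegrableOn (fun s => ‖G s‖ ^ 2 - P.q0 ^ 2) (Set.Ioi y))
    (hG' : IntegrableOn (deriv G) (Set.Ioi y)) :
    IntegrableOn (fun s => -(I * ((‖G s‖ ^ 2 - P.q0 ^ 2 : ℝ) : ℂ) * n1 s) + I * deriv G s * n2 s)
        (Set.Ioi y) ∧
    IntegrableOn (fun s => I * ((‖G s‖ ^ 2 - P.q0 ^ 2 : ℝ) : ℂ) * n2 s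
        + I * conj (deriv G s) * n1 s) (Set.Ioi y) := by
  have hδ' : IntegrableOn (fun s => I * ((‖G s‖ ^ 2 - P.q0 ^ 2 : ℝ) : ℂ)) (Set.Ioi y) :=
    hδ.ofReal.const_mul I
  have hc : IntegrableOn (fun s => conj (deriv G s)) (Set.Ioi y) :=
    (conjCLE : ℂ →L[ℝ] ℂ).integrable_comp hG'
  obtain ⟨c1, c2⟩ := h.continuous
  exact ⟨(integrableOn_mul_of_bounded c1 h.tendsto_fst hδ').neg.add
      (integrableOn_mul_of_bounded c2 h.tendsto_snd (hG'.const_mul I)),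
    (integrableOn_mul_of_bounded c2 h.tendsto_snd hδ').add
      (integrableOn_mul_of_bounded c1 h.tendsto_fst (hc.const_mul I))⟩

theorem IsGaugedColumn.integral_eq_fst (hG : Differentiable ℝ G) (hGl : Tendsto G atTop (𝓝 Q))
    (hζ : ζ ∈ closedD1 P) (h : IsGaugedColumn P G Q ζ n1 n2) {y : ℝ}
    (hδ : IntegrableOn (fun s => ‖G s‖ ^ 2 - P.q0 ^ 2) (Set.Ioi y))
    (hG' : IntegrableOn (deriv G) (Set.Ioi y)) :
    n1 y + I * G y * n2 y / ζ = -(1 / ζ * ∫ s in Set.Ioi y, exp (wexp P ζ * ((y - s : ℝ) : ℂ)) *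
        (-(I * ((‖G s‖ ^ 2 - P.q0 ^ 2 : ℝ) : ℂ) * n1 s) + I * deriv G s * n2 s)) := by
  have hl : Tendsto (fun y => n1 y + I * G y * n2 y / ζ) atTop (𝓝 0) := by
    have := h.tendsto_fst.add (((hGl.const_mul I).mul h.tendsto_snd).div_const ζ)
    refine this.congr_right ?_
    ring
  have hw : 0 ≤ (wexp P ζ).re := by rw [wexp_re]; linarith [hζ.2.2]
  rw [eq_sub_integral_of_hasDerivAt hw (Or.inr rfl) (h.hasDerivAt_diag_fst hG hζ.1) hl
    ((h.forcing_integrable hδ hG').1.const_mul (1 / ζ)), zero_sub, ← integral_const_mul]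
  congr 2
  funext s
  ring

theorem IsGaugedColumn.integral_eq_snd (hG : Differentiable ℝ G) (hGl : Tendsto G atTop (𝓝 Q))
    (hQ : ‖Q‖ = P.q0) (hζ : ζ ≠ 0) (h : IsGaugedColumn P G Q ζ n1 n2) {y : ℝ}
    (hδ : IntegrableOn (fun s => ‖G s‖ ^ 2 - P.q0 ^ 2) (Set.Ioi y))
    (hG' : IntegrableOn (deriv G) (Set.Ioi y)) :
    n2 y + I * conj (G y) * n1 y / ζ = 1 + P.q0 ^ 2 / ζ ^ 2 - 1 / ζ * ∫ s in Set.Ioi y,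
        (I * ((‖G s‖ ^ 2 - P.q0 ^ 2 : ℝ) : ℂ) * n2 s + I * conj (deriv G s) * n1 s) := by
  have hl : Tendsto (fun y => n2 y + I * conj (G y) * n1 y / ζ) atTop
      (𝓝 (1 + P.q0 ^ 2 / ζ ^ 2)) := by
    have := h.tendsto_snd.add (((((continuous_conj.tendsto Q).comp hGl).const_mul I).mul
      h.tendsto_fst).div_const ζ)
    refine this.congr_right ?_
    have hQQ : Q * conj Q = P.q0 ^ 2 := by
      rw [mul_conj, normSq_eq_norm_sq, hQ]; push_cast; rfl
    rw [← hQQ]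
    field_simp
    linear_combination (-Q * conj Q) * I_sq
  rw [eq_sub_integral_of_hasDerivAt (w := 0) le_rfl (Or.inl rfl)
    (fun y => (h.hasDerivAt_diag_snd hG hζ y).congr_deriv (by ring)) hl
    ((h.forcing_integrable hδ hG').2.const_mul (1 / ζ)), ← integral_const_mul]
  simp only [zero_mul, exp_zero, one_mul]

end Gauged

section GaugedFamily

variable {P : Params} {G : ℝ → ℂ} {Q : ℂ} {n1 n2 : ℂ → ℝ → ℂ}

/-- A bound `M` for a column on `[x, ∞)` improves, by the diagonalized equations, to one with the
factor `1 / |ζ|` in front of `M`. -/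
theorem IsGaugedColumn.norm_le_of_norm_le (hG : Differentiable ℝ G)
    (hGl : Tendsto G atTop (𝓝 Q)) (hQ : ‖Q‖ = P.q0) {ζ : ℂ} (hζ : ζ ∈ closedD1 P)
    {n1 n2 : ℝ → ℂ} (h : IsGaugedColumn P G Q ζ n1 n2) {x : ℝ}
    (hδ : IntegrableOn (fun s => ‖G s‖ ^ 2 - P.q0 ^ 2) (Set.Ioi x))
    (hG' : IntegrableOn (deriv G) (Set.Ioi x)) {B : ℝ} (hB : ∀ y, x ≤ y → ‖G y‖ ≤ B)
    {M : ℝ} (hM : ∀ y, x ≤ y → ‖n1 y‖ ≤ M ∧ ‖n2 y‖ ≤ M) {y : ℝ} (hy : x ≤ y) :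
    ‖n1 y‖ ≤ ((∫ s in Set.Ioi x, (|‖G s‖ ^ 2 - P.q0 ^ 2| + ‖deriv G s‖)) + B) * M / ‖ζ‖ ∧
    ‖n2 y - 1‖ ≤ P.q0 ^ 2 / ‖ζ‖ ^ 2
      + ((∫ s in Set.Ioi x, (|‖G s‖ ^ 2 - P.q0 ^ 2| + ‖deriv G s‖)) + B) * M / ‖ζ‖ := by
  set k := ∫ s in Set.Ioi x, (|‖G s‖ ^ 2 - P.q0 ^ 2| + ‖deriv G s‖) with hk
  have hM0 : 0 ≤ M := (norm_nonneg _).trans (hM x le_rfl).1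
  have hζ0 : 0 < ‖ζ‖ := norm_pos_iff.2 hζ.1
  have hsub := Set.Ioi_subset_Ioi hy
  have hδy := hδ.mono_set hsub
  have hGy := hG'.mono_set hsub
  have hki : IntegrableOn (fun s => |‖G s‖ ^ 2 - P.q0 ^ 2| + ‖deriv G s‖) (Set.Ioi x) :=
    hδ.norm.add hG'.norm
  have hky : ∫ s in Set.Ioi y, (|‖G s‖ ^ 2 - P.q0 ^ 2| + ‖deriv G s‖) * M ≤ k * M := by
    rw [integral_mul_const]
    exact mul_le_mul_of_nonneg_right (setIntegral_mono_set hki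
      (ae_of_all _ fun s => by positivity) hsub.eventuallyLE) hM0
  obtain ⟨f1, f2⟩ := h.forcing_integrable hδy hGy
  have hw : 0 ≤ (wexp P ζ).re := by rw [wexp_re]; linarith [hζ.2.2]
  have hbound : ∀ s ∈ Set.Ioi y,
      ‖-(I * ((‖G s‖ ^ 2 - P.q0 ^ 2 : ℝ) : ℂ) * n1 s) + I * deriv G s * n2 s‖
        ≤ (|‖G s‖ ^ 2 - P.q0 ^ 2| + ‖deriv G s‖) * M ∧
      ‖I * ((‖G s‖ ^ 2 - P.q0 ^ 2 : ℝ) : ℂ) * n2 s + I * conj (deriv G s) * n1 s‖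
        ≤ (|‖G s‖ ^ 2 - P.q0 ^ 2| + ‖deriv G s‖) * M := by
    intro s hs
    obtain ⟨b1, b2⟩ := hM s (hy.trans (le_of_lt hs))
    constructor
    · refine (norm_add_le _ _).trans ?_
      simp only [norm_neg, norm_mul, norm_I, one_mul, norm_real, Real.norm_eq_abs]
      rw [add_mul]
      gcongr
    · refine (norm_add_le _ _).trans ?_
      simp only [norm_mul, norm_I, one_mul, norm_real, Real.norm_eq_abs, RCLike.norm_conj]
      rw [add_mul]
      gcongr
  have hkyi : IntegrableOn (fun s => (|‖G s‖ ^ 2 - P.q0 ^ 2| + ‖deriv G s‖) * M) (Set.Ioi y) :=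
    (hki.mono_set hsub).mul_const M
  have e1 := h.integral_eq_fst hG hGl hζ hδy hGy
  have e2 := h.integral_eq_snd hG hGl hQ hζ.1 hδy hGy
  have i1 : ‖∫ s in Set.Ioi y, exp (wexp P ζ * ((y - s : ℝ) : ℂ)) *
      (-(I * ((‖G s‖ ^ 2 - P.q0 ^ 2 : ℝ) : ℂ) * n1 s) + I * deriv G s * n2 s)‖ ≤ k * M := by
    refine (norm_integral_exp_mul_le hw f1).trans (le_trans ?_ hky)
    exact setIntegral_mono_on f1.norm hkyi measurableSet_Ioi fun s hs => (hbound s hs).1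
  have i2 : ‖∫ s in Set.Ioi y, (I * ((‖G s‖ ^ 2 - P.q0 ^ 2 : ℝ) : ℂ) * n2 s
      + I * conj (deriv G s) * n1 s)‖ ≤ k * M :=
    (norm_integral_le_of_norm_le hkyi
      ((ae_restrict_mem measurableSet_Ioi).mono fun s hs => (hbound s hs).2)).trans hky
  obtain ⟨b1, b2⟩ := hM y hy
  have b3 := hB y hy
  have hB0 : 0 ≤ B := (norm_nonneg _).trans b3
  constructor
  · rw [eq_sub_of_add_eq e1]
    refine (norm_sub_le _ _).trans ?_
    have h1 : ‖I * G y * n2 y / ζ‖ ≤ B * M / ‖ζ‖ := by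
      rw [norm_div, norm_mul, norm_mul, norm_I, one_mul]
      gcongr
    have h2 : ‖-(1 / ζ * ∫ s in Set.Ioi y, exp (wexp P ζ * ((y - s : ℝ) : ℂ)) *
        (-(I * ((‖G s‖ ^ 2 - P.q0 ^ 2 : ℝ) : ℂ) * n1 s) + I * deriv G s * n2 s))‖
        ≤ k * M / ‖ζ‖ := by
      rw [norm_neg, norm_mul, norm_div, norm_one, div_mul_eq_mul_div, one_mul]
      gcongr
    refine (add_le_add h2 h1).trans (le_of_eq ?_)
    ring
  · have e3 : n2 y - 1 = P.q0 ^ 2 / ζ ^ 2 + (-(1 / ζ * ∫ s in Set.Ioi y,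
        (I * ((‖G s‖ ^ 2 - P.q0 ^ 2 : ℝ) : ℂ) * n2 s + I * conj (deriv G s) * n1 s))
        + -(I * conj (G y) * n1 y / ζ)) := by
      linear_combination e2
    rw [e3]
    have h1 : ‖-(I * conj (G y) * n1 y / ζ)‖ ≤ B * M / ‖ζ‖ := by
      rw [norm_neg, norm_div, norm_mul, norm_mul, norm_I, one_mul, RCLike.norm_conj]
      gcongr
    have h2 : ‖-(1 / ζ * ∫ s in Set.Ioi y,
        (I * ((‖G s‖ ^ 2 - P.q0 ^ 2 : ℝ) : ℂ) * n2 s + I * conj (deriv G s) * n1 s))‖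
        ≤ k * M / ‖ζ‖ := by
      rw [norm_neg, norm_mul, norm_div, norm_one, div_mul_eq_mul_div, one_mul]
      gcongr
    have h3 : ‖(P.q0 : ℂ) ^ 2 / ζ ^ 2‖ = P.q0 ^ 2 / ‖ζ‖ ^ 2 := by
      rw [norm_div, norm_pow, norm_pow, norm_real, Real.norm_eq_abs, sq_abs]
    refine (norm_add_le _ _).trans ?_
    rw [h3]
    refine add_le_add le_rfl ((norm_add_le _ _).trans ((add_le_add h2 h1).trans (le_of_eq ?_)))
    ring

/-- For large `ζ` the columns are bounded on `[x, ∞)` by a constant independent of `ζ`. -/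
theorem IsGaugedColumn.uniform_bound (hG : Differentiable ℝ G)
    (hGl : Tendsto G atTop (𝓝 Q)) (hQ : ‖Q‖ = P.q0)
    (h : ∀ ζ ∈ closedD1 P, IsGaugedColumn P G Q ζ (n1 ζ) (n2 ζ)) {x : ℝ}
    (hδ : IntegrableOn (fun s => ‖G s‖ ^ 2 - P.q0 ^ 2) (Set.Ioi x))
    (hG' : IntegrableOn (deriv G) (Set.Ioi x)) :
    ∃ R C : ℝ, 0 < R ∧ 0 ≤ C ∧ ∀ ζ ∈ closedD1 P, R ≤ ‖ζ‖ → ∀ y, x ≤ y →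
      ‖n1 ζ y‖ ≤ C / ‖ζ‖ ∧ ‖n2 ζ y - 1‖ ≤ C / ‖ζ‖ ∧ ‖n2 ζ y‖ ≤ C := by
  obtain ⟨B, hB0, hB⟩ := exists_bound_of_tendsto hG.continuous hGl x
  set k := ∫ s in Set.Ioi x, (|‖G s‖ ^ 2 - P.q0 ^ 2| + ‖deriv G s‖) with hk
  have hk0 : 0 ≤ k := integral_nonneg fun s => by positivity
  have hq := P.q0_pos
  refine ⟨max 1 (max P.q0 (2 * (k + B))), P.q0 ^ 2 + (k + B) * 4 + 4, by positivity, by positivity,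
    fun ζ hζ hR y hy => ?_⟩
  have hR1 : 1 ≤ ‖ζ‖ := (le_max_left _ _).trans hR
  have hR2 : P.q0 ≤ ‖ζ‖ := ((le_max_left _ _).trans (le_max_right _ _)).trans hR
  have hR3 : 2 * (k + B) ≤ ‖ζ‖ := ((le_max_right _ _).trans (le_max_right _ _)).trans hR
  have hζ0 : 0 < ‖ζ‖ := by linarith
  have hq1 : P.q0 ^ 2 / ‖ζ‖ ^ 2 ≤ 1 := by
    rw [div_le_one (by positivity)]
    gcongr
  have hq2 : P.q0 ^ 2 / ‖ζ‖ ^ 2 ≤ P.q0 ^ 2 / ‖ζ‖ := by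
    gcongr
    nlinarith
  have hz := h ζ hζ
  have key : ∀ {M : ℝ}, (∀ y, x ≤ y → ‖n1 ζ y‖ ≤ M ∧ ‖n2 ζ y‖ ≤ M) → ∀ y, x ≤ y →
      ‖n1 ζ y‖ ≤ (k + B) * M / ‖ζ‖ ∧ ‖n2 ζ y - 1‖ ≤ P.q0 ^ 2 / ‖ζ‖ ^ 2 + (k + B) * M / ‖ζ‖ :=
    fun hM y hy => hz.norm_le_of_norm_le hG hGl hQ hζ hδ hG' hB hM hy
  have hmax : ∀ y : Set.Ici x, max ‖n1 ζ y‖ ‖n2 ζ y‖ ≤ 2 * 2 := by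
    refine le_two_mul_of_bound_imp (u := fun y : Set.Ici x => max ‖n1 ζ y‖ ‖n2 ζ y‖) ?_ ?_
    · obtain ⟨M1, _, h1⟩ := exists_bound_of_tendsto hz.continuous.1 hz.tendsto_fst x
      obtain ⟨M2, _, h2⟩ := exists_bound_of_tendsto hz.continuous.2 hz.tendsto_snd x
      refine ⟨max M1 M2, ?_⟩
      rintro _ ⟨y, rfl⟩
      exact max_le_max (h1 y y.2) (h2 y y.2)
    · intro M hM y
      have hM' : ∀ y, x ≤ y → ‖n1 ζ y‖ ≤ M ∧ ‖n2 ζ y‖ ≤ M := fun y hy =>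
        max_le_iff.1 (hM ⟨y, hy⟩)
      have hM0 : 0 ≤ M := (norm_nonneg _).trans (hM' x le_rfl).1
      obtain ⟨a1, a2⟩ := key hM' y y.2
      have h3 : (k + B) * M / ‖ζ‖ ≤ M / 2 := by
        rw [div_le_iff₀ hζ0]
        nlinarith
      have h4 : ‖n2 ζ y‖ ≤ ‖n2 ζ y - 1‖ + 1 := by
        have := norm_add_le (n2 ζ y - 1) 1
        simpa using this
      exact max_le (by linarith) (by linarith)
  have hM4 : ∀ y, x ≤ y → ‖n1 ζ y‖ ≤ 4 ∧ ‖n2 ζ y‖ ≤ 4 := fun y hy => by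
    have := hmax ⟨y, hy⟩
    norm_num at this
    exact this
  obtain ⟨a1, a2⟩ := key hM4 y hy
  refine ⟨a1.trans ?_, a2.trans ?_, (hM4 y hy).2.trans ?_⟩
  · exact div_le_div_of_nonneg_right (by nlinarith) hζ0.le
  · refine (add_le_add hq2 le_rfl).trans ?_
    rw [← add_div]
    exact div_le_div_of_nonneg_right (by linarith) hζ0.le
  · nlinarith

/-- The filter of neighbourhoods of `∞` within `D₁ ∪ Σ_Ω`. -/
noncomputable def atInftyD1 (P : Params) : Filter ℂ := Bornology.cobounded ℂ ⊓ 𝓟 (closedD1 P)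

theorem tendsto_norm_wexp : Tendsto (fun ζ => ‖wexp P ζ‖) (Bornology.cobounded ℂ) atTop := by
  have h1 : Tendsto (fun ζ : ℂ => ‖ζ‖) (Bornology.cobounded ℂ) atTop := tendsto_norm_cobounded_atTop
  have h2 : Tendsto (fun ζ : ℂ => ‖ζ‖ - P.q0 ^ 2) (Bornology.cobounded ℂ) atTop :=
    tendsto_atTop_add_const_right _ _ h1
  refine tendsto_atTop_mono' _ ?_ h2
  filter_upwards [h1.eventually_ge_atTop 1] with ζ hζ
  have h3 : wexp P ζ = -I * (ζ + P.q0 ^ 2 / ζ) := by rw [wexp, lam]; ring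
  have h4 : ‖(P.q0 : ℂ) ^ 2 / ζ‖ ≤ P.q0 ^ 2 := by
    rw [norm_div, norm_pow, norm_real, Real.norm_eq_abs, sq_abs]
    exact div_le_self (by positivity) hζ
  rw [h3, norm_mul, norm_neg, norm_I, one_mul]
  have h5 := norm_sub_norm_le ζ (-((P.q0 : ℂ) ^ 2 / ζ))
  rw [norm_neg, sub_neg_eq_add] at h5
  linarith

theorem tendsto_const_div_norm (C : ℝ) :
    Tendsto (fun ζ : ℂ => C / ‖ζ‖) (Bornology.cobounded ℂ) (𝓝 0) :=
  tendsto_norm_cobounded_atTop.const_div_atTop C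

/-- Asymptotics at `∞` in the gauge without the diagonal term. -/
theorem IsGaugedColumn.tendsto_atInfty (hG : ContDiff ℝ 2 G)
    (hGl : Tendsto G atTop (𝓝 Q)) (hQ : ‖Q‖ = P.q0)
    (h : ∀ ζ ∈ closedD1 P, IsGaugedColumn P G Q ζ (n1 ζ) (n2 ζ)) {x : ℝ}
    (hδ : IntegrableOn (fun s => ‖G s‖ ^ 2 - P.q0 ^ 2) (Set.Ioi x))
    (hG' : IntegrableOn (deriv G) (Set.Ioi x)) :
    Tendsto (fun ζ => n2 ζ x) (atInftyD1 P) (𝓝 1) ∧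
      Tendsto (fun ζ => ζ * n1 ζ x) (atInftyD1 P) (𝓝 (-I * G x)) := by
  have hGd : Differentiable ℝ G := hG.differentiable two_ne_zero
  obtain ⟨R, C, hR0, hC0, hRC⟩ := IsGaugedColumn.uniform_bound hGd hGl hQ h hδ hG'
  have hev : ∀ᶠ ζ in atInftyD1 P, ζ ∈ closedD1 P ∧ R ≤ ‖ζ‖ := by
    refine Eventually.and ?_ ?_
    · exact mem_inf_of_right (mem_principal_self _)
    · exact (tendsto_norm_cobounded_atTop.eventually_ge_atTop R).filter_mono inf_le_left
  have hsmall : ∀ C : ℝ, Tendsto (fun ζ : ℂ => C / ‖ζ‖) (atInftyD1 P) (𝓝 0) := fun C =>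
    (tendsto_const_div_norm C).mono_left inf_le_left
  have hn2 : Tendsto (fun ζ => n2 ζ x) (atInftyD1 P) (𝓝 1) := by
    rw [tendsto_iff_norm_sub_tendsto_zero]
    refine squeeze_zero' (Eventually.of_forall fun _ => norm_nonneg _) ?_ (hsmall C)
    filter_upwards [hev] with ζ hζ using (hRC ζ hζ.1 hζ.2 x le_rfl).2.1
  refine ⟨hn2, ?_⟩
  have hg1 : ContDiff ℝ 1 (deriv G) := by
    have : ContDiff ℝ (1 + 1) G := by simpa [one_add_one_eq_two] using hG
    exact (contDiff_succ_iff_deriv.1 this).2.2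
  set k := ∫ s in Set.Ioi x, (|‖G s‖ ^ 2 - P.q0 ^ 2| + ‖deriv G s‖) with hk
  have hki : IntegrableOn (fun s => |‖G s‖ ^ 2 - P.q0 ^ 2| + ‖deriv G s‖) (Set.Ioi x) :=
    hδ.norm.add hG'.norm
  -- The oscillatory part tends to zero by the Riemann-Lebesgue lemma.
  have hRL : Tendsto (fun ζ => ∫ s in Set.Ioi x, exp (wexp P ζ * ((x - s : ℝ) : ℂ)) *
      (I * deriv G s)) (atInftyD1 P) (𝓝 0) := by
    rw [tendsto_zero_iff_norm_tendsto_zero]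
    rw [Metric.tendsto_nhds]
    intro ε hε
    obtain ⟨R', hR'⟩ := riemannLebesgue_Ioi (contDiff_const.mul hg1) (hG'.const_mul I) (half_pos hε)
    have h1 : ∀ᶠ ζ in atInftyD1 P, R' ≤ ‖wexp P ζ‖ :=
      (tendsto_norm_wexp.eventually_ge_atTop R').filter_mono inf_le_left
    filter_upwards [hev, h1] with ζ h2 h3
    rw [dist_zero_right, norm_norm]
    exact (hR' _ (by rw [wexp_re]; linarith [h2.1.2.2]) h3).trans_lt (half_lt_self hε)
  have hrest : Tendsto (fun ζ => ∫ s in Set.Ioi x, exp (wexp P ζ * ((x - s : ℝ) : ℂ)) *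
      (-(I * ((‖G s‖ ^ 2 - P.q0 ^ 2 : ℝ) : ℂ) * n1 ζ s) + I * deriv G s * (n2 ζ s - 1)))
      (atInftyD1 P) (𝓝 0) := by
    refine squeeze_zero_norm' (a := fun ζ => k * C / ‖ζ‖) ?_ (hsmall (k * C))
    filter_upwards [hev] with ζ hζ
    have hw : 0 ≤ (wexp P ζ).re := by rw [wexp_re]; linarith [hζ.1.2.2]
    have : k * C / ‖ζ‖ = ∫ s in Set.Ioi x, (|‖G s‖ ^ 2 - P.q0 ^ 2| + ‖deriv G s‖) * (C / ‖ζ‖) := by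
      rw [integral_mul_const, mul_div_assoc]
    rw [this]
    refine norm_integral_le_of_norm_le (hki.mul_const _) ?_
    filter_upwards [ae_restrict_mem measurableSet_Ioi] with s hs
    obtain ⟨b1, b2, _⟩ := hRC ζ hζ.1 hζ.2 s (le_of_lt hs)
    rw [norm_mul]
    refine (mul_le_of_le_one_left (norm_nonneg _)
      (norm_exp_mul_sub_le_one hw (le_of_lt hs))).trans ((norm_add_le _ _).trans ?_)
    simp only [norm_neg, norm_mul, norm_I, one_mul, norm_real, Real.norm_eq_abs]
    rw [add_mul]
    gcongr
  have hlim := ((hRL.add hrest).neg).sub ((hn2.const_mul (I * G x)))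
  refine (hlim.congr' ?_).congr_right (by ring)
  filter_upwards [hev] with ζ hζ
  have hz := h ζ hζ.1
  have hw : 0 ≤ (wexp P ζ).re := by rw [wexp_re]; linarith [hζ.1.2.2]
  have e1 := hz.integral_eq_fst hGd hGl hζ.1 hδ hG'
  have i1 := integrableOn_exp_mul hw (hG'.const_mul I)
  have i2 : IntegrableOn (fun s => exp (wexp P ζ * ((x - s : ℝ) : ℂ)) *
      (-(I * ((‖G s‖ ^ 2 - P.q0 ^ 2 : ℝ) : ℂ) * n1 ζ s) + I * deriv G s * (n2 ζ s - 1)))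
      (Set.Ioi x) := by
    refine integrableOn_exp_mul hw (((hz.forcing_integrable hδ hG').1.sub
      (hG'.const_mul I)).congr (Eventually.of_forall fun s => ?_))
    simp only [Pi.sub_apply]
    ring
  have e2 : ∫ s in Set.Ioi x, exp (wexp P ζ * ((x - s : ℝ) : ℂ)) *
      (-(I * ((‖G s‖ ^ 2 - P.q0 ^ 2 : ℝ) : ℂ) * n1 ζ s) + I * deriv G s * n2 ζ s)
      = (∫ s in Set.Ioi x, exp (wexp P ζ * ((x - s : ℝ) : ℂ)) * (I * deriv G s))
      + ∫ s in Set.Ioi x, exp (wexp P ζ * ((x - s : ℝ) : ℂ)) *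
      (-(I * ((‖G s‖ ^ 2 - P.q0 ^ 2 : ℝ) : ℂ) * n1 ζ s) + I * deriv G s * (n2 ζ s - 1)) := by
    rw [← integral_add i1 i2]
    congr 1
    funext s
    ring
  rw [e2] at e1
  have hinv : ζ * ζ⁻¹ = 1 := mul_inv_cancel₀ hζ.1.1
  generalize (∫ s in Set.Ioi x, exp (wexp P ζ * ((x - s : ℝ) : ℂ)) * (I * deriv G s)) = X at e1 ⊢
  generalize (∫ s in Set.Ioi x, exp (wexp P ζ * ((x - s : ℝ) : ℂ)) *
    (-(I * ((‖G s‖ ^ 2 - P.q0 ^ 2 : ℝ) : ℂ) * n1 ζ s) + I * deriv G s * (n2 ζ s - 1))) = Y at e1 ⊢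
  linear_combination (-ζ) * e1 + (I * G x * n2 ζ x + X + Y) * hinv

end GaugedFamily

section Ungauge

variable {P : Params} {p : ℝ → ℂ} {Q : ℂ}

/-- The potential in the gauge without diagonal term. -/
noncomputable def gaugedPotential (P : Params) (p : ℝ → ℂ) (y : ℝ) : ℂ :=
  p y * exp (2 * I * tail (tau P p) y)

theorem IsPotential.hasDerivAt_tail_tau (h : IsPotential P p Q) (y : ℝ) :
    HasDerivAt (fun y => (tail (tau P p) y : ℂ)) (-(tau P p y : ℂ)) y := by
  have := (hasDerivAt_tail (continuous_tau (P := P) h.continuous) h.tau_integrable y).ofReal_comp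
  simpa using this

theorem norm_gaugedPotential (y : ℝ) : ‖gaugedPotential P p y‖ = ‖p y‖ := by
  have : (2 * I * (tail (tau P p) y : ℂ)) = ((2 * tail (tau P p) y : ℝ) : ℂ) * I := by
    push_cast; ring
  rw [gaugedPotential, norm_mul, this, norm_exp_ofReal_mul_I, mul_one]

theorem IsPotential.hasDerivAt_gaugedPotential (h : IsPotential P p Q) (y : ℝ) :
    HasDerivAt (gaugedPotential P p)
      ((deriv p y - 2 * I * tau P p y * p y) * exp (2 * I * tail (tau P p) y)) y := by
  have h1 := (h.contDiff.differentiable two_ne_zero y).hasDerivAt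
  refine (h1.mul ((h.hasDerivAt_tail_tau y).const_mul (2 * I)).cexp).congr_deriv ?_
  ring

theorem IsPotential.contDiff_gaugedPotential (h : IsPotential P p Q) :
    ContDiff ℝ 2 (gaugedPotential P p) := by
  have hτ : ContDiff ℝ 2 (tau P p) := by
    have := h.contDiff.norm_sq ℝ
    unfold tau
    exact contDiff_const.mul (this.sub contDiff_const)
  have ht : ContDiff ℝ 2 (tail (tau P p)) := by
    have hd : deriv (tail (tau P p)) = fun y => -tau P p y := funext fun y =>
      (hasDerivAt_tail (continuous_tau (P := P) h.continuous) h.tau_integrable y).deriv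
    have : ContDiff ℝ (1 + 1) (tail (tau P p)) := by
      refine contDiff_succ_iff_deriv.2 ⟨fun y => (hasDerivAt_tail
        (continuous_tau (P := P) h.continuous) h.tau_integrable y).differentiableAt, by simp, ?_⟩
      rw [hd]
      exact hτ.neg.of_le one_le_two
    simpa [one_add_one_eq_two] using this
  have h2 : ContDiff ℝ 2 (fun y => (tail (tau P p) y : ℂ)) := ofRealCLM.contDiff.comp ht
  exact h.contDiff.mul (contDiff_const.mul h2).cexp

theorem IsPotential.tendsto_gaugedPotential (h : IsPotential P p Q) :
    Tendsto (gaugedPotential P p) atTop (𝓝 Q) := by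
  have h1 : Tendsto (fun y => (tail (tau P p) y : ℂ)) atTop (𝓝 ((0 : ℝ) : ℂ)) :=
    (continuous_ofReal.tendsto 0).comp (tendsto_tail _)
  have h2 : Tendsto (gaugedPotential P p) atTop _ := h.tendsto.mul ((h1.const_mul (2 * I)).cexp)
  exact h2.congr_right (by simp)

theorem IsPotential.delta_integrable (h : IsPotential P p Q) (a : ℝ) :
    IntegrableOn (fun s => ‖p s‖ ^ 2 - P.q0 ^ 2) (Set.Ioi a) := by
  have h1 : IsPotential { P with T := 1 } p Q := ⟨h.1, h.2, h.3, h.4, h.5⟩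
  have h2 := h1.tau_integrable a
  unfold tau at h2
  simpa using h2

theorem IsPotential.deriv_gaugedPotential_integrable (h : IsPotential P p Q) (a : ℝ) :
    IntegrableOn (deriv (gaugedPotential P p)) (Set.Ioi a) := by
  have h1 : IntegrableOn (fun y => (tau P p y : ℂ) * p y) (Set.Ioi a) :=
    integrableOn_mul_of_bounded h.continuous h.tendsto (h.tau_integrable a).ofReal
  have h2 : IntegrableOn (fun y => deriv p y - 2 * I * ((tau P p y : ℂ) * p y)) (Set.Ioi a) :=
    h.integrable_deriv.integrableOn.sub (h1.const_mul _)
  have h3 : Tendsto (fun y => exp (2 * I * tail (tau P p) y)) atTop (𝓝 (exp (2 * I * (0 : ℝ)))) :=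
    (((continuous_ofReal.tendsto 0).comp (tendsto_tail (tau P p))).const_mul (2 * I)).cexp
  have h4 : Continuous fun y => exp (2 * I * tail (tau P p) y) := by
    have : Continuous fun y => (tail (tau P p) y : ℂ) :=
      continuous_iff_continuousAt.2 fun y => (h.hasDerivAt_tail_tau y).continuousAt
    fun_prop
  refine (integrableOn_mul_of_bounded h4 h3 h2).congr (Eventually.of_forall fun y => ?_)
  simp only
  rw [(h.hasDerivAt_gaugedPotential y).deriv]
  ring

theorem IsColumn.isGaugedColumn (h : IsPotential P p Q) {ζ : ℂ} {m1 m2 : ℝ → ℂ}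
    (hm : IsColumn P p Q ζ m1 m2) :
    IsGaugedColumn P (gaugedPotential P p) Q ζ
      (fun y => exp (I * tail (tau P p) y) * m1 y)
      (fun y => exp (-(I * tail (tau P p) y)) * m2 y) := by
  have h1 : Tendsto (fun y => (tail (tau P p) y : ℂ)) atTop (𝓝 ((0 : ℝ) : ℂ)) :=
    (continuous_ofReal.tendsto 0).comp (tendsto_tail _)
  refine ⟨fun y => ?_, fun y => ?_, ?_, ?_⟩
  · refine ((((h.hasDerivAt_tail_tau y).const_mul I).cexp).mul (hm.deriv_fst y)).congr_deriv ?_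
    have e : exp (2 * I * tail (tau P p) y) * exp (-(I * tail (tau P p) y))
        = exp (I * tail (tau P p) y) := by
      rw [← exp_add]; congr 1; ring
    simp only [gaugedPotential]
    linear_combination (-(p y * m2 y)) * e
  · refine ((((h.hasDerivAt_tail_tau y).const_mul I).neg.cexp).mul (hm.deriv_snd y)).congr_deriv ?_
    have e0 : conj (exp (2 * I * tail (tau P p) y)) = exp (-(2 * I * tail (tau P p) y)) := by
      rw [← exp_conj]; congr 1; simp [conj_ofNat]
    have e : exp (-(2 * I * tail (tau P p) y)) * exp (I * tail (tau P p) y)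
        = exp (-(I * tail (tau P p) y)) := by
      rw [← exp_add]; congr 1; ring
    simp only [gaugedPotential, map_mul, e0]
    linear_combination (conj (p y) * m1 y) * e
  · simpa using ((h1.const_mul I).cexp).mul hm.tendsto_fst
  · simpa using (((h1.const_mul I).neg).cexp).mul hm.tendsto_snd

/-- Asymptotics of the Jost columns at `∞`: `m2 → exp (i ω)` and `ζ m1 → -i p exp (i ω)`, where
`ω` is the integral of `tau` over `(x, ∞)`. -/
theorem IsColumn.tendsto_atInfty (h : IsPotential P p Q) {f1 f2 : ℂ → ℝ → ℂ}
    (hf : ∀ ζ ∈ closedD1 P, IsColumn P p Q ζ (f1 ζ) (f2 ζ)) (x : ℝ) :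
    Tendsto (fun ζ => f2 ζ x) (atInftyD1 P) (𝓝 (exp (I * tail (tau P p) x))) ∧
      Tendsto (fun ζ => ζ * f1 ζ x) (atInftyD1 P)
        (𝓝 (-I * p x * exp (I * tail (tau P p) x))) := by
  obtain ⟨a1, a2⟩ := IsGaugedColumn.tendsto_atInfty h.contDiff_gaugedPotential
    h.tendsto_gaugedPotential h.norm_eq (fun ζ hζ => (hf ζ hζ).isGaugedColumn h) (x := x)
    (by simpa only [norm_gaugedPotential] using h.delta_integrable x)
    (h.deriv_gaugedPotential_integrable x)
  have e1 : exp (I * tail (tau P p) x) * exp (-(I * tail (tau P p) x)) = 1 := by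
    rw [← exp_add]; simp
  have e2 : exp (2 * I * tail (tau P p) x) * exp (-(I * tail (tau P p) x))
      = exp (I * tail (tau P p) x) := by
    rw [← exp_add]; congr 1; ring
  constructor
  · refine ((a1.const_mul (exp (I * tail (tau P p) x))).congr fun ζ => ?_).congr_right (mul_one _)
    linear_combination (f2 ζ x) * e1
  · refine ((a2.const_mul (exp (-(I * tail (tau P p) x)))).congr fun ζ => ?_).congr_right ?_
    · linear_combination (ζ * f1 ζ x) * e1
    · simp only [gaugedPotential]
      linear_combination (-I * p x) * e2

end Ungauge

/-! ### Contour integrals along the boundaries of half-annuli -/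

/-- The integral of `H` along the arc `r exp (i v)`, `v` from `c` to `d`. -/
noncomputable def arcIntegral (H : ℂ → ℂ) (r c d : ℝ) : ℂ :=
  ∫ v in c..d, H (r * exp (I * v)) * (I * r * exp (I * v))

/-- The integral of `H` along the segment from `r1 exp (i c)` to `r2 exp (i c)`. -/
noncomputable def rayIntegral (H : ℂ → ℂ) (c r1 r2 : ℝ) : ℂ :=
  ∫ ρ in r1..r2, H (ρ * exp (I * c)) * exp (I * c)

/-- Cauchy's theorem for an annular sector, obtained from that for a rectangle by `exp`. -/
theorem integral_boundary_sector_eq_zero {H : ℂ → ℂ} {S D : Set ℂ} {r1 r2 c d : ℝ} (h1 : 0 < r1)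
    (h12 : r1 ≤ r2) (hcd : c ≤ d) (hH : ContinuousOn H S) (hD : DifferentiableOn ℂ H D)
    (hS : ∀ ρ ∈ Set.Icc r1 r2, ∀ v ∈ Set.Icc c d, (ρ : ℂ) * exp (I * v) ∈ S)
    (hDi : ∀ ρ ∈ Set.Ioo r1 r2, ∀ v ∈ Set.Ioo c d, (ρ : ℂ) * exp (I * v) ∈ D) :
    rayIntegral H c r1 r2 - rayIntegral H d r1 r2 + arcIntegral H r2 c d
      - arcIntegral H r1 c d = 0 := by
  have h2 : 0 < r2 := h1.trans_le h12
  have hlog : Real.log r1 ≤ Real.log r2 := Real.log_le_log h1 h12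
  have hexp : ∀ u v : ℝ, exp ((u : ℂ) + v * I) = (Real.exp u : ℂ) * exp (I * v) := by
    intro u v
    rw [exp_add, ofReal_exp, mul_comm I]
  have hpol : ∀ z : ℂ, exp z = (Real.exp z.re : ℂ) * exp (I * z.im) := by
    intro z
    rw [← hexp, re_add_im]
  have hIcc : ∀ u ∈ Set.Icc (Real.log r1) (Real.log r2), Real.exp u ∈ Set.Icc r1 r2 := fun u hu =>
    ⟨(Real.log_le_iff_le_exp h1).1 hu.1, (Real.le_log_iff_exp_le h2).1 hu.2⟩
  have hIoo : ∀ u ∈ Set.Ioo (Real.log r1) (Real.log r2), Real.exp u ∈ Set.Ioo r1 r2 := fun u hu =>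
    ⟨(Real.log_lt_iff_lt_exp h1).1 hu.1, (Real.lt_log_iff_exp_lt h2).1 hu.2⟩
  have key := Complex.integral_boundary_rect_eq_zero_of_continuousOn_of_differentiableOn
    (fun w => H (exp w) * exp w) ⟨Real.log r1, c⟩ ⟨Real.log r2, d⟩ ?_ ?_
  · have hray : ∀ v ∈ Set.Icc c d, ∫ u in Real.log r1..Real.log r2,
        H (exp ((u : ℂ) + v * I)) * exp ((u : ℂ) + v * I) = rayIntegral H v r1 r2 := by
      intro v hv
      have hsub := intervalIntegral.integral_deriv_smul_comp'' (a := Real.log r1)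
        (b := Real.log r2) (f := Real.exp) (f' := Real.exp)
        (g := fun ρ : ℝ => H (ρ * exp (I * v)) * exp (I * v)) Real.continuous_exp.continuousOn
        (fun x _ => (Real.hasDerivAt_exp x).hasDerivWithinAt) Real.continuous_exp.continuousOn ?_
      · rw [Real.exp_log h1, Real.exp_log h2] at hsub
        rw [rayIntegral, ← hsub]
        congr 1
        funext u
        simp only [Function.comp, hexp, real_smul]
        ring
      · rintro _ ⟨u, hu, rfl⟩
        rw [Set.uIcc_of_le hlog] at hu
        refine ContinuousWithinAt.mul ?_ continuousWithinAt_const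
        refine ContinuousWithinAt.comp (t := S) (hH _ (hS _ (hIcc u hu) v hv))
          (Continuous.continuousWithinAt (by fun_prop)) ?_
        rintro _ ⟨u, hu, rfl⟩
        rw [Set.uIcc_of_le hlog] at hu
        exact hS _ (hIcc u hu) v hv
    have harc : ∀ r : ℝ, 0 < r → I • ∫ v in c..d, H (exp ((Real.log r : ℂ) + v * I))
        * exp ((Real.log r : ℂ) + v * I) = arcIntegral H r c d := by
      intro r hr
      rw [arcIntegral, smul_eq_mul, ← intervalIntegral.integral_const_mul]
      congr 1
      funext v
      rw [hexp, Real.exp_log hr]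
      ring
    simp only at key
    rw [hray c ⟨le_rfl, hcd⟩, hray d ⟨hcd, le_rfl⟩, harc r2 h2, harc r1 h1] at key
    exact key
  · simp only [Set.uIcc_of_le hlog, Set.uIcc_of_le hcd]
    have hmap : Set.MapsTo exp (Set.Icc (Real.log r1) (Real.log r2) ×ℂ Set.Icc c d) S := by
      rintro z ⟨hz1, hz2⟩
      rw [hpol]
      exact hS _ (hIcc _ hz1) _ hz2
    exact (hH.comp continuous_exp.continuousOn hmap).mul continuous_exp.continuousOn
  · simp only [min_eq_left hlog, max_eq_right hlog, min_eq_left hcd, max_eq_right hcd]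
    have hmap : Set.MapsTo exp (Set.Ioo (Real.log r1) (Real.log r2) ×ℂ Set.Ioo c d) D := by
      rintro z ⟨hz1, hz2⟩
      rw [hpol]
      exact hDi _ (hIoo _ hz1) _ hz2
    exact (hD.comp differentiable_exp.differentiableOn hmap).mul differentiable_exp.differentiableOn

/-- Arc integrals converge when the radius does, if the integrand stays bounded and the limit arc
meets the exceptional set in countably many points only. -/
theorem tendsto_arcIntegral {H : ℂ → ℂ} {S : Set ℂ} {c d r C : ℝ} (hcd : c ≤ d)
    (hH : ContinuousOn H S) {ι : Type*} {l : Filter ι} [l.IsCountablyGenerated] {ρ : ι → ℝ}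
    (hρ : Tendsto ρ l (𝓝 r))
    (hS : ∀ᶠ i in l, ∀ v ∈ Set.Icc c d, (ρ i : ℂ) * exp (I * v) ∈ S)
    {B : Set ℝ} (hB : B.Countable) (hr : ∀ v ∈ Set.Icc c d, v ∉ B → (r : ℂ) * exp (I * v) ∈ S)
    (hC : ∀ᶠ i in l, ∀ v ∈ Set.Icc c d, ‖H ((ρ i : ℂ) * exp (I * v))‖ ≤ C) :
    Tendsto (fun i => arcIntegral H (ρ i) c d) l (𝓝 (arcIntegral H r c d)) := by
  have hsub : Set.uIoc c d ⊆ Set.Icc c d := by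
    rw [Set.uIoc_of_le hcd]; exact Set.Ioc_subset_Icc_self
  have hbr : ∀ᶠ i in l, |ρ i| ≤ |r| + 1 :=
    (hρ.abs.eventually_lt_const (lt_add_one |r|)).mono fun _ h => le_of_lt h
  unfold arcIntegral
  refine intervalIntegral.tendsto_integral_filter_of_dominated_convergence
    (fun _ => C * (|r| + 1)) ?_ ?_ intervalIntegrable_const ?_
  · filter_upwards [hS] with i hi
    refine ContinuousOn.aestronglyMeasurable ?_ measurableSet_uIoc
    refine ContinuousOn.mul ?_ (Continuous.continuousOn (by fun_prop))
    exact hH.comp (Continuous.continuousOn (by fun_prop)) fun v hv => hi v (hsub hv)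
  · filter_upwards [hC, hbr] with i h1 h2
    refine Eventually.of_forall fun v hv => ?_
    rw [norm_mul, norm_mul, norm_mul, norm_I, one_mul, norm_real, mul_comm I, norm_exp_ofReal_mul_I,
      mul_one, Real.norm_eq_abs]
    have := h1 v (hsub hv)
    rw [mul_comm I] at this
    exact mul_le_mul this h2 (abs_nonneg _) ((norm_nonneg _).trans this)
  · have hBae : ∀ᵐ v : ℝ, v ∉ B := by
      rw [ae_iff]
      simpa using hB.measure_zero volume
    filter_upwards [hBae] with v hv hvcd
    have h1 : Tendsto (fun i => (ρ i : ℂ)) l (𝓝 (r : ℂ)) := (continuous_ofReal.tendsto r).comp hρ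
    refine Tendsto.mul ?_ ((h1.const_mul I).mul_const _)
    refine (hH _ (hr v (hsub hvcd) hv)).tendsto.comp (tendsto_nhdsWithin_iff.2 ⟨h1.mul_const _, ?_⟩)
    filter_upwards [hS] with i hi using hi v (hsub hvcd)

theorem tendsto_rayIntegral {H : ℂ → ℂ} {S : Set ℂ} {c r1 r2 : ℝ} (h12 : r1 < r2)
    (hH : ContinuousOn H S) (hS : ∀ ρ ∈ Set.Icc r1 r2, (ρ : ℂ) * exp (I * c) ∈ S) :
    Tendsto (fun s => rayIntegral H c (r1 + s) (r2 - s)) (𝓝[>] 0) (𝓝 (rayIntegral H c r1 r2)) := by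
  have hF : ContinuousOn (fun ρ : ℝ => H (ρ * exp (I * c)) * exp (I * c)) (Set.Icc r1 r2) :=
    (hH.comp (Continuous.continuousOn (by fun_prop)) fun ρ hρ => hS ρ hρ).mul continuousOn_const
  have hi : IntegrableOn (fun ρ : ℝ => H (ρ * exp (I * c)) * exp (I * c)) (Set.uIcc r1 r2) := by
    rw [Set.uIcc_of_le h12.le]
    exact hF.integrableOn_Icc
  have hp := intervalIntegral.continuousOn_primitive_interval hi
  rw [Set.uIcc_of_le h12.le] at hp
  have hev : ∀ᶠ s : ℝ in 𝓝[>] 0, s ∈ Set.Ioo 0 (r2 - r1) := Ioo_mem_nhdsGT (by linarith)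
  have hid : Tendsto (fun s : ℝ => s) (𝓝[>] 0) (𝓝 0) := tendsto_id.mono_left nhdsWithin_le_nhds
  have t1 : Tendsto (fun s : ℝ => r1 + s) (𝓝[>] 0) (𝓝[Set.Icc r1 r2] r1) := by
    refine tendsto_nhdsWithin_iff.2 ⟨by simpa using hid.const_add r1, ?_⟩
    filter_upwards [hev] with s hs
    exact ⟨by linarith [hs.1], by linarith [hs.2]⟩
  have t2 : Tendsto (fun s : ℝ => r2 - s) (𝓝[>] 0) (𝓝[Set.Icc r1 r2] r2) := by
    refine tendsto_nhdsWithin_iff.2 ⟨by simpa using hid.const_sub r2, ?_⟩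
    filter_upwards [hev] with s hs
    exact ⟨by linarith [hs.2], by linarith [hs.1]⟩
  have l1 := (hp r1 ⟨le_rfl, h12.le⟩).tendsto.comp t1
  have l2 := (hp r2 ⟨h12.le, le_rfl⟩).tendsto.comp t2
  have := l2.sub l1
  rw [intervalIntegral.integral_same, sub_zero] at this
  refine this.congr' ?_
  filter_upwards [hev] with s hs
  have i1 : IntervalIntegrable (fun ρ : ℝ => H (ρ * exp (I * c)) * exp (I * c)) volume r1
      (r1 + s) := by
    refine (hF.mono ?_).intervalIntegrable
    rw [Set.uIcc_of_le (by linarith [hs.1])]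
    exact Set.Icc_subset_Icc le_rfl (by linarith [hs.2])
  have i2 : IntervalIntegrable (fun ρ : ℝ => H (ρ * exp (I * c)) * exp (I * c)) volume r1
      (r2 - s) := by
    refine (hF.mono ?_).intervalIntegrable
    rw [Set.uIcc_of_le (by linarith [hs.2])]
    exact Set.Icc_subset_Icc le_rfl (by linarith [hs.1])
  exact intervalIntegral.integral_interval_sub_left i2 i1

/-- Cauchy's theorem for an annular sector when the bounding arcs may contain countably many
points at which the function is only known to be bounded nearby. -/
theorem integral_boundary_sector_eq_zero_of_bounded {H : ℂ → ℂ} {S D : Set ℂ} {r1 r2 c d C : ℝ}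
    (h1 : 0 < r1) (h12 : r1 < r2) (hcd : c ≤ d) (hH : ContinuousOn H S)
    (hD : DifferentiableOn ℂ H D)
    (hS : ∀ ρ ∈ Set.Ioo r1 r2, ∀ v ∈ Set.Icc c d, (ρ : ℂ) * exp (I * v) ∈ S)
    (hDi : ∀ ρ ∈ Set.Ioo r1 r2, ∀ v ∈ Set.Ioo c d, (ρ : ℂ) * exp (I * v) ∈ D)
    (hc : ∀ ρ ∈ Set.Icc r1 r2, (ρ : ℂ) * exp (I * c) ∈ S)
    (hd : ∀ ρ ∈ Set.Icc r1 r2, (ρ : ℂ) * exp (I * d) ∈ S) {B : Set ℝ} (hB : B.Countable)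
    (hS' : ∀ ρ ∈ Set.Icc r1 r2, ∀ v ∈ Set.Icc c d, v ∉ B → (ρ : ℂ) * exp (I * v) ∈ S)
    (hC : ∀ ζ ∈ S, r1 ≤ ‖ζ‖ → ‖ζ‖ ≤ r2 → ‖H ζ‖ ≤ C) :
    rayIntegral H c r1 r2 - rayIntegral H d r1 r2 + arcIntegral H r2 c d
      - arcIntegral H r1 c d = 0 := by
  have hev : ∀ᶠ s : ℝ in 𝓝[>] 0, s ∈ Set.Ioo 0 ((r2 - r1) / 2) := Ioo_mem_nhdsGT (by linarith)
  have hid : Tendsto (fun s : ℝ => s) (𝓝[>] 0) (𝓝 0) := tendsto_id.mono_left nhdsWithin_le_nhds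
  have hnorm : ∀ ρ ∈ Set.Ioo r1 r2, ∀ v : ℝ, ‖(ρ : ℂ) * exp (I * v)‖ = ρ := fun ρ hρ v => by
    rw [norm_mul, mul_comm I, norm_exp_ofReal_mul_I, mul_one, norm_real,
      Real.norm_of_nonneg (h1.le.trans hρ.1.le)]
  have hCb : ∀ ρ ∈ Set.Ioo r1 r2, ∀ v ∈ Set.Icc c d, ‖H ((ρ : ℂ) * exp (I * v))‖ ≤ C :=
    fun ρ hρ v hv => hC _ (hS ρ hρ v hv) (by rw [hnorm ρ hρ]; exact hρ.1.le)
      (by rw [hnorm ρ hρ]; exact hρ.2.le)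
  have m1 : ∀ᶠ s : ℝ in 𝓝[>] 0, r1 + s ∈ Set.Ioo r1 r2 := hev.mono fun s hs =>
    ⟨by linarith [hs.1], by linarith [hs.1, hs.2]⟩
  have m2 : ∀ᶠ s : ℝ in 𝓝[>] 0, r2 - s ∈ Set.Ioo r1 r2 := hev.mono fun s hs =>
    ⟨by linarith [hs.1, hs.2], by linarith [hs.1]⟩
  have a1 := tendsto_arcIntegral (C := C) hcd hH (by simpa using hid.const_add r1)
    (m1.mono fun s hs => hS _ hs) hB (hS' r1 ⟨le_rfl, h12.le⟩) (m1.mono fun s hs => hCb _ hs)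
  have a2 := tendsto_arcIntegral (C := C) hcd hH (by simpa using hid.const_sub r2)
    (m2.mono fun s hs => hS _ hs) hB (hS' r2 ⟨h12.le, le_rfl⟩) (m2.mono fun s hs => hCb _ hs)
  have l := (((tendsto_rayIntegral h12 hH hc).sub (tendsto_rayIntegral h12 hH hd)).add a2).sub a1
  refine tendsto_nhds_unique l (tendsto_const_nhds.congr' ?_)
  filter_upwards [hev] with s hs
  refine (integral_boundary_sector_eq_zero (by linarith [hs.1]) (by linarith [hs.1, hs.2]) hcd hH hD
    (fun ρ hρ => hS ρ ⟨?_, ?_⟩) (fun ρ hρ => hDi ρ ⟨?_, ?_⟩)).symm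
  · linarith [hρ.1, hs.1]
  · linarith [hρ.2, hs.1]
  · linarith [hρ.1, hs.1]
  · linarith [hρ.2, hs.1]

/-- If `ζ H(ζ)` tends to `k` uniformly on the arcs, the arc integrals tend to `i (d - c) k`. -/
theorem tendsto_arcIntegral_of_mul_tendsto {H : ℂ → ℂ} {S : Set ℂ} {c d : ℝ} (hcd : c ≤ d)
    (hH : ContinuousOn H S) {l : Filter ℝ} {k : ℂ}
    (hS : ∀ᶠ r : ℝ in l, ∀ v ∈ Set.Icc c d, (r : ℂ) * exp (I * v) ∈ S)
    (hk : ∀ ε > 0, ∀ᶠ r : ℝ in l, ∀ v ∈ Set.Icc c d,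
      ‖(r : ℂ) * exp (I * v) * H (r * exp (I * v)) - k‖ ≤ ε) :
    Tendsto (fun r => arcIntegral H r c d) l (𝓝 (I * (d - c) * k)) := by
  rw [Metric.tendsto_nhds]
  intro ε hε
  have hδ : 0 < ε / (d - c + 1) := by
    have : 0 < d - c + 1 := by linarith
    positivity
  filter_upwards [hS, hk _ hδ] with r h1 h2
  have hcont : ContinuousOn (fun v : ℝ => H (r * exp (I * v)) * (I * r * exp (I * v)))
      (Set.uIcc c d) := by
    rw [Set.uIcc_of_le hcd]
    exact (hH.comp (Continuous.continuousOn (by fun_prop)) fun v hv => h1 v hv).mul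
      (Continuous.continuousOn (by fun_prop))
  have e1 : arcIntegral H r c d - I * (d - c) * k
      = ∫ v in c..d, (H (r * exp (I * v)) * (I * r * exp (I * v)) - I * k) := by
    rw [intervalIntegral.integral_sub hcont.intervalIntegrable intervalIntegrable_const,
      intervalIntegral.integral_const, arcIntegral, real_smul]
    push_cast
    ring
  rw [dist_eq_norm, e1]
  have h3 : ‖∫ v in c..d, (H (r * exp (I * v)) * (I * r * exp (I * v)) - I * k)‖
      ≤ ε / (d - c + 1) * |d - c| := by
    refine intervalIntegral.norm_integral_le_of_norm_le_const fun v hv => ?_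
    rw [Set.uIoc_of_le hcd] at hv
    have e2 : H (r * exp (I * v)) * (I * r * exp (I * v)) - I * k
        = I * ((r : ℂ) * exp (I * v) * H (r * exp (I * v)) - k) := by ring
    rw [e2, norm_mul, norm_I, one_mul]
    exact h2 v ⟨hv.1.le, hv.2⟩
  refine h3.trans_lt ?_
  rw [abs_of_nonneg (by linarith), div_mul_eq_mul_div, div_lt_iff₀ (by linarith)]
  nlinarith

/-! ### The regions `D₁`, `D₂` and the contour `Σ_Ω` -/

section Regions

variable {P : Params}

/-- `D₂ ∪ Σ_Ω`. -/
def closedD2 (P : Params) : Set ℂ := {ζ | ζ ≠ 0 ∧ lam P ζ ≠ 0 ∧ (lam P ζ).im ≤ 0}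

theorem lam_im (ζ : ℂ) : (lam P ζ).im = (‖ζ‖ ^ 2 - P.q0 ^ 2) * ζ.im / (2 * ‖ζ‖ ^ 2) := by
  rcases eq_or_ne ζ 0 with rfl | h
  · simp [lam]
  have h1 : normSq ζ ≠ 0 := normSq_eq_zero.not.2 h
  have h2 : ((P.q0 : ℂ) ^ 2 / ζ).im = -(P.q0 ^ 2 * ζ.im / normSq ζ) := by
    rw [← ofReal_pow, div_im]
    simp only [ofReal_re, ofReal_im]
    ring
  have h3 : (lam P ζ).im = (ζ.im + ((P.q0 : ℂ) ^ 2 / ζ).im) / 2 := by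
    rw [lam, show (2 : ℂ) = ((2 : ℝ) : ℂ) by norm_num, div_ofReal_im, add_im]
  rw [h3, h2, ← normSq_eq_norm_sq]
  field_simp
  ring

theorem lam_eq_zero_iff {ζ : ℂ} (h : ζ ≠ 0) : lam P ζ = 0 ↔ ζ = I * P.q0 ∨ ζ = -(I * P.q0) := by
  have h1 : lam P ζ = (ζ - I * P.q0) * (ζ + I * P.q0) / (2 * ζ) := by
    rw [lam]
    field_simp
    linear_combination ((P.q0 : ℂ) ^ 2) * I_sq
  rw [h1, div_eq_zero_iff, mul_eq_zero, sub_eq_zero, add_eq_zero_iff_eq_neg]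
  simp [h]

theorem mem_D1_iff {ζ : ℂ} : ζ ∈ D1 P ↔ 0 < (lam P ζ).im := by
  rcases eq_or_ne ζ 0 with rfl | h
  · simp [lam, D1]
  have : 0 < 2 * ‖ζ‖ ^ 2 := by positivity
  rw [lam_im, div_pos_iff_of_pos_right this]
  rfl

theorem mem_D2_iff {ζ : ℂ} : ζ ∈ D2 P ↔ (lam P ζ).im < 0 := by
  rcases eq_or_ne ζ 0 with rfl | h
  · simp [lam, D2]
  have : 0 < 2 * ‖ζ‖ ^ 2 := by positivity
  rw [lam_im, div_neg_iff]
  simp only [D2, Set.mem_ofPred_eq, this, this.not_gt, and_true, and_false, false_or]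

theorem mem_Sigma_iff {ζ : ℂ} :
    ζ ∈ Sigma P ↔ ζ ≠ 0 ∧ lam P ζ ≠ 0 ∧ (lam P ζ).im = 0 := by
  refine and_congr_right fun h => ?_
  have : 0 < 2 * ‖ζ‖ ^ 2 := by positivity
  have hl : lam P ζ ≠ 0 ↔ ζ ≠ I * P.q0 ∧ ζ ≠ -(I * P.q0) := by
    rw [Ne, lam_eq_zero_iff h, not_or]
  rw [hl, and_assoc, lam_im, div_eq_zero_iff, mul_eq_zero]
  refine and_congr_right fun _ => and_congr_right fun _ => ?_
  have h2 : ‖ζ‖ ^ 2 - P.q0 ^ 2 = 0 ↔ ‖ζ‖ = P.q0 := by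
    rw [sub_eq_zero, sq_eq_sq₀ (norm_nonneg _) P.q0_pos.le]
  rw [h2]
  simp only [this.ne', or_false]
  exact or_comm

theorem D1_union_Sigma : D1 P ∪ Sigma P = closedD1 P := by
  ext ζ
  rw [Set.mem_union, mem_D1_iff, mem_Sigma_iff, closedD1, Set.mem_ofPred_eq]
  constructor
  · rintro (h | ⟨h1, h2, h3⟩)
    · refine ⟨?_, ?_, h.le⟩
      · rintro rfl; simp [lam] at h
      · intro h0; simp [h0] at h
    · exact ⟨h1, h2, h3.ge⟩
  · rintro ⟨h1, h2, h3⟩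
    rcases h3.lt_or_eq with h | h
    · exact Or.inl h
    · exact Or.inr ⟨h1, h2, h.symm⟩

theorem D2_union_Sigma : D2 P ∪ Sigma P = closedD2 P := by
  ext ζ
  rw [Set.mem_union, mem_D2_iff, mem_Sigma_iff, closedD2, Set.mem_ofPred_eq]
  constructor
  · rintro (h | ⟨h1, h2, h3⟩)
    · refine ⟨?_, ?_, h.le⟩
      · rintro rfl; simp [lam] at h
      · intro h0; simp [h0] at h
    · exact ⟨h1, h2, h3.le⟩
  · rintro ⟨h1, h2, h3⟩
    rcases h3.lt_or_eq with h | h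
    · exact Or.inl h
    · exact Or.inr ⟨h1, h2, h⟩

theorem isOpen_D1 : IsOpen (D1 P) :=
  isOpen_lt continuous_const (((continuous_norm.pow 2).sub continuous_const).mul continuous_im)

theorem isOpen_D2 : IsOpen (D2 P) :=
  isOpen_lt (((continuous_norm.pow 2).sub continuous_const).mul continuous_im) continuous_const

theorem D1_subset : D1 P ⊆ closedD1 P := D1_union_Sigma (P := P) ▸ Set.subset_union_left

theorem D2_subset : D2 P ⊆ closedD2 P := D2_union_Sigma (P := P) ▸ Set.subset_union_left

theorem Sigma_subset_closedD1 : Sigma P ⊆ closedD1 P :=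
  D1_union_Sigma (P := P) ▸ Set.subset_union_right

theorem Sigma_subset_closedD2 : Sigma P ⊆ closedD2 P :=
  D2_union_Sigma (P := P) ▸ Set.subset_union_right

theorem norm_polar {ρ : ℝ} (h : 0 < ρ) (v : ℝ) : ‖(ρ : ℂ) * exp (I * v)‖ = ρ := by
  rw [norm_mul, mul_comm I, norm_exp_ofReal_mul_I, mul_one, norm_real, Real.norm_of_nonneg h.le]

theorem polar_re (ρ v : ℝ) : ((ρ : ℂ) * exp (I * v)).re = ρ * Real.cos v := by
  rw [mul_comm I, re_ofReal_mul, exp_ofReal_mul_I_re]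

theorem polar_im (ρ v : ℝ) : ((ρ : ℂ) * exp (I * v)).im = ρ * Real.sin v := by
  rw [mul_comm I, im_ofReal_mul, exp_ofReal_mul_I_im]

theorem polar_D_sign {ρ : ℝ} (h : 0 < ρ) (v : ℝ) :
    (‖(ρ : ℂ) * exp (I * v)‖ ^ 2 - P.q0 ^ 2) * ((ρ : ℂ) * exp (I * v)).im
      = (ρ + P.q0) * ρ * ((ρ - P.q0) * Real.sin v) := by
  rw [norm_polar h, polar_im]; ring

theorem polar_mem_D1 {ρ v : ℝ} (h : 0 < ρ) (hs : 0 < (ρ - P.q0) * Real.sin v) :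
    (ρ : ℂ) * exp (I * v) ∈ D1 P := by
  have := P.q0_pos
  rw [D1, Set.mem_ofPred_eq, polar_D_sign h]
  positivity

theorem polar_mem_D2 {ρ v : ℝ} (h : 0 < ρ) (hs : (ρ - P.q0) * Real.sin v < 0) :
    (ρ : ℂ) * exp (I * v) ∈ D2 P := by
  have := P.q0_pos
  rw [D2, Set.mem_ofPred_eq, polar_D_sign h]
  exact mul_neg_of_pos_of_neg (by positivity) hs

theorem polar_mem_Sigma {ρ v : ℝ} (h : 0 < ρ) (hs : (ρ - P.q0) * Real.sin v = 0)
    (hc : Real.cos v ≠ 0) : (ρ : ℂ) * exp (I * v) ∈ Sigma P := by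
  have h0 : ((ρ : ℂ) * exp (I * v)).re ≠ 0 := by
    rw [polar_re]; exact mul_ne_zero h.ne' hc
  refine ⟨fun h1 => h0 (by rw [h1]; simp), fun h1 => h0 (by rw [h1]; simp),
    fun h1 => h0 (by rw [h1]; simp), ?_⟩
  rw [norm_polar h, polar_im]
  rcases mul_eq_zero.1 hs with h1 | h1
  · exact Or.inr (by linarith)
  · exact Or.inl (by rw [h1, mul_zero])

theorem polar_mem_closedD1 {ρ v : ℝ} (h : 0 < ρ) (hs : 0 ≤ (ρ - P.q0) * Real.sin v)
    (hc : ρ ≠ P.q0 ∨ Real.cos v ≠ 0) : (ρ : ℂ) * exp (I * v) ∈ closedD1 P := by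
  rcases hs.lt_or_eq with h1 | h1
  · exact D1_subset (polar_mem_D1 h h1)
  · refine Sigma_subset_closedD1 (polar_mem_Sigma h h1.symm ?_)
    rcases hc with h2 | h2
    · rcases mul_eq_zero.1 h1.symm with h3 | h3
      · exact absurd (by linarith) h2
      · intro h4
        have := Real.sin_sq_add_cos_sq v
        rw [h3, h4] at this
        norm_num at this
    · exact h2

theorem polar_mem_closedD2 {ρ v : ℝ} (h : 0 < ρ) (hs : (ρ - P.q0) * Real.sin v ≤ 0)
    (hc : ρ ≠ P.q0 ∨ Real.cos v ≠ 0) : (ρ : ℂ) * exp (I * v) ∈ closedD2 P := by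
  rcases hs.lt_or_eq with h1 | h1
  · exact D2_subset (polar_mem_D2 h h1)
  · refine Sigma_subset_closedD2 (polar_mem_Sigma h h1 ?_)
    rcases hc with h2 | h2
    · rcases mul_eq_zero.1 h1 with h3 | h3
      · exact absurd (by linarith) h2
      · intro h4
        have := Real.sin_sq_add_cos_sq v
        rw [h3, h4] at this
        norm_num at this
    · exact h2

theorem ofReal_mem_Sigma {s : ℝ} (hs : s ≠ 0) : (s : ℂ) ∈ Sigma P := by
  refine ⟨by exact_mod_cast hs, fun h => ?_, fun h => ?_, Or.inl (by simp)⟩ <;>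
  · have := congrArg re h
    simp at this
    exact hs this

theorem countable_cos_zero : {v : ℝ | Real.cos v = 0}.Countable := by
  refine (Set.countable_range fun k : ℤ => (2 * k + 1) * Real.pi / 2).mono fun v hv => ?_
  obtain ⟨k, hk⟩ := Real.cos_eq_zero_iff.1 hv
  exact ⟨k, hk.symm⟩

end Regions

/-! ### Cauchy's theorem for sectionally holomorphic functions -/

section Contour

variable {P : Params}

/-- `H` is holomorphic in the open set `D`, continuous on `S` (in the applications `S = D ∪ Σ_Ω`),
bounded near every nonzero point, and `ζ H(ζ)` has the limits `k0` at `0` and `kInf` at `∞`. -/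
structure IsSectional (S D : Set ℂ) (H : ℂ → ℂ) (k0 kInf : ℂ) : Prop where
  cont : ContinuousOn H S
  diff : DifferentiableOn ℂ H D
  bounded : ∀ z, z ≠ 0 → ∃ C, ∀ᶠ ζ in 𝓝[S] z, ‖H ζ‖ ≤ C
  zero : Tendsto (fun ζ => ζ * H ζ) (𝓝[S] 0) (𝓝 k0)
  infty : Tendsto (fun ζ => ζ * H ζ) (Bornology.cobounded ℂ ⊓ 𝓟 S) (𝓝 kInf)

theorem IsSectional.bounded_annulus {S D : Set ℂ} {H : ℂ → ℂ} {k0 kInf : ℂ}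
    (h : IsSectional S D H k0 kInf) {r1 : ℝ} (h1 : 0 < r1) (r2 : ℝ) :
    ∃ C, ∀ ζ ∈ S, r1 ≤ ‖ζ‖ → ‖ζ‖ ≤ r2 → ‖H ζ‖ ≤ C := by
  have hK : IsCompact (Metric.closedBall (0 : ℂ) r2 ∩ {ζ | r1 ≤ ‖ζ‖}) :=
    (isCompact_closedBall 0 r2).inter_right (isClosed_le continuous_const continuous_norm)
  have := hK.induction_on (p := fun s => ∃ C, ∀ ζ ∈ s, ζ ∈ S → ‖H ζ‖ ≤ C) ⟨0, by simp⟩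
    (fun s t hst ⟨C, hC⟩ => ⟨C, fun ζ hζ => hC ζ (hst hζ)⟩)
    (fun s t ⟨C, hC⟩ ⟨C', hC'⟩ => ⟨max C C', fun ζ hζ hS => ?_⟩) (fun z hz => ?_)
  · obtain ⟨C, hC⟩ := this
    exact ⟨C, fun ζ hζ h1 h2 => hC ζ ⟨by simpa using h2, h1⟩ hζ⟩
  · rcases hζ with h | h
    · exact (hC ζ h hS).trans (le_max_left _ _)
    · exact (hC' ζ h hS).trans (le_max_right _ _)
  · have hz0 : z ≠ 0 := norm_pos_iff.1 (h1.trans_le hz.2)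
    obtain ⟨C, hC⟩ := h.bounded z hz0
    exact ⟨_, mem_nhdsWithin_of_mem_nhds (mem_nhdsWithin_iff_eventually.1 hC), C,
      fun ζ hζ hS => hζ hS⟩

theorem IsSectional.tendsto_arc_infty {S D : Set ℂ} {H : ℂ → ℂ} {k0 kInf : ℂ}
    (h : IsSectional S D H k0 kInf) {c d : ℝ} (hcd : c ≤ d)
    (hS : ∀ᶠ r : ℝ in atTop, ∀ v ∈ Set.Icc c d, (r : ℂ) * exp (I * v) ∈ S) :
    Tendsto (fun r => arcIntegral H r c d) atTop (𝓝 (I * (d - c) * kInf)) := by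
  refine tendsto_arcIntegral_of_mul_tendsto hcd h.cont hS fun ε hε => ?_
  have h1 := (Metric.tendsto_nhds.1 h.infty) ε hε
  rw [eventually_inf_principal, ← comap_norm_atTop, eventually_comap] at h1
  filter_upwards [h1, hS, eventually_gt_atTop 0] with r h2 h3 h4 v hv
  rw [← dist_eq_norm]
  exact (h2 _ (norm_polar h4 v) (h3 v hv)).le

theorem IsSectional.tendsto_arc_zero {S D : Set ℂ} {H : ℂ → ℂ} {k0 kInf : ℂ}
    (h : IsSectional S D H k0 kInf) {c d : ℝ} (hcd : c ≤ d)
    (hS : ∀ᶠ r : ℝ in 𝓝[>] 0, ∀ v ∈ Set.Icc c d, (r : ℂ) * exp (I * v) ∈ S) :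
    Tendsto (fun r => arcIntegral H r c d) (𝓝[>] 0) (𝓝 (I * (d - c) * k0)) := by
  refine tendsto_arcIntegral_of_mul_tendsto hcd h.cont hS fun ε hε => ?_
  have h1 := (Metric.tendsto_nhds.1 h.zero) ε hε
  rw [eventually_nhdsWithin_iff, Metric.eventually_nhds_iff] at h1
  obtain ⟨δ, hδ, h2⟩ := h1
  filter_upwards [Ioo_mem_nhdsGT hδ, hS] with r h4 h3 v hv
  rw [← dist_eq_norm]
  refine (h2 ?_ (h3 v hv)).le
  rw [dist_zero_right, norm_polar h4.1]
  exact h4.2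

theorem rayIntegral_zero (H : ℂ → ℂ) (r1 r2 : ℝ) :
    rayIntegral H 0 r1 r2 = ∫ ρ in r1..r2, H (ρ : ℂ) := by
  simp [rayIntegral]

theorem rayIntegral_pi (H : ℂ → ℂ) (r1 r2 : ℝ) :
    rayIntegral H Real.pi r1 r2 = -∫ ρ in r1..r2, H ((-ρ : ℝ) : ℂ) := by
  have : exp (I * Real.pi) = -1 := by rw [mul_comm, exp_pi_mul_I]
  simp [rayIntegral, this]

theorem rayIntegral_neg_pi (H : ℂ → ℂ) (r1 r2 : ℝ) :
    rayIntegral H (-Real.pi) r1 r2 = -∫ ρ in r1..r2, H ((-ρ : ℝ) : ℂ) := by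
  have : exp (-(I * Real.pi)) = -1 := by rw [exp_neg, mul_comm, exp_pi_mul_I]; norm_num
  simp [rayIntegral, this]

/-- The boundary integral over an upper half-annulus. -/
theorem IsSectional.upper {S D : Set ℂ} {H : ℂ → ℂ} {k0 kInf : ℂ}
    (h : IsSectional S D H k0 kInf) {r1 r2 : ℝ} (h1 : 0 < r1) (h12 : r1 < r2)
    (hS : ∀ ρ ∈ Set.Icc r1 r2, ∀ v, 0 ≤ Real.sin v → (ρ ∈ Set.Ioo r1 r2 ∨ Real.cos v ≠ 0) →
      (ρ : ℂ) * exp (I * v) ∈ S)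
    (hD : ∀ ρ ∈ Set.Ioo r1 r2, ∀ v, 0 < Real.sin v → (ρ : ℂ) * exp (I * v) ∈ D) :
    (∫ ρ in r1..r2, H (ρ : ℂ)) + (∫ ρ in r1..r2, H ((-ρ : ℝ) : ℂ))
      + arcIntegral H r2 0 Real.pi - arcIntegral H r1 0 Real.pi = 0 := by
  obtain ⟨C, hC⟩ := h.bounded_annulus h1 r2
  have hs : ∀ v ∈ Set.Icc 0 Real.pi, 0 ≤ Real.sin v := fun v hv => Real.sin_nonneg_of_mem_Icc hv
  have := integral_boundary_sector_eq_zero_of_bounded (C := C) h1 h12 Real.pi_pos.le h.cont h.diff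
    (fun ρ hρ v hv => hS ρ (Set.Ioo_subset_Icc_self hρ) v (hs v hv) (Or.inl hρ))
    (fun ρ hρ v hv => hD ρ hρ v (Real.sin_pos_of_mem_Ioo hv))
    (fun ρ hρ => hS ρ hρ 0 (by simp) (by simp)) (fun ρ hρ => hS ρ hρ Real.pi (by simp) (by simp))
    countable_cos_zero (fun ρ hρ v hv hc => hS ρ hρ v (hs v hv) (Or.inr hc)) hC
  rw [rayIntegral_zero, rayIntegral_pi] at this
  linear_combination this

/-- The boundary integral over a lower half-annulus. -/
theorem IsSectional.lower {S D : Set ℂ} {H : ℂ → ℂ} {k0 kInf : ℂ}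
    (h : IsSectional S D H k0 kInf) {r1 r2 : ℝ} (h1 : 0 < r1) (h12 : r1 < r2)
    (hS : ∀ ρ ∈ Set.Icc r1 r2, ∀ v, Real.sin v ≤ 0 → (ρ ∈ Set.Ioo r1 r2 ∨ Real.cos v ≠ 0) →
      (ρ : ℂ) * exp (I * v) ∈ S)
    (hD : ∀ ρ ∈ Set.Ioo r1 r2, ∀ v, Real.sin v < 0 → (ρ : ℂ) * exp (I * v) ∈ D) :
    -(∫ ρ in r1..r2, H ((-ρ : ℝ) : ℂ)) - (∫ ρ in r1..r2, H (ρ : ℂ))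
      + arcIntegral H r2 (-Real.pi) 0 - arcIntegral H r1 (-Real.pi) 0 = 0 := by
  obtain ⟨C, hC⟩ := h.bounded_annulus h1 r2
  have hs : ∀ v ∈ Set.Icc (-Real.pi) 0, Real.sin v ≤ 0 := fun v hv =>
    Real.sin_nonpos_of_nonpos_of_neg_pi_le hv.2 hv.1
  have := integral_boundary_sector_eq_zero_of_bounded (C := C) (c := -Real.pi) (d := 0) h1 h12
    (by linarith [Real.pi_pos]) h.cont h.diff
    (fun ρ hρ v hv => hS ρ (Set.Ioo_subset_Icc_self hρ) v (hs v hv) (Or.inl hρ))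
    (fun ρ hρ v hv => hD ρ hρ v (Real.sin_neg_of_neg_of_neg_pi_lt hv.2 hv.1))
    (fun ρ hρ => hS ρ hρ (-Real.pi) (by simp) (by simp)) (fun ρ hρ => hS ρ hρ 0 (by simp) (by simp))
    countable_cos_zero (fun ρ hρ v hv hc => hS ρ hρ v (hs v hv) (Or.inr hc)) hC
  rw [rayIntegral_zero, rayIntegral_neg_pi] at this
  linear_combination this

theorem IsSectional.circle_intervalIntegrable {S D : Set ℂ} {H : ℂ → ℂ} {k0 kInf : ℂ}
    (h : IsSectional S D H k0 kInf) (hS : Sigma P ⊆ S) (a b : ℝ) :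
    IntervalIntegrable (fun v : ℝ => H (P.q0 * exp (I * v)) * (I * P.q0 * exp (I * v)))
      volume a b := by
  have hq := P.q0_pos
  obtain ⟨C, hC⟩ := h.bounded_annulus hq P.q0
  have hmem : ∀ v : ℝ, v ∉ {v : ℝ | Real.cos v = 0} → (P.q0 : ℂ) * exp (I * v) ∈ S := fun v hv =>
    hS (polar_mem_Sigma hq (by simp) hv)
  have hBae : ∀ᵐ v : ℝ, v ∉ {v : ℝ | Real.cos v = 0} := by
    rw [ae_iff]
    simpa using countable_cos_zero.measure_zero volume
  have hcont : ContinuousOn (fun v : ℝ => H (P.q0 * exp (I * v)) * (I * P.q0 * exp (I * v)))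
      {v : ℝ | Real.cos v = 0}ᶜ :=
    (h.cont.comp (Continuous.continuousOn (by fun_prop)) hmem).mul
      (Continuous.continuousOn (by fun_prop))
  have hmeas : AEStronglyMeasurable
      (fun v : ℝ => H (P.q0 * exp (I * v)) * (I * P.q0 * exp (I * v))) volume := by
    have h1 := hcont.aestronglyMeasurable (μ := volume) countable_cos_zero.measurableSet.compl
    have h2 : ∀ᵐ v : ℝ, v ∈ {v : ℝ | Real.cos v = 0}ᶜ := hBae
    rwa [Measure.restrict_eq_self_of_ae_mem h2] at h1
  refine (intervalIntegrable_const (c := C * P.q0)).mono_fun' hmeas.restrict ?_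
  refine ae_restrict_of_ae ?_
  filter_upwards [hBae] with v hv
  have hn := norm_polar hq v
  rw [norm_mul, mul_assoc, norm_mul, norm_I, one_mul, hn]
  exact mul_le_mul_of_nonneg_right (hC _ (hmem v hv) hn.ge hn.le) hq.le

/-- The jump of a sectionally holomorphic function, integrated over `Σ_Ω`, is given by its
behaviour at `0` and at `∞`. -/
theorem hasSigmaIntegral_of_isSectional {H1 H2 f : ℂ → ℂ} {k0 kInf : ℂ}
    (h1 : IsSectional (closedD1 P) (D1 P) H1 k0 kInf)
    (h2 : IsSectional (closedD2 P) (D2 P) H2 k0 kInf)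
    (hf : ∀ ζ ∈ Sigma P, f ζ = H1 ζ - H2 ζ)
    (hf0 : ∃ C, ∀ᶠ s : ℝ in 𝓝[≠] 0, ‖f s‖ ≤ C) :
    HasSigmaIntegral P f (2 * Real.pi * I * (kInf - k0)) := by
  have hq := P.q0_pos
  have hpi := Real.pi_pos
  -- The integrand is locally bounded and almost everywhere continuous on the real line.
  have hloc : LocallyIntegrable (fun s : ℝ => f s) volume := by
    have hmap1 : Set.MapsTo (fun s : ℝ => (s : ℂ)) {0}ᶜ (closedD1 P) := fun s hs =>
      Sigma_subset_closedD1 (ofReal_mem_Sigma hs)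
    have hmap2 : Set.MapsTo (fun s : ℝ => (s : ℂ)) {0}ᶜ (closedD2 P) := fun s hs =>
      Sigma_subset_closedD2 (ofReal_mem_Sigma hs)
    have hcont : ContinuousOn (fun s : ℝ => f s) {0}ᶜ := by
      refine ContinuousOn.congr ((h1.cont.comp continuous_ofReal.continuousOn hmap1).sub
        (h2.cont.comp continuous_ofReal.continuousOn hmap2)) fun s hs => ?_
      exact hf _ (ofReal_mem_Sigma hs)
    have hmeas : AEStronglyMeasurable (fun s : ℝ => f s) volume := by
      have h3 := hcont.aestronglyMeasurable (μ := volume) (measurableSet_singleton 0).compl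
      rwa [Measure.restrict_eq_self_of_ae_mem (by
        simp [ae_iff])] at h3
    intro s
    refine Measure.FiniteAtFilter.integrableAtFilter ⟨Set.univ, univ_mem, hmeas.restrict⟩
      (Measure.finiteAt_nhds _ _) ?_
    rcases eq_or_ne s 0 with rfl | hs
    · obtain ⟨C, hC⟩ := hf0
      refine ⟨max C ‖f ((0 : ℝ) : ℂ)‖, ?_⟩
      rw [eventually_map]
      rw [eventually_nhdsWithin_iff] at hC
      filter_upwards [hC] with r hr
      rcases eq_or_ne r 0 with rfl | h0
      · exact le_max_right _ _
      · exact (hr h0).trans (le_max_left _ _)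
    · exact ((hcont.continuousAt (isOpen_compl_singleton.mem_nhds hs)).norm).isBoundedUnder_le
  have hii : ∀ a b : ℝ, IntervalIntegrable (fun s : ℝ => f s) volume a b := fun a b =>
    (hloc.integrableOn_isCompact isCompact_uIcc).intervalIntegrable
  have hBae : ∀ᵐ v : ℝ, v ∉ {v : ℝ | Real.cos v = 0} := by
    rw [ae_iff]
    simpa using countable_cos_zero.measure_zero volume
  have hcirc : ∀ᵐ v : ℝ, circleForm P f v = H1 (P.q0 * exp (I * v)) * (I * P.q0 * exp (I * v))
      - H2 (P.q0 * exp (I * v)) * (I * P.q0 * exp (I * v)) := by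
    filter_upwards [hBae] with v hv
    rw [circleForm, hf _ (polar_mem_Sigma hq (by simp) hv)]
    ring
  have hc1 := fun a b => h1.circle_intervalIntegrable (P := P) Sigma_subset_closedD1 a b
  have hc2 := fun a b => h2.circle_intervalIntegrable (P := P) Sigma_subset_closedD2 a b
  have hcint : ∀ a b : ℝ, ∫ v in a..b, circleForm P f v
      = arcIntegral H1 P.q0 a b - arcIntegral H2 P.q0 a b := fun a b => by
    rw [arcIntegral, arcIntegral, ← intervalIntegral.integral_sub (hc1 a b) (hc2 a b)]
    exact intervalIntegral.integral_congr_ae (hcirc.mono fun v hv _ => hv)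
  refine ⟨?_, fun R => hii _ _, ?_⟩
  · refine ((hc1 (-Real.pi) Real.pi).sub (hc2 (-Real.pi) Real.pi)).congr_ae ?_
    exact ae_restrict_of_ae (hcirc.mono fun v hv => hv.symm)
  have hray : ∀ a b : ℝ, 0 < a → a ≤ b →
      (∫ s in a..b, f (s : ℂ)) = (∫ s in a..b, H1 (s : ℂ)) - ∫ s in a..b, H2 (s : ℂ) := by
    intro a b ha hab
    have hne : ∀ s ∈ Set.uIcc a b, s ≠ 0 := fun s hs => by
      rw [Set.uIcc_of_le hab] at hs
      exact (ha.trans_le hs.1).ne'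
    rw [← intervalIntegral.integral_sub]
    · exact intervalIntegral.integral_congr fun s hs => hf _ (ofReal_mem_Sigma (hne s hs))
    · exact ContinuousOn.intervalIntegrable (h1.cont.comp continuous_ofReal.continuousOn
        fun s hs => Sigma_subset_closedD1 (ofReal_mem_Sigma (hne s hs)))
    · exact ContinuousOn.intervalIntegrable (h2.cont.comp continuous_ofReal.continuousOn
        fun s hs => Sigma_subset_closedD2 (ofReal_mem_Sigma (hne s hs)))
  have hray' : ∀ a b : ℝ, 0 < a → a ≤ b → (∫ s in a..b, f ((-s : ℝ) : ℂ))
      = (∫ s in a..b, H1 ((-s : ℝ) : ℂ)) - ∫ s in a..b, H2 ((-s : ℝ) : ℂ) := by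
    intro a b ha hab
    have hne : ∀ s ∈ Set.uIcc a b, -s ≠ 0 := fun s hs => by
      rw [Set.uIcc_of_le hab] at hs
      exact neg_ne_zero.2 (ha.trans_le hs.1).ne'
    rw [← intervalIntegral.integral_sub]
    · exact intervalIntegral.integral_congr fun s hs => hf _ (ofReal_mem_Sigma (hne s hs))
    · exact ContinuousOn.intervalIntegrable (h1.cont.comp
        (continuous_ofReal.comp continuous_neg).continuousOn
        fun s hs => Sigma_subset_closedD1 (ofReal_mem_Sigma (hne s hs)))
    · exact ContinuousOn.intervalIntegrable (h2.cont.comp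
        (continuous_ofReal.comp continuous_neg).continuousOn
        fun s hs => Sigma_subset_closedD2 (ofReal_mem_Sigma (hne s hs)))
  -- Cauchy's theorem for the two outer half-annuli.
  have hout : ∀ R : ℝ, P.q0 < R → (∫ s in P.q0..R, f (s : ℂ)) + (∫ s in P.q0..R, f ((-s : ℝ) : ℂ))
      + (arcIntegral H1 R 0 Real.pi + arcIntegral H2 R (-Real.pi) 0)
      - arcIntegral H1 P.q0 0 Real.pi - arcIntegral H2 P.q0 (-Real.pi) 0 = 0 := by
    intro R hR
    have e1 := h1.upper hq hR
      (fun ρ hρ v hv hc => polar_mem_closedD1 (hq.trans_le hρ.1)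
        (mul_nonneg (by linarith [hρ.1]) hv) (hc.imp (fun h => h.1.ne') id))
      (fun ρ hρ v hv => polar_mem_D1 (hq.trans hρ.1) (mul_pos (by linarith [hρ.1]) hv))
    have e2 := h2.lower hq hR
      (fun ρ hρ v hv hc => polar_mem_closedD2 (hq.trans_le hρ.1)
        (mul_nonpos_of_nonneg_of_nonpos (by linarith [hρ.1]) hv) (hc.imp (fun h => h.1.ne') id))
      (fun ρ hρ v hv => polar_mem_D2 (hq.trans hρ.1)
        (mul_neg_of_pos_of_neg (by linarith [hρ.1]) hv))
    rw [hray _ _ hq hR.le, hray' _ _ hq hR.le]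
    linear_combination e1 + e2
  -- Cauchy's theorem for the two inner half-annuli.
  have hin : ∀ ε : ℝ, 0 < ε → ε < P.q0 → (∫ s in ε..P.q0, f (s : ℂ))
      + (∫ s in ε..P.q0, f ((-s : ℝ) : ℂ))
      = arcIntegral H2 P.q0 0 Real.pi + arcIntegral H1 P.q0 (-Real.pi) 0
        - (arcIntegral H2 ε 0 Real.pi + arcIntegral H1 ε (-Real.pi) 0) := by
    intro ε hε hεq
    have e1 := h2.upper hε hεq
      (fun ρ hρ v hv hc => polar_mem_closedD2 (hε.trans_le hρ.1)
        (mul_nonpos_of_nonpos_of_nonneg (by linarith [hρ.2]) hv) (hc.imp (fun h => h.2.ne) id))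
      (fun ρ hρ v hv => polar_mem_D2 (hε.trans hρ.1)
        (mul_neg_of_neg_of_pos (by linarith [hρ.2]) hv))
    have e2 := h1.lower hε hεq
      (fun ρ hρ v hv hc => polar_mem_closedD1 (hε.trans_le hρ.1)
        (mul_nonneg_of_nonpos_of_nonpos (by linarith [hρ.2]) hv) (hc.imp (fun h => h.2.ne) id))
      (fun ρ hρ v hv => polar_mem_D1 (hε.trans hρ.1)
        (mul_pos_of_neg_of_neg (by linarith [hρ.2]) hv))
    rw [hray _ _ hε hεq.le, hray' _ _ hε hεq.le]
    linear_combination -e1 - e2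
  -- The small arcs shrink to the origin.
  have hin0 : (∫ s in (0 : ℝ)..P.q0, f (s : ℂ)) + (∫ s in (0 : ℝ)..P.q0, f ((-s : ℝ) : ℂ))
      = arcIntegral H2 P.q0 0 Real.pi + arcIntegral H1 P.q0 (-Real.pi) 0
        - 2 * Real.pi * I * k0 := by
    have hii' : ∀ a b : ℝ, IntervalIntegrable (fun s : ℝ => f ((-s : ℝ) : ℂ)) volume a b :=
      fun a b => (IntervalIntegrable.iff_comp_neg (f := fun s : ℝ => f ((-s : ℝ) : ℂ))).2
        (by simpa using hii (-a) (-b))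
    have hprim : ∀ g : ℝ → ℂ, (∀ a b : ℝ, IntervalIntegrable g volume a b) →
        Tendsto (fun ε => ∫ s in ε..P.q0, g s) (𝓝[>] 0) (𝓝 (∫ s in (0 : ℝ)..P.q0, g s)) := by
      intro g hg
      have hp : Continuous fun ε => -∫ s in P.q0..ε, g s :=
        (intervalIntegral.continuous_primitive hg P.q0).neg
      have := (hp.tendsto 0).mono_left (nhdsWithin_le_nhds (s := Set.Ioi 0))
      simpa only [intervalIntegral.integral_symm P.q0, neg_neg] using this
    have hlt : ∀ᶠ ε : ℝ in 𝓝[>] 0, ε ∈ Set.Ioo 0 P.q0 := Ioo_mem_nhdsGT hq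
    have a2 := h2.tendsto_arc_zero (c := 0) (d := Real.pi) hpi.le (by
      filter_upwards [hlt] with ε hε v hv
      exact polar_mem_closedD2 hε.1 (mul_nonpos_of_nonpos_of_nonneg (by linarith [hε.2])
        (Real.sin_nonneg_of_mem_Icc hv)) (Or.inl hε.2.ne))
    have a1 := h1.tendsto_arc_zero (c := -Real.pi) (d := 0) (by linarith) (by
      filter_upwards [hlt] with ε hε v hv
      exact polar_mem_closedD1 hε.1 (mul_nonneg_of_nonpos_of_nonpos (by linarith [hε.2])
        (Real.sin_nonpos_of_nonpos_of_neg_pi_le hv.2 hv.1)) (Or.inl hε.2.ne))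
    have l := (hprim _ hii).add (hprim _ hii')
    have r := (a2.add a1).const_sub
      (arcIntegral H2 P.q0 0 Real.pi + arcIntegral H1 P.q0 (-Real.pi) 0)
    have := tendsto_nhds_unique l (r.congr' ?_)
    · rw [this]
      push_cast
      ring
    · filter_upwards [hlt] with ε hε using (hin ε hε.1 hε.2).symm
  have hneg : ∀ a b : ℝ, ∫ s in (-b)..(-a), f (s : ℂ) = ∫ s in a..b, f ((-s : ℝ) : ℂ) := fun a b =>
    (intervalIntegral.integral_comp_neg (fun s : ℝ => f (s : ℂ))).symm
  have a1 := h1.tendsto_arc_infty (c := 0) (d := Real.pi) hpi.le (by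
    filter_upwards [eventually_gt_atTop P.q0] with R hR v hv
    exact polar_mem_closedD1 (hq.trans hR) (mul_nonneg (by linarith)
      (Real.sin_nonneg_of_mem_Icc hv)) (Or.inl hR.ne'))
  have a2 := h2.tendsto_arc_infty (c := -Real.pi) (d := 0) (by linarith) (by
    filter_upwards [eventually_gt_atTop P.q0] with R hR v hv
    exact polar_mem_closedD2 (hq.trans hR) (mul_nonpos_of_nonneg_of_nonpos (by linarith)
      (Real.sin_nonpos_of_nonpos_of_neg_pi_le hv.2 hv.1)) (Or.inl hR.ne'))
  have l := ((a1.add a2).sub_const (2 * Real.pi * I * k0))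
  refine (l.congr' ?_).congr_right (by push_cast; ring)
  filter_upwards [eventually_gt_atTop P.q0] with R hR
  have e1 := hout R hR
  have e2 := hcint 0 Real.pi
  have e3 := hcint (-Real.pi) 0
  have e4 : ∫ s in (-P.q0)..P.q0, f (s : ℂ)
      = (∫ s in (0 : ℝ)..P.q0, f (s : ℂ)) + ∫ s in (0 : ℝ)..P.q0, f ((-s : ℝ) : ℂ) := by
    rw [← hneg 0 P.q0, neg_zero, add_comm,
      intervalIntegral.integral_add_adjacent_intervals (hii _ _) (hii _ _)]
  rw [sigmaIntegral, intervalIntegral.integral_symm (-Real.pi) 0, e2, e3, e4, hneg]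
  linear_combination e1 - hin0

end Contour

/-! ### The Jost solutions as columns on a half-line; symmetries -/

theorem mulVec_fin_two (M : Matrix (Fin 2) (Fin 2) ℂ) (v : Fin 2 → ℂ) (i : Fin 2) :
    (M *ᵥ v) i = M i 0 * v 0 + M i 1 * v 1 := by
  simp [Matrix.mulVec, dotProduct, Fin.sum_univ_two]

section Columns

variable {P : Params} {S : Set ℝ} {q : ℝ → ℝ → ℂ}

theorem norm_env (x t : ℝ) : ‖env P q x t‖ = ‖q x t‖ := by
  rw [env, norm_mul, neg_mul, mul_comm I, ← neg_mul, ← ofReal_neg, norm_exp_ofReal_mul_I, mul_one]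

theorem laxX_00 (x t : ℝ) (ζ : ℂ) :
    laxX P q x t ζ 0 0 = I * tau P (fun y => env P q y t) x - I * zTilde P ζ := by
  simp only [laxX, laxU, sigma3, spec, tau, norm_env, Matrix.sub_apply, Matrix.smul_apply, Matrix.of_apply,
    Matrix.cons_val', Matrix.cons_val_zero, Matrix.cons_val_fin_one, smul_eq_mul]
  push_cast
  ring

theorem laxX_01 (x t : ℝ) (ζ : ℂ) : laxX P q x t ζ 0 1 = env P q x t := by
  simp [laxX, laxU, sigma3, env]

theorem laxX_10 (x t : ℝ) (ζ : ℂ) : laxX P q x t ζ 1 0 = -conj (env P q x t) := by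
  simp [laxX, laxU, sigma3, env, ← exp_conj]

theorem laxX_11 (x t : ℝ) (ζ : ℂ) : laxX P q x t ζ 1 1 = -laxX P q x t ζ 0 0 := by
  simp [laxX, laxU, sigma3]
  ring

theorem laxT_11 (x t : ℝ) (ζ : ℂ) : laxT P q x t ζ 1 1 = -laxT P q x t ζ 0 0 := by
  simp [laxT, laxV, sigma3]
  ring

theorem mu_zero (ψ : ℝ → ℝ → ℂ → Matrix (Fin 2) (Fin 2) ℂ) (x t : ℝ) (ζ : ℂ) (i : Fin 2) :
    mu P ψ x t ζ i 0 = ψ x t ζ i 0 * exp (I * Theta P x t ζ) := by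
  simp [mu, expSigma3, Matrix.mul_apply, Fin.sum_univ_two]

theorem mu_one (ψ : ℝ → ℝ → ℂ → Matrix (Fin 2) (Fin 2) ℂ) (x t : ℝ) (ζ : ℂ) (i : Fin 2) :
    mu P ψ x t ζ i 1 = ψ x t ζ i 1 * exp (-(I * Theta P x t ζ)) := by
  simp [mu, expSigma3, Matrix.mul_apply, Fin.sum_univ_two]

theorem hasDerivAt_Theta (x t : ℝ) (ζ : ℂ) :
    HasDerivAt (fun y : ℝ => Theta P y t ζ) (lam P ζ) x := by
  have h : HasDerivAt (fun y : ℝ => (y : ℂ)) 1 x := by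
    simpa using (hasDerivAt_id x).ofReal_comp
  unfold Theta
  simpa using (h.add_const (2 * (spec P ζ + P.T * P.q0 ^ 2 - P.α / 2) * t)).const_mul (lam P ζ)

theorem zTilde_sub_lam (ζ : ℂ) : zTilde P ζ - lam P ζ = -(P.q0 ^ 2 / ζ) := by
  unfold zTilde lam; ring

theorem zTilde_add_lam (ζ : ℂ) : zTilde P ζ + lam P ζ = ζ := by
  unfold zTilde lam; ring

variable {l : Filter ℝ} {Q ζ : ℂ} {ψ : ℝ → ℝ → ℂ → Matrix (Fin 2) (Fin 2) ℂ} {t : ℝ}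

theorem IsJostColumn.hasDerivAt_apply {k : Fin 2} (h : IsJostColumn P S q l Q ψ k ζ) (ht : t ∈ S)
    (x : ℝ) (i : Fin 2) : HasDerivAt (fun y => ψ y t ζ i k)
      (laxX P q x t ζ i 0 * ψ x t ζ 0 k + laxX P q x t ζ i 1 * ψ x t ζ 1 k) x := by
  rw [← mulVec_fin_two (laxX P q x t ζ) (fun i => ψ x t ζ i k)]
  exact hasDerivAt_pi.1 (h.space x t ht) i

/-- The space part of the Lax pair for the first column of `μ`. -/
theorem IsJostColumn.hasDerivAt_mu_zero (h : IsJostColumn P S q l Q ψ 0 ζ) (ht : t ∈ S) (x : ℝ) :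
    HasDerivAt (fun y => mu P ψ y t ζ 0 0)
      ((I * tau P (fun y => env P q y t) x + I * (P.q0 ^ 2 / ζ)) * mu P ψ x t ζ 0 0
        + env P q x t * mu P ψ x t ζ 1 0) x ∧
    HasDerivAt (fun y => mu P ψ y t ζ 1 0)
      (-conj (env P q x t) * mu P ψ x t ζ 0 0
        + (-(I * tau P (fun y => env P q y t) x) + I * ζ) * mu P ψ x t ζ 1 0) x := by
  have hE := ((hasDerivAt_Theta (P := P) x t ζ).const_mul I).cexp
  simp only [mu_zero]
  constructor
  · refine ((h.hasDerivAt_apply ht x 0).mul hE).congr_deriv ?_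
    rw [laxX_00, laxX_01]
    linear_combination (-I * ψ x t ζ 0 0 * exp (I * Theta P x t ζ)) * zTilde_sub_lam (P := P) ζ
  · refine ((h.hasDerivAt_apply ht x 1).mul hE).congr_deriv ?_
    rw [laxX_10, laxX_11, laxX_00]
    linear_combination (I * ψ x t ζ 1 0 * exp (I * Theta P x t ζ)) * zTilde_add_lam (P := P) ζ

/-- The space part of the Lax pair for the second column of `μ`. -/
theorem IsJostColumn.hasDerivAt_mu_one (h : IsJostColumn P S q l Q ψ 1 ζ) (ht : t ∈ S) (x : ℝ) :
    HasDerivAt (fun y => mu P ψ y t ζ 0 1)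
      ((I * tau P (fun y => env P q y t) x - I * ζ) * mu P ψ x t ζ 0 1
        + env P q x t * mu P ψ x t ζ 1 1) x ∧
    HasDerivAt (fun y => mu P ψ y t ζ 1 1)
      (-conj (env P q x t) * mu P ψ x t ζ 0 1
        + (-(I * tau P (fun y => env P q y t) x) - I * (P.q0 ^ 2 / ζ)) * mu P ψ x t ζ 1 1) x := by
  have hE := ((hasDerivAt_Theta (P := P) x t ζ).const_mul I).neg.cexp
  simp only [mu_one]
  constructor
  · refine ((h.hasDerivAt_apply ht x 0).mul hE).congr_deriv ?_
    rw [laxX_00, laxX_01]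
    linear_combination (-I * ψ x t ζ 0 1 * exp (-(I * Theta P x t ζ))) * zTilde_add_lam (P := P) ζ
  · refine ((h.hasDerivAt_apply ht x 1).mul hE).congr_deriv ?_
    rw [laxX_10, laxX_11, laxX_00]
    linear_combination (I * ψ x t ζ 1 1 * exp (-(I * Theta P x t ζ))) * zTilde_sub_lam (P := P) ζ

theorem IsJostColumn.tendsto_mu {k : Fin 2} (h : IsJostColumn P S q l Q ψ k ζ) (ht : t ∈ S)
    (i : Fin 2) : Tendsto (fun x => mu P ψ x t ζ i k) l (𝓝 (Einf Q ζ i k)) :=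
  tendsto_pi_nhds.1 (h.limit t ht) i

/-- `ψ_{+,2}` as a column. -/
theorem IsJostColumn.isColumn_plus_second (h : IsJostColumn P S q atTop Q ψ 1 ζ) (ht : t ∈ S) :
    IsColumn P (fun y => env P q y t) Q ζ (fun y => mu P ψ y t ζ 0 1)
      (fun y => mu P ψ y t ζ 1 1) :=
  ⟨fun x => (h.hasDerivAt_mu_one ht x).1, fun x => (h.hasDerivAt_mu_one ht x).2,
    by simpa [Einf] using h.tendsto_mu ht 0, by simpa [Einf] using h.tendsto_mu ht 1⟩

theorem hasDerivAt_conj {f : ℝ → ℂ} {f' : ℂ} {x : ℝ} (h : HasDerivAt f f' x) :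
    HasDerivAt (fun y => conj (f y)) (conj f') x :=
  (conjCLE : ℂ →L[ℝ] ℂ).hasFDerivAt.comp_hasDerivAt x h

theorem tendsto_conj {α : Type*} {f : α → ℂ} {c : ℂ} {l : Filter α} (h : Tendsto f l (𝓝 c)) :
    Tendsto (fun y => conj (f y)) l (𝓝 (conj c)) :=
  (continuous_conj.tendsto c).comp h

/-- `ψ_{+,1}` as a column, by the Schwarz symmetry. -/
theorem IsJostColumn.isColumn_plus_first (h : IsJostColumn P S q atTop Q ψ 0 ζ) (ht : t ∈ S) :
    IsColumn P (fun y => env P q y t) Q (conj ζ) (fun y => -conj (mu P ψ y t ζ 1 0))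
      (fun y => conj (mu P ψ y t ζ 0 0)) := by
  refine ⟨fun x => ?_, fun x => ?_, ?_, ?_⟩
  · refine (hasDerivAt_conj (h.hasDerivAt_mu_zero ht x).2).neg.congr_deriv ?_
    simp only [map_add, map_mul, map_neg, conj_I, conj_ofReal, Complex.conj_conj]
    ring
  · refine (hasDerivAt_conj (h.hasDerivAt_mu_zero ht x).1).congr_deriv ?_
    simp only [map_add, map_mul, map_div₀, map_pow, conj_I, conj_ofReal]
    ring
  · refine (tendsto_conj (h.tendsto_mu ht 1)).neg.congr_right ?_
    simp [Einf]
    ring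
  · refine (tendsto_conj (h.tendsto_mu ht 0)).congr_right ?_
    simp [Einf]

/-- The conjugate reflected potential. -/
noncomputable def reflEnv (P : Params) (q : ℝ → ℝ → ℂ) (t y : ℝ) : ℂ := conj (env P q (-y) t)

theorem tau_reflEnv (y : ℝ) :
    tau P (reflEnv P q t) y = tau P (fun y => env P q y t) (-y) := by
  simp [tau, reflEnv]

/-- `ψ_{-,1}` as a column, by the reflection `x → -x`. -/
theorem IsJostColumn.isColumn_minus_first (h : IsJostColumn P S q atBot Q ψ 0 ζ) (ht : t ∈ S) :
    IsColumn P (reflEnv P q t) (conj Q) ζ (fun y => mu P ψ (-y) t ζ 1 0)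
      (fun y => mu P ψ (-y) t ζ 0 0) := by
  refine ⟨fun x => ?_, fun x => ?_, ?_, ?_⟩
  · have := (h.hasDerivAt_mu_zero ht (-x)).2.scomp x (hasDerivAt_neg x)
    refine this.congr_deriv ?_
    rw [tau_reflEnv, reflEnv, neg_one_smul]
    ring
  · have := (h.hasDerivAt_mu_zero ht (-x)).1.scomp x (hasDerivAt_neg x)
    refine this.congr_deriv ?_
    rw [tau_reflEnv, reflEnv, neg_one_smul, Complex.conj_conj]
    ring
  · refine ((h.tendsto_mu ht 1).comp tendsto_neg_atTop_atBot).congr_right ?_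
    simp [Einf]
  · refine ((h.tendsto_mu ht 0).comp tendsto_neg_atTop_atBot).congr_right ?_
    simp [Einf]

/-- `ψ_{-,2}` as a column, by reflection and the Schwarz symmetry. -/
theorem IsJostColumn.isColumn_minus_second (h : IsJostColumn P S q atBot Q ψ 1 ζ) (ht : t ∈ S) :
    IsColumn P (reflEnv P q t) (conj Q) (conj ζ) (fun y => -conj (mu P ψ (-y) t ζ 0 1))
      (fun y => conj (mu P ψ (-y) t ζ 1 1)) := by
  refine ⟨fun x => ?_, fun x => ?_, ?_, ?_⟩
  · have := (hasDerivAt_conj ((h.hasDerivAt_mu_one ht (-x)).1.scomp x (hasDerivAt_neg x))).neg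
    refine this.congr_deriv ?_
    rw [tau_reflEnv, reflEnv, neg_one_smul]
    simp only [map_add, map_sub, map_mul, map_neg, conj_I, conj_ofReal]
    ring
  · have := hasDerivAt_conj ((h.hasDerivAt_mu_one ht (-x)).2.scomp x (hasDerivAt_neg x))
    refine this.congr_deriv ?_
    rw [tau_reflEnv, reflEnv, neg_one_smul]
    simp only [map_add, map_sub, map_mul, map_neg, map_div₀, map_pow, conj_I, conj_ofReal,
      Complex.conj_conj]
    ring
  · refine (tendsto_conj ((h.tendsto_mu ht 0).comp tendsto_neg_atTop_atBot)).neg.congr_right ?_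
    simp [Einf]
    ring
  · refine (tendsto_conj ((h.tendsto_mu ht 1).comp tendsto_neg_atTop_atBot)).congr_right ?_
    simp [Einf]

theorem contDiff_env (hq : IsSolution P S q) (ht : t ∈ S) : ContDiff ℝ 2 (fun y => env P q y t) := by
  have h0 : ContDiff ℝ 2 (fun y => Upsilon P y t) := by
    unfold Upsilon
    fun_prop
  have h1 : ContDiff ℝ 2 (fun y : ℝ => (Upsilon P y t : ℂ)) := ofRealCLM.contDiff.comp h0
  exact (hq.contDiff t ht).mul (contDiff_const.mul h1).cexp

theorem isPotential_env (hq : IsSolution P S q) (hbc : HasNZBC P S q) (ht : t ∈ S) :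
    IsPotential P (fun y => env P q y t) P.qp :=
  ⟨P.norm_qp, contDiff_env hq ht, hbc.tendsto_atTop t ht, hbc.integrable_right t ht,
    hbc.integrable_deriv t ht⟩

theorem isPotential_reflEnv (hq : IsSolution P S q) (hbc : HasNZBC P S q) (ht : t ∈ S) :
    IsPotential P (reflEnv P q t) (conj P.qm) := by
  refine ⟨by rw [RCLike.norm_conj, P.norm_qm], ?_, ?_, ?_, ?_⟩
  · exact (conjCLE : ℂ →L[ℝ] ℂ).contDiff.comp ((contDiff_env hq ht).comp contDiff_neg)
  · exact tendsto_conj ((hbc.tendsto_atBot t ht).comp tendsto_neg_atTop_atBot)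
  · have h1 := hbc.integrable_left t ht
    rw [← neg_zero] at h1
    refine h1.comp_neg_Ioi.congr (Eventually.of_forall fun y => ?_)
    simp only [reflEnv]
    rw [← map_sub, RCLike.norm_conj, abs_neg]
  · have h1 := (hbc.integrable_deriv t ht).comp_neg
    have h2 := ((conjCLE : ℂ →L[ℝ] ℂ).integrable_comp h1).neg
    refine h2.congr (Eventually.of_forall fun y => ?_)
    have h3 := ((contDiff_env hq ht).differentiable two_ne_zero (-y)).hasDerivAt
    have h4 := hasDerivAt_conj (h3.scomp y (hasDerivAt_neg y))
    refine Eq.trans ?_ (h4.deriv).symm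
    simp

/-- The involution `ζ → -q₀² / ζ̄` of `D₁ ∪ Σ_Ω`. -/
noncomputable def sharp (P : Params) (ζ : ℂ) : ℂ := -(P.q0 ^ 2 / conj ζ)

theorem q0_ne_zero (P : Params) : (P.q0 : ℂ) ≠ 0 := ofReal_ne_zero.2 P.q0_pos.ne'

theorem sharp_ne_zero (hζ : ζ ≠ 0) : sharp P ζ ≠ 0 := by
  have := q0_ne_zero P
  have h2 : conj ζ ≠ 0 := by simpa using hζ
  exact neg_ne_zero.2 (div_ne_zero (pow_ne_zero 2 this) h2)

theorem conj_sharp (ζ : ℂ) : conj (sharp P ζ) = -(P.q0 ^ 2 / ζ) := by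
  simp [sharp]

theorem sharp_sharp (hζ : ζ ≠ 0) : sharp P (sharp P ζ) = ζ := by
  have := q0_ne_zero P
  conv_lhs => rw [sharp, conj_sharp]
  field_simp

theorem lam_sharp (hζ : ζ ≠ 0) : lam P (sharp P ζ) = -conj (lam P ζ) := by
  have := q0_ne_zero P
  have h2 : conj ζ ≠ 0 := by simpa using hζ
  simp only [lam, sharp, map_div₀, map_add, map_pow, conj_ofReal, conj_ofNat]
  field_simp
  ring

theorem lam_conj (ζ : ℂ) : lam P (conj ζ) = conj (lam P ζ) := by
  simp only [lam, map_div₀, map_add, map_pow, conj_ofReal, conj_ofNat]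

theorem sharp_mem_closedD1 (hζ : ζ ∈ closedD1 P) : sharp P ζ ∈ closedD1 P := by
  refine ⟨sharp_ne_zero hζ.1, ?_, ?_⟩
  · rw [lam_sharp hζ.1]; simpa using hζ.2.1
  · rw [lam_sharp hζ.1]; simpa using hζ.2.2

theorem sharp_mem_D1 (hζ : ζ ∈ D1 P) : sharp P ζ ∈ D1 P := by
  have h0 := (D1_subset hζ).1
  rw [mem_D1_iff] at hζ ⊢
  rw [lam_sharp h0]; simpa using hζ

theorem conj_mem_closedD2 : conj ζ ∈ closedD2 P ↔ ζ ∈ closedD1 P := by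
  simp [closedD1, closedD2, lam_conj]

theorem conj_mem_closedD1 : conj ζ ∈ closedD1 P ↔ ζ ∈ closedD2 P := by
  simp [closedD1, closedD2, lam_conj]

theorem conj_mem_D2 : conj ζ ∈ D2 P ↔ ζ ∈ D1 P := by
  simp [mem_D1_iff, mem_D2_iff, lam_conj]

theorem conj_mem_D1 : conj ζ ∈ D1 P ↔ ζ ∈ D2 P := by
  simp [mem_D1_iff, mem_D2_iff, lam_conj]

theorem conj_mem_Sigma : conj ζ ∈ Sigma P ↔ ζ ∈ Sigma P := by
  simp [mem_Sigma_iff, lam_conj]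

/-- A column at `-q₀² / ζ̄` gives one at `ζ`. -/
theorem IsColumn.of_sharp {p : ℝ → ℂ} (hp : IsPotential P p Q) (hζ : ζ ≠ 0) {m1 m2 : ℝ → ℂ}
    (h : IsColumn P p Q (sharp P ζ) m1 m2) :
    IsColumn P p Q ζ (fun y => -I * Q / ζ * conj (m2 y)) (fun y => -(-I * Q / ζ * conj (m1 y))) := by
  have hq := q0_ne_zero P
  have hQ := mul_conj_eq hp
  have hc : conj ((P.q0 : ℂ) ^ 2 / sharp P ζ) = -ζ := by
    rw [map_div₀, conj_sharp, map_pow, conj_ofReal]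
    field_simp
  have hc' : conj (sharp P ζ) = -(P.q0 ^ 2 / ζ) := conj_sharp ζ
  refine ⟨fun x => ?_, fun x => ?_, ?_, ?_⟩
  · refine ((hasDerivAt_conj (h.deriv_snd x)).const_mul (-I * Q / ζ)).congr_deriv ?_
    simp only [map_add, map_sub, map_mul, map_neg, conj_I, conj_ofReal, Complex.conj_conj, hc]
    ring
  · refine ((hasDerivAt_conj (h.deriv_fst x)).const_mul (-I * Q / ζ)).neg.congr_deriv ?_
    simp only [map_add, map_sub, map_mul, conj_I, conj_ofReal, hc']
    ring
  · simpa using (tendsto_conj h.tendsto_snd).const_mul (-I * Q / ζ)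
  · refine ((tendsto_conj h.tendsto_fst).const_mul (-I * Q / ζ)).neg.congr_right ?_
    simp only [map_div₀, map_mul, map_neg, conj_I, hc']
    field_simp
    linear_combination (-(I ^ 2)) * hQ - (P.q0 : ℂ) ^ 2 * I_sq

/-- The second symmetry, for columns that exist on all of `D₁ ∪ Σ_Ω`. -/
theorem IsColumn.sharp_eq {p : ℝ → ℂ} (hp : IsPotential P p Q) {f1 f2 : ℂ → ℝ → ℂ}
    (hf : ∀ ζ ∈ closedD1 P, IsColumn P p Q ζ (f1 ζ) (f2 ζ)) (hζ : ζ ∈ closedD1 P) (x : ℝ) :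
    f1 ζ x = -I * Q / ζ * conj (f2 (sharp P ζ) x) ∧
      f2 ζ x = -(-I * Q / ζ * conj (f1 (sharp P ζ) x)) :=
  IsColumn.unique hp hζ (hf ζ hζ) ((hf _ (sharp_mem_closedD1 hζ)).of_sharp hp hζ.1) x

/-- A column has no zero. -/
theorem IsColumn.ne_zero {p : ℝ → ℂ} (hp : Continuous p) {m1 m2 : ℝ → ℂ}
    (h : IsColumn P p Q ζ m1 m2) (x : ℝ) : m1 x ≠ 0 ∨ m2 x ≠ 0 := by
  by_contra! h0
  have hz : ∀ y, x ≤ y → m2 y = 0 := by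
    intro b hb
    have hc := continuous_pertMat (P := P) (Q := Q) hp
    obtain ⟨K, hK⟩ := (isCompact_Icc (a := x) (b := b)).exists_bound_of_continuousOn
      (continuous_const.add hc : Continuous fun y => bgMat P Q ζ + pertMat P p Q y).continuousOn
    have := eq_zero_of_abs_deriv_le_mul_abs_self_of_eq_zero_right (K := K)
      (f := fun y => (m1 y, m2 y)) (a := x) (b := b) h.continuous_pair.continuousOn
      (fun y _ => (h.hasDerivAt_pair y).hasDerivWithinAt) (by simp [h0.1, h0.2]) ?_ b ⟨hb, le_rfl⟩
    · exact (Prod.mk.inj this).2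
    · intro y hy
      have h1 := (bgMat P Q ζ + pertMat P p Q y).le_opNorm (m1 y, m2 y)
      rw [add_apply] at h1
      exact h1.trans (mul_le_mul_of_nonneg_right (hK y ⟨hy.1, hy.2.le⟩) (norm_nonneg _))
  have hl : Tendsto m2 atTop (𝓝 0) := tendsto_const_nhds.congr' <| by
    filter_upwards [eventually_ge_atTop x] with y hy using (hz y hy).symm
  exact one_ne_zero (tendsto_nhds_unique h.tendsto_snd hl)

end Columns

/-! ### Wronskians, the scattering matrix and the norming constants -/

section Link

variable {P : Params} {S : Set ℝ} {q : ℝ → ℝ → ℂ} {ψp ψm : ℝ → ℝ → ℂ → Matrix (Fin 2) (Fin 2) ℂ}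
  {ζ : ℂ} {x t : ℝ}

theorem eq_of_hasDeriv_zero (hS : S.OrdConnected) {f : ℝ → ℝ → ℂ}
    (hx : ∀ x, ∀ t ∈ S, HasDerivAt (fun y => f y t) 0 x)
    (ht : ∀ x, ∀ t ∈ S, HasDerivWithinAt (fun s => f x s) 0 S t) {x t y s : ℝ} (h1 : t ∈ S)
    (h2 : s ∈ S) : f x t = f y s := by
  have e1 : f x t = f y t :=
    is_const_of_deriv_eq_zero (fun z => (hx z t h1).differentiableAt)
      (fun z => (hx z t h1).deriv) x y
  have e2 := hS.convex.norm_image_sub_le_of_norm_hasDerivWithin_le (C := 0)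
    (fun s hs => ht y s hs) (fun s _ => by simp) h1 h2
  rw [zero_mul, norm_le_zero_iff, sub_eq_zero] at e2
  rw [e1, e2]

theorem hasDerivWithinAt_wronskian {A : Matrix (Fin 2) (Fin 2) ℂ} (hA : A 1 1 = -A 0 0)
    {F G : ℝ → Matrix (Fin 2) (Fin 2) ℂ} {j k : Fin 2} {s : Set ℝ}
    (hF : HasDerivWithinAt (fun y i => F y i j) (A *ᵥ fun i => F x i j) s x)
    (hG : HasDerivWithinAt (fun y i => G y i k) (A *ᵥ fun i => G x i k) s x) :
    HasDerivWithinAt (fun y => wronskian (F y) (G y) j k) 0 s x := by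
  have f := hasDerivWithinAt_pi.1 hF
  have g := hasDerivWithinAt_pi.1 hG
  refine (((f 0).mul (g 1)).sub ((f 1).mul (g 0))).congr_deriv ?_
  simp only [mulVec_fin_two, hA]
  ring

/-- The coefficient matrices of the Lax pair have trace zero, so Wronskians are constant in `x`
and `t`. -/
theorem IsJostColumn.wronskian_eq (hS : S.OrdConnected) {l l' : Filter ℝ} {Q Q' : ℂ}
    {ψ φ : ℝ → ℝ → ℂ → Matrix (Fin 2) (Fin 2) ℂ} {j k : Fin 2}
    (h : IsJostColumn P S q l Q ψ j ζ) (h' : IsJostColumn P S q l' Q' φ k ζ) {y s : ℝ}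
    (ht : t ∈ S) (hs : s ∈ S) :
    wronskian (ψ x t ζ) (φ x t ζ) j k = wronskian (ψ y s ζ) (φ y s ζ) j k := by
  refine eq_of_hasDeriv_zero (f := fun x t => wronskian (ψ x t ζ) (φ x t ζ) j k) hS
    (fun x t ht => ?_) (fun x t ht => ?_) ht hs
  · rw [← hasDerivWithinAt_univ]
    exact hasDerivWithinAt_wronskian (laxX_11 x t ζ) (h.space x t ht).hasDerivWithinAt
      (h'.space x t ht).hasDerivWithinAt
  · exact hasDerivWithinAt_wronskian (F := fun s => ψ x s ζ) (G := fun s => φ x s ζ)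
      (laxT_11 x t ζ) (h.time x t ht) (h'.time x t ht)

theorem hasDerivWithinAt_ratio {A : Matrix (Fin 2) (Fin 2) ℂ} {u v : ℝ → Fin 2 → ℂ} {c : ℝ → ℂ}
    {s : Set ℝ} (hx : x ∈ s) (hu : HasDerivWithinAt u (A *ᵥ u x) s x)
    (hv : HasDerivWithinAt v (A *ᵥ v x) s x) (hv0 : v x 0 ≠ 0 ∨ v x 1 ≠ 0)
    (hc : ∀ y ∈ s, ∀ i, u y i = c y * v y i) : HasDerivWithinAt c 0 s x := by
  obtain ⟨i, hi⟩ : ∃ i, v x i ≠ 0 := hv0.elim (fun h => ⟨0, h⟩) fun h => ⟨1, h⟩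
  have hui := hasDerivWithinAt_pi.1 hu i
  have hvi := hasDerivWithinAt_pi.1 hv i
  have hne : ∀ᶠ y in 𝓝[s] x, v y i ≠ 0 := hvi.continuousWithinAt.eventually_ne hi
  have he : c =ᶠ[𝓝[s] x] fun y => u y i / v y i := by
    filter_upwards [hne, self_mem_nhdsWithin] with y hy hys
    rw [hc y hys i, mul_div_cancel_right₀ _ hy]
  refine ((hui.div hvi hi).congr_deriv ?_).congr_of_eventuallyEq he (he.self_of_nhdsWithin hx)
  simp only [mulVec_fin_two, hc x hx]
  ring

/-- Two Jost columns with vanishing Wronskian are proportional, with a constant factor. -/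
theorem IsJostColumn.exists_eq_mul (hS : S.OrdConnected) (h0 : (0 : ℝ) ∈ S) {l l' : Filter ℝ}
    {Q Q' : ℂ} {ψ φ : ℝ → ℝ → ℂ → Matrix (Fin 2) (Fin 2) ℂ} {j k : Fin 2}
    (h : IsJostColumn P S q l Q ψ j ζ) (h' : IsJostColumn P S q l' Q' φ k ζ)
    (hW : ∀ x, ∀ t ∈ S, wronskian (ψ x t ζ) (φ x t ζ) j k = 0)
    (hφ : ∀ x, ∀ t ∈ S, φ x t ζ 0 k ≠ 0 ∨ φ x t ζ 1 k ≠ 0) :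
    ∃ b : ℂ, ∀ x, ∀ t ∈ S, ∀ i, ψ x t ζ i j = b * φ x t ζ i k := by
  -- The factor is written with a denominator that never vanishes; near each point it equals the
  -- quotient of one of the two components, whose derivative is zero.
  let c : ℝ → ℝ → ℂ := fun x t =>
    (ψ x t ζ 0 j * conj (φ x t ζ 0 k) + ψ x t ζ 1 j * conj (φ x t ζ 1 k)) /
      (φ x t ζ 0 k * conj (φ x t ζ 0 k) + φ x t ζ 1 k * conj (φ x t ζ 1 k))
  have hc : ∀ x, ∀ t ∈ S, ∀ i, ψ x t ζ i j = c x t * φ x t ζ i k := by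
    intro x t ht i
    have hn : φ x t ζ 0 k * conj (φ x t ζ 0 k) + φ x t ζ 1 k * conj (φ x t ζ 1 k) ≠ 0 := by
      rw [mul_conj, mul_conj, ← ofReal_add, ofReal_ne_zero]
      rcases hφ x t ht with h | h
      · have := normSq_pos.2 h; have := normSq_nonneg (φ x t ζ 1 k); positivity
      · have := normSq_pos.2 h; have := normSq_nonneg (φ x t ζ 0 k); positivity
    have hw := hW x t ht
    simp only [wronskian] at hw
    rw [div_mul_eq_mul_div, eq_div_iff hn]
    fin_cases i <;> simp only [Fin.zero_eta, Fin.mk_one]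
    · linear_combination conj (φ x t ζ 1 k) * hw
    · linear_combination (-conj (φ x t ζ 0 k)) * hw
  refine ⟨c 0 0, fun x t ht i => ?_⟩
  rw [hc x t ht i]
  congr 1
  refine eq_of_hasDeriv_zero hS (fun x t ht => ?_) (fun x t ht => ?_) ht h0
  · rw [← hasDerivWithinAt_univ]
    exact hasDerivWithinAt_ratio (u := fun y i => ψ y t ζ i j) (v := fun y i => φ y t ζ i k)
      (Set.mem_univ x) (h.space x t ht).hasDerivWithinAt (h'.space x t ht).hasDerivWithinAt
      (hφ x t ht) fun y _ => hc y t ht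
  · exact hasDerivWithinAt_ratio (u := fun s i => ψ x s ζ i j) (v := fun s i => φ x s ζ i k)
      ht (h.time x t ht) (h'.time x t ht) (hφ x t ht) fun s hs => hc x s hs

theorem conj_Theta (x t : ℝ) (ζ : ℂ) : conj (Theta P x t ζ) = Theta P x t (conj ζ) := by
  simp only [Theta, spec, zTilde, lam, map_mul, map_add, map_sub, map_div₀, map_pow, conj_ofReal,
    conj_ofNat]

theorem Theta_neg_div (hζ : ζ ≠ 0) (x t : ℝ) :
    Theta P x t (-(P.q0 ^ 2 / ζ)) = -Theta P x t ζ := by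
  have := q0_ne_zero P
  have h1 : lam P (-(P.q0 ^ 2 / ζ)) = -lam P ζ := by
    simp only [lam]; field_simp; ring
  have h2 : zTilde P (-(P.q0 ^ 2 / ζ)) = zTilde P ζ := by
    simp only [zTilde]; field_simp; ring
  simp only [Theta, spec, h1, h2]
  ring

theorem exp_mul_exp_neg (c : ℂ) : exp c * exp (-c) = 1 := by
  rw [← exp_add, add_neg_cancel, exp_zero]

theorem exp_neg_two_Theta (x t : ℝ) (ζ : ℂ) : exp (-2 * I * Theta P x t ζ) =
    exp (-(I * Theta P x t ζ)) * exp (-(I * Theta P x t ζ)) := by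
  rw [← exp_add]; ring_nf

theorem wronskian_mu (F G : ℝ → ℝ → ℂ → Matrix (Fin 2) (Fin 2) ℂ) (x t : ℝ) (ζ : ℂ) :
    wronskian (mu P F x t ζ) (mu P G x t ζ) 0 1 = wronskian (F x t ζ) (G x t ζ) 0 1 := by
  have h := exp_mul_exp_neg (I * Theta P x t ζ)
  simp only [wronskian, mu_zero, mu_one]
  linear_combination (F x t ζ 0 0 * G x t ζ 1 1 - F x t ζ 1 0 * G x t ζ 0 1) * h

theorem one_add_ne_zero (h0 : ζ ≠ 0) (h : lam P ζ ≠ 0) : 1 + (P.q0 : ℂ) ^ 2 / ζ ^ 2 ≠ 0 := by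
  have e : lam P ζ = ζ / 2 * (1 + (P.q0 : ℂ) ^ 2 / ζ ^ 2) := by
    simp only [lam]; field_simp
  rw [e] at h
  exact right_ne_zero_of_mul h


theorem IsJost.plus_second' (hψ : IsJost P S q ψp ψm) (hζ : ζ ∈ closedD1 P) :
    IsJostColumn P S q atTop P.qp ψp 1 ζ :=
  hψ.plus_second ζ (D1_union_Sigma ▸ hζ)

theorem IsJost.minus_first' (hψ : IsJost P S q ψp ψm) (hζ : ζ ∈ closedD1 P) :
    IsJostColumn P S q atBot P.qm ψm 0 ζ :=
  hψ.minus_first ζ (D1_union_Sigma ▸ hζ)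

theorem IsJost.plus_first' (hψ : IsJost P S q ψp ψm) (hζ : ζ ∈ closedD2 P) :
    IsJostColumn P S q atTop P.qp ψp 0 ζ :=
  hψ.plus_first ζ (D2_union_Sigma ▸ hζ)

theorem IsJost.minus_second' (hψ : IsJost P S q ψp ψm) (hζ : ζ ∈ closedD2 P) :
    IsJostColumn P S q atBot P.qm ψm 1 ζ :=
  hψ.minus_second ζ (D2_union_Sigma ▸ hζ)

theorem IsJost.column_plus (hψ : IsJost P S q ψp ψm) (ht : t ∈ S) : ∀ ζ ∈ closedD1 P,
    IsColumn P (fun y => env P q y t) P.qp ζ (fun y => mu P ψp y t ζ 0 1)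
      (fun y => mu P ψp y t ζ 1 1) :=
  fun _ hζ => (hψ.plus_second' hζ).isColumn_plus_second ht

theorem IsJost.column_minus (hψ : IsJost P S q ψp ψm) (ht : t ∈ S) : ∀ ζ ∈ closedD1 P,
    IsColumn P (reflEnv P q t) (conj P.qm) ζ (fun y => mu P ψm (-y) t ζ 1 0)
      (fun y => mu P ψm (-y) t ζ 0 0) :=
  fun _ hζ => (hψ.minus_first' hζ).isColumn_minus_first ht

/-- Schwarz symmetry of `μ_{+,1}`. -/
theorem IsJost.mu_plus_first (hψ : IsJost P S q ψp ψm) (hq : IsSolution P S q)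
    (hbc : HasNZBC P S q) (ht : t ∈ S) (hζ : ζ ∈ closedD1 P) (x : ℝ) :
    mu P ψp x t (conj ζ) 0 0 = conj (mu P ψp x t ζ 1 1) ∧
      mu P ψp x t (conj ζ) 1 0 = -conj (mu P ψp x t ζ 0 1) := by
  have h1 := (hψ.plus_first' (conj_mem_closedD2.2 hζ)).isColumn_plus_first ht
  rw [Complex.conj_conj] at h1
  have h := IsColumn.unique (isPotential_env hq hbc ht) hζ h1 (hψ.column_plus ht ζ hζ) x
  exact ⟨by rw [← h.2, Complex.conj_conj], by rw [← h.1]; simp⟩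

/-- Schwarz symmetry of `μ_{-,2}`. -/
theorem IsJost.mu_minus_second (hψ : IsJost P S q ψp ψm) (hq : IsSolution P S q)
    (hbc : HasNZBC P S q) (ht : t ∈ S) (hζ : ζ ∈ closedD1 P) (x : ℝ) :
    mu P ψm x t (conj ζ) 0 1 = -conj (mu P ψm x t ζ 1 0) ∧
      mu P ψm x t (conj ζ) 1 1 = conj (mu P ψm x t ζ 0 0) := by
  have h1 := (hψ.minus_second' (conj_mem_closedD2.2 hζ)).isColumn_minus_second ht
  rw [Complex.conj_conj] at h1
  have h := IsColumn.unique (isPotential_reflEnv hq hbc ht) hζ h1 (hψ.column_minus ht ζ hζ) (-x)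
  simp only [neg_neg] at h
  exact ⟨by rw [← h.1]; simp, by rw [← h.2, Complex.conj_conj]⟩

theorem psi_zero (ψ : ℝ → ℝ → ℂ → Matrix (Fin 2) (Fin 2) ℂ) (x t : ℝ) (ζ : ℂ) (i : Fin 2) :
    ψ x t ζ i 0 = mu P ψ x t ζ i 0 * exp (-(I * Theta P x t ζ)) := by
  rw [mu_zero, mul_assoc, exp_mul_exp_neg, mul_one]

theorem psi_one (ψ : ℝ → ℝ → ℂ → Matrix (Fin 2) (Fin 2) ℂ) (x t : ℝ) (ζ : ℂ) (i : Fin 2) :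
    ψ x t ζ i 1 = mu P ψ x t ζ i 1 * exp (I * Theta P x t ζ) := by
  rw [mu_one, mul_assoc, mul_comm (exp (-_)), exp_mul_exp_neg, mul_one]

theorem conj_exp_I_Theta (x t : ℝ) (ζ : ℂ) :
    conj (exp (I * Theta P x t ζ)) = exp (-(I * Theta P x t (conj ζ))) := by
  rw [← exp_conj, map_mul, conj_I, conj_Theta, neg_mul]

theorem conj_exp_neg_I_Theta (x t : ℝ) (ζ : ℂ) :
    conj (exp (-(I * Theta P x t ζ))) = exp (I * Theta P x t (conj ζ)) := by
  rw [← exp_conj, map_neg, map_mul, conj_I, conj_Theta, neg_mul, neg_neg]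

theorem IsJost.psi_plus_first (hψ : IsJost P S q ψp ψm) (hq : IsSolution P S q)
    (hbc : HasNZBC P S q) (ht : t ∈ S) (hζ : ζ ∈ closedD1 P) (x : ℝ) :
    ψp x t (conj ζ) 0 0 = conj (ψp x t ζ 1 1) ∧ ψp x t (conj ζ) 1 0 = -conj (ψp x t ζ 0 1) := by
  have h := hψ.mu_plus_first hq hbc ht hζ x
  constructor
  · rw [psi_zero (P := P) ψp x t (conj ζ), h.1, psi_one (P := P) ψp x t ζ, map_mul, conj_exp_I_Theta]
  · rw [psi_zero (P := P) ψp x t (conj ζ), h.2, psi_one (P := P) ψp x t ζ, map_mul, conj_exp_I_Theta, neg_mul]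

theorem IsJost.psi_minus_second (hψ : IsJost P S q ψp ψm) (hq : IsSolution P S q)
    (hbc : HasNZBC P S q) (ht : t ∈ S) (hζ : ζ ∈ closedD1 P) (x : ℝ) :
    ψm x t (conj ζ) 0 1 = -conj (ψm x t ζ 1 0) ∧ ψm x t (conj ζ) 1 1 = conj (ψm x t ζ 0 0) := by
  have h := hψ.mu_minus_second hq hbc ht hζ x
  constructor
  · rw [psi_one (P := P) ψm x t (conj ζ), h.1, psi_zero (P := P) ψm x t ζ, map_mul, conj_exp_neg_I_Theta, neg_mul]
  · rw [psi_one (P := P) ψm x t (conj ζ), h.2, psi_zero (P := P) ψm x t ζ, map_mul, conj_exp_neg_I_Theta]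

/-- `det ψ_+ = det Ẽ_+` on the contour. -/
theorem IsJost.wronskian_plus (hψ : IsJost P S q ψp ψm) (hS : S.OrdConnected) (hζ : ζ ∈ Sigma P)
    (ht : t ∈ S) (x : ℝ) :
    wronskian (ψp x t ζ) (ψp x t ζ) 0 1 = 1 + P.q0 ^ 2 / ζ ^ 2 := by
  have h0 := hψ.plus_first' (Sigma_subset_closedD2 hζ)
  have h1 := hψ.plus_second' (Sigma_subset_closedD1 hζ)
  have hl : Tendsto (fun y => wronskian (mu P ψp y t ζ) (mu P ψp y t ζ) 0 1) atTop
      (𝓝 (wronskian (Einf P.qp ζ) (Einf P.qp ζ) 0 1)) :=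
    ((h0.tendsto_mu ht 0).mul (h1.tendsto_mu ht 1)).sub
      ((h0.tendsto_mu ht 1).mul (h1.tendsto_mu ht 0))
  have hc : (fun y => wronskian (mu P ψp y t ζ) (mu P ψp y t ζ) 0 1) =
      fun _ => wronskian (ψp x t ζ) (ψp x t ζ) 0 1 := by
    funext y
    rw [wronskian_mu]
    exact h0.wronskian_eq hS h1 ht ht
  rw [hc] at hl
  rw [tendsto_nhds_unique tendsto_const_nhds hl]
  have hz := hζ.1
  have hQ : P.qp * conj P.qp = P.q0 ^ 2 := by
    rw [mul_conj, normSq_eq_norm_sq, P.norm_qp]; push_cast; rfl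
  simp only [wronskian, Einf, Matrix.of_apply, Matrix.cons_val', Matrix.cons_val_zero,
    Matrix.cons_val_one, Matrix.cons_val_fin_one]
  field_simp
  linear_combination (-(I ^ 2)) * hQ - (P.q0 : ℂ) ^ 2 * I_sq

/-- The scattering matrix has its defining property. -/
theorem IsJost.scat_spec (hψ : IsJost P S q ψp ψm) (hS : S.OrdConnected) (h0 : (0 : ℝ) ∈ S)
    (hζ : ζ ∈ Sigma P) : ∀ x : ℝ, ∀ t ∈ S, ψm x t ζ = ψp x t ζ * scat S ψp ψm ζ := by
  have hp0 := hψ.plus_first' (Sigma_subset_closedD2 hζ)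
  have hp1 := hψ.plus_second' (Sigma_subset_closedD1 hζ)
  have hm0 := hψ.minus_first' (Sigma_subset_closedD1 hζ)
  have hm1 := hψ.minus_second' (Sigma_subset_closedD2 hζ)
  have hd := one_add_ne_zero hζ.1 (Sigma_subset_closedD1 hζ).2.1
  refine Classical.epsilon_spec (p := fun s : Matrix (Fin 2) (Fin 2) ℂ =>
    ∀ x : ℝ, ∀ t ∈ S, ψm x t ζ = ψp x t ζ * s) ⟨(1 + (P.q0 : ℂ) ^ 2 / ζ ^ 2)⁻¹ •
      !![wronskian (ψm 0 0 ζ) (ψp 0 0 ζ) 0 1, wronskian (ψm 0 0 ζ) (ψp 0 0 ζ) 1 1;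
         wronskian (ψp 0 0 ζ) (ψm 0 0 ζ) 0 0, wronskian (ψp 0 0 ζ) (ψm 0 0 ζ) 0 1], ?_⟩
  intro x t ht
  have hW := hψ.wronskian_plus hS hζ ht x
  rw [hm0.wronskian_eq hS hp1 (y := x) h0 ht, hm1.wronskian_eq hS hp1 (y := x) h0 ht,
    hp0.wronskian_eq hS hm0 (y := x) h0 ht, hp0.wronskian_eq hS hm1 (y := x) h0 ht, Matrix.mul_smul,
    eq_inv_smul_iff₀ hd, ← hW]
  ext i j
  fin_cases i <;> fin_cases j <;>
    simp [Matrix.mul_apply, Fin.sum_univ_two, wronskian] <;> ring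

theorem scat_wronskian (h : ψm x t ζ = ψp x t ζ * scat S ψp ψm ζ) :
    let d := wronskian (ψp x t ζ) (ψp x t ζ) 0 1
    scat S ψp ψm ζ 0 0 * d = wronskian (ψm x t ζ) (ψp x t ζ) 0 1 ∧
    scat S ψp ψm ζ 1 0 * d = wronskian (ψp x t ζ) (ψm x t ζ) 0 0 ∧
    scat S ψp ψm ζ 0 1 * d = wronskian (ψm x t ζ) (ψp x t ζ) 1 1 ∧
    scat S ψp ψm ζ 1 1 * d = wronskian (ψp x t ζ) (ψm x t ζ) 0 1 := by
  simp only [h, wronskian, Matrix.mul_apply, Fin.sum_univ_two]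
  refine ⟨?_, ?_, ?_, ?_⟩ <;> ring

/-- The Wronskian representation of `a` on `D₁ ∪ Σ_Ω`. -/
theorem IsJost.scatA_eq (hψ : IsJost P S q ψp ψm) (hS : S.OrdConnected) (h0 : (0 : ℝ) ∈ S)
    (hζ : ζ ∈ closedD1 P) (ht : t ∈ S) (x : ℝ) :
    scatA P S ψp ψm ζ = wronskian (ψm x t ζ) (ψp x t ζ) 0 1 / (1 + P.q0 ^ 2 / ζ ^ 2) := by
  rw [scatA]
  split_ifs with h
  · rw [eq_div_iff (one_add_ne_zero hζ.1 hζ.2.1), ← hψ.wronskian_plus hS h ht x,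
      (scat_wronskian (hψ.scat_spec hS h0 h x t ht)).1]
  · rw [(hψ.minus_first' hζ).wronskian_eq hS (hψ.plus_second' hζ) h0 ht]

theorem IsJost.scatA_eq_mu (hψ : IsJost P S q ψp ψm) (hS : S.OrdConnected) (h0 : (0 : ℝ) ∈ S)
    (hζ : ζ ∈ closedD1 P) (ht : t ∈ S) (x : ℝ) :
    scatA P S ψp ψm ζ = (mu P ψm x t ζ 0 0 * mu P ψp x t ζ 1 1
      - mu P ψm x t ζ 1 0 * mu P ψp x t ζ 0 1) / (1 + P.q0 ^ 2 / ζ ^ 2) := by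
  rw [hψ.scatA_eq hS h0 hζ ht x, ← wronskian_mu (P := P), wronskian]

/-- Schwarz symmetry of the scattering coefficients: `ã(ζ̄)` is the conjugate of `a(ζ)`. -/
theorem IsJost.scatAt_conj (hψ : IsJost P S q ψp ψm) (hq : IsSolution P S q)
    (hbc : HasNZBC P S q) (hS : S.OrdConnected) (h0 : (0 : ℝ) ∈ S) (hζ : ζ ∈ closedD1 P) :
    scatAt P S ψp ψm (conj ζ) = conj (scatA P S ψp ψm ζ) := by
  have e : scatAt P S ψp ψm (conj ζ) =
      wronskian (ψp 0 0 (conj ζ)) (ψm 0 0 (conj ζ)) 0 1 / (1 + P.q0 ^ 2 / (conj ζ) ^ 2) := by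
    rw [scatAt]
    split_ifs with h
    · have hd := one_add_ne_zero (Sigma_subset_closedD1 h).1 (Sigma_subset_closedD1 h).2.1
      rw [eq_div_iff hd, ← hψ.wronskian_plus hS h h0 0,
        (scat_wronskian (hψ.scat_spec hS h0 h 0 0 h0)).2.2.2]
    · rfl
  rw [e, hψ.scatA_eq hS h0 hζ h0 0]
  have h1 := hψ.psi_plus_first hq hbc h0 hζ 0
  have h2 := hψ.psi_minus_second hq hbc h0 hζ 0
  simp only [wronskian, h1.1, h1.2, h2.1, h2.2, map_div₀, map_sub, map_mul, map_add, map_one,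
    map_pow, conj_ofReal]
  ring

/-- Schwarz symmetry of the off-diagonal scattering coefficients. -/
theorem IsJost.scat_conj (hψ : IsJost P S q ψp ψm) (hq : IsSolution P S q)
    (hbc : HasNZBC P S q) (hS : S.OrdConnected) (h0 : (0 : ℝ) ∈ S) (hζ : ζ ∈ Sigma P) :
    conj (scat S ψp ψm (conj ζ) 1 0) = -scat S ψp ψm ζ 0 1 := by
  have hζ' := conj_mem_Sigma.2 hζ
  have hc1 := Sigma_subset_closedD1 hζ
  have hd := one_add_ne_zero hc1.1 hc1.2.1
  have e1 := (scat_wronskian (hψ.scat_spec hS h0 hζ 0 0 h0)).2.2.1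
  have e2 := (scat_wronskian (hψ.scat_spec hS h0 hζ' 0 0 h0)).2.1
  rw [hψ.wronskian_plus hS hζ h0 0] at e1
  rw [hψ.wronskian_plus hS hζ' h0 0] at e2
  have a1 := hψ.psi_plus_first hq hbc h0 hc1 0
  have a2 := hψ.psi_minus_second hq hbc h0 (Sigma_subset_closedD1 hζ') 0
  rw [Complex.conj_conj] at a2
  have e3 := congrArg conj e2
  simp only [wronskian, a1.1, a1.2, a2.1, a2.2, map_div₀, map_sub, map_mul, map_add, map_one,
    map_pow, map_neg, conj_ofReal, Complex.conj_conj] at e1 e3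
  apply mul_right_cancel₀ hd
  linear_combination e3 + e1

/-- The second symmetry of `a`. -/
theorem IsJost.scatA_sharp (hψ : IsJost P S q ψp ψm) (hq : IsSolution P S q)
    (hbc : HasNZBC P S q) (hS : S.OrdConnected) (h0 : (0 : ℝ) ∈ S) (hζ : ζ ∈ closedD1 P) :
    scatA P S ψp ψm ζ =
      conj P.qm * P.qp / P.q0 ^ 2 * conj (scatA P S ψp ψm (sharp P ζ)) := by
  have hf := IsColumn.sharp_eq (isPotential_env hq hbc h0) (hψ.column_plus h0) hζ 0
  have hg := IsColumn.sharp_eq (isPotential_reflEnv hq hbc h0) (hψ.column_minus h0) hζ 0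
  have hd := one_add_ne_zero hζ.1 hζ.2.1
  have hz := hζ.1
  have hq0 := q0_ne_zero P
  have hd' : (1 : ℂ) + P.q0 ^ 2 / (conj (sharp P ζ)) ^ 2 =
      ζ ^ 2 / P.q0 ^ 2 * (1 + P.q0 ^ 2 / ζ ^ 2) := by
    rw [conj_sharp]; field_simp; ring
  rw [hψ.scatA_eq_mu hS h0 hζ h0 0, hψ.scatA_eq_mu hS h0 (sharp_mem_closedD1 hζ) h0 0]
  simp only [neg_zero] at hg
  rw [hf.1, hf.2, hg.1, hg.2]
  simp only [map_div₀, map_sub, map_mul, map_add, map_one, map_pow, conj_ofReal, hd']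
  generalize mu P ψp 0 0 (sharp P ζ) 0 1 = A
  generalize mu P ψp 0 0 (sharp P ζ) 1 1 = B
  generalize mu P ψm 0 0 (sharp P ζ) 0 0 = C
  generalize mu P ψm 0 0 (sharp P ζ) 1 0 = D
  generalize (1 : ℂ) + P.q0 ^ 2 / ζ ^ 2 = d at *
  field_simp
  linear_combination (conj P.qm * P.qp * (conj A * conj D - conj B * conj C)) * I_sq

theorem IsJost.scatA_continuousOn (hψ : IsJost P S q ψp ψm) (hq : IsSolution P S q)
    (hbc : HasNZBC P S q) (hS : S.OrdConnected) (h0 : (0 : ℝ) ∈ S) :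
    ContinuousOn (scatA P S ψp ψm) (closedD1 P) := by
  have hf := IsColumn.continuousOn (isPotential_env hq hbc h0) (hψ.column_plus h0) 0
  have hg := IsColumn.continuousOn (isPotential_reflEnv hq hbc h0) (hψ.column_minus h0) 0
  have hd : ContinuousOn (fun ζ : ℂ => (1 : ℂ) + P.q0 ^ 2 / ζ ^ 2) (closedD1 P) :=
    continuousOn_const.add (continuousOn_const.div (continuousOn_id.pow 2)
      fun ζ hζ => pow_ne_zero 2 hζ.1)
  simp only [neg_zero] at hg
  refine (((hg.snd.mul hf.snd).sub (hg.fst.mul hf.fst)).div hd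
    fun ζ hζ => one_add_ne_zero hζ.1 hζ.2.1).congr fun ζ hζ => ?_
  exact hψ.scatA_eq_mu hS h0 hζ h0 0

theorem IsJost.scatA_differentiableOn (hψ : IsJost P S q ψp ψm) (hq : IsSolution P S q)
    (hbc : HasNZBC P S q) (hS : S.OrdConnected) (h0 : (0 : ℝ) ∈ S) :
    DifferentiableOn ℂ (scatA P S ψp ψm) (D1 P) := by
  have hf := IsColumn.differentiableOn (isPotential_env hq hbc h0) (hψ.column_plus h0) 0
    (isOpen_D1) D1_subset
  have hg := IsColumn.differentiableOn (isPotential_reflEnv hq hbc h0) (hψ.column_minus h0) 0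
    (isOpen_D1) D1_subset
  have hd : DifferentiableOn ℂ (fun ζ : ℂ => (1 : ℂ) + P.q0 ^ 2 / ζ ^ 2) (D1 P) :=
    (differentiableOn_const _).add ((differentiableOn_const _).div (differentiableOn_id.pow 2)
      fun ζ hζ => pow_ne_zero 2 (D1_subset hζ).1)
  simp only [neg_zero] at hg
  refine (((hg.snd.mul hf.snd).sub (hg.fst.mul hf.fst)).div hd
    fun ζ hζ => one_add_ne_zero (D1_subset hζ).1 (D1_subset hζ).2.1).congr fun ζ hζ => ?_
  exact hψ.scatA_eq_mu hS h0 (D1_subset hζ) h0 0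

/-- At a zero of `a` the norming constant has its defining property. -/
theorem IsJost.normB_spec (hψ : IsJost P S q ψp ψm) (hq : IsSolution P S q) (hS : S.OrdConnected)
    (h0 : (0 : ℝ) ∈ S) (hζ : ζ ∈ closedD1 P) (ha : scatA P S ψp ψm ζ = 0) :
    ∀ x : ℝ, ∀ t ∈ S, ∀ i, ψm x t ζ i 0 = normB S ψp ψm ζ * ψp x t ζ i 1 := by
  refine Classical.epsilon_spec (p := fun b : ℂ =>
    ∀ x : ℝ, ∀ t ∈ S, ∀ i, ψm x t ζ i 0 = b * ψp x t ζ i 1) ?_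
  refine (hψ.minus_first' hζ).exists_eq_mul hS h0 (hψ.plus_second' hζ) (fun x t ht => ?_)
    fun x t ht => ?_
  · rw [hψ.scatA_eq hS h0 hζ ht x, div_eq_zero_iff] at ha
    exact ha.resolve_right (one_add_ne_zero hζ.1 hζ.2.1)
  · have := (hψ.column_plus ht ζ hζ).ne_zero (contDiff_env hq ht).continuous x
    simpa only [mu_one, mul_ne_zero_iff, exp_ne_zero, ne_eq, not_false_eq_true, and_true] using this

/-- At the conjugate of a zero of `a` the norming constant has its defining property. -/
theorem IsJost.normBt_spec (hψ : IsJost P S q ψp ψm) (hq : IsSolution P S q)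
    (hbc : HasNZBC P S q) (hS : S.OrdConnected)
    (h0 : (0 : ℝ) ∈ S) (hζ : ζ ∈ closedD1 P) (ha : scatA P S ψp ψm ζ = 0) :
    ∀ x : ℝ, ∀ t ∈ S, ∀ i,
      ψm x t (conj ζ) i 1 = normBt S ψp ψm (conj ζ) * ψp x t (conj ζ) i 0 := by
  refine Classical.epsilon_spec (p := fun b : ℂ =>
    ∀ x : ℝ, ∀ t ∈ S, ∀ i, ψm x t (conj ζ) i 1 = b * ψp x t (conj ζ) i 0)
      ⟨-conj (normB S ψp ψm ζ), fun x t ht i => ?_⟩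
  have hb := hψ.normB_spec hq hS h0 hζ ha x t ht
  have h1 := hψ.psi_plus_first hq hbc ht hζ x
  have h2 := hψ.psi_minus_second hq hbc ht hζ x
  fin_cases i
  · simp only [Fin.zero_eta, h1.1, h2.1, hb 1, map_mul]
    ring
  · simp only [Fin.mk_one, h1.2, h2.2, hb 0, map_mul]
    ring

end Link

/-! ### Removal of simple poles and sectional functions -/

section Sectional

variable {P : Params} {ι : Type*} [Fintype ι] {c ξ : ι → ℂ}

/-- Finitely many singularities of order less than one are removable. -/
theorem exists_differentiableOn_of_tendsto_zero {U : Set ℂ} (hU : IsOpen U) {G : ℂ → ℂ}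
    {F : Set ℂ} (hF : F.Finite) (hd : DifferentiableOn ℂ G (U \ F))
    (h0 : ∀ c ∈ F, Tendsto (fun z => (z - c) * G z) (𝓝[≠] c) (𝓝 0)) :
    ∃ G' : ℂ → ℂ, DifferentiableOn ℂ G' U ∧ ∀ z ∉ F, G' z = G z := by
  classical
  refine ⟨fun z => if z ∈ F then limUnder (𝓝[≠] z) G else G z, fun z hz => ?_,
    fun z hz => if_neg hz⟩
  by_cases hzF : z ∈ F
  · have hV : U \ (F \ {z}) ∈ 𝓝 z :=
      (hU.sdiff (hF.subset Set.sdiff_subset).isClosed).mem_nhds ⟨hz, fun h => h.2 rfl⟩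
    have h1 : DifferentiableOn ℂ G ((U \ (F \ {z})) \ {z}) :=
      hd.mono fun w hw => ⟨hw.1.1, fun h => hw.1.2 ⟨h, hw.2⟩⟩
    have h2 : (fun w => G w - G z) =o[𝓝[≠] z] fun w => (w - z)⁻¹ := by
      rw [Asymptotics.isLittleO_iff_tendsto']
      · have h3 : Tendsto (fun w : ℂ => (w - z) * G z) (𝓝[≠] z) (𝓝 0) := by
          have : Continuous fun w : ℂ => (w - z) * G z := by fun_prop
          simpa using (this.tendsto z).mono_left nhdsWithin_le_nhds
        have h4 := (h0 z hzF).sub h3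
        rw [sub_zero] at h4
        refine h4.congr fun w => ?_
        rw [div_inv_eq_mul]
        ring
      · filter_upwards [self_mem_nhdsWithin] with w hw h
        exact absurd (sub_eq_zero.1 (inv_eq_zero.1 h)) hw
    have h3 := (differentiableOn_update_limUnder_of_isLittleO hV h1 h2).differentiableAt hV
    refine (h3.congr_of_eventuallyEq ?_).differentiableWithinAt
    filter_upwards [hV] with w hw
    rcases eq_or_ne w z with rfl | hne
    · simp [hzF]
    · rw [Function.update_of_ne hne, if_neg fun h => hw.2 ⟨h, hne⟩]
  · have hV : U \ F ∈ 𝓝 z := (hU.sdiff hF.isClosed).mem_nhds ⟨hz, hzF⟩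
    refine ((hd.differentiableAt hV).congr_of_eventuallyEq ?_).differentiableWithinAt
    filter_upwards [hV] with w hw using if_neg hw.2

/-- The rational function with the simple poles `ξ i` and the residues `c i`, vanishing at
infinity. -/
noncomputable def simplePoles (c ξ : ι → ℂ) (ζ : ℂ) : ℂ := ∑ i, c i / (ζ - ξ i)

theorem differentiableAt_simplePoles {z : ℂ} (hz : z ∉ Set.range ξ) :
    DifferentiableAt ℂ (simplePoles c ξ) z := by
  unfold simplePoles
  refine DifferentiableAt.fun_sum fun i _ => ?_
  exact (differentiableAt_const _).div (differentiableAt_id.sub_const _)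
    (sub_ne_zero.2 fun h => hz ⟨i, h.symm⟩)

theorem tendsto_mul_simplePoles_zero (h : ∀ i, ξ i ≠ 0) :
    Tendsto (fun ζ => ζ * simplePoles c ξ ζ) (𝓝 0) (𝓝 0) := by
  have h1 := (differentiableAt_simplePoles (c := c) (ξ := ξ) (z := 0)
    fun ⟨i, hi⟩ => h i hi).continuousAt
  simpa using tendsto_id.mul h1.tendsto

theorem tendsto_mul_simplePoles_cobounded :
    Tendsto (fun ζ => ζ * simplePoles c ξ ζ) (Bornology.cobounded ℂ) (𝓝 (∑ i, c i)) := by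
  simp only [simplePoles, Finset.mul_sum]
  refine tendsto_finsetSum _ fun i _ => ?_
  have h1 : Tendsto (fun ζ : ℂ => (ζ - ξ i)⁻¹) (Bornology.cobounded ℂ) (𝓝 0) := by
    refine tendsto_inv₀_cobounded.comp ?_
    refine tendsto_norm_atTop_iff_cobounded.1 ?_
    refine tendsto_atTop_mono (fun ζ => norm_sub_norm_le ζ (ξ i)) ?_
    exact tendsto_atTop_add_const_right _ _ tendsto_norm_cobounded_atTop
  have h2 : Tendsto (fun ζ : ℂ => c i + c i * ξ i * (ζ - ξ i)⁻¹) (Bornology.cobounded ℂ)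
      (𝓝 (c i)) := by
    simpa using (h1.const_mul (c i * ξ i)).const_add (c i)
  refine h2.congr' ?_
  filter_upwards [Bornology.isBounded_def.1 (Set.finite_singleton (ξ i)).isBounded] with ζ hζ
  have : ζ - ξ i ≠ 0 := sub_ne_zero.2 hζ
  field_simp
  ring

theorem tendsto_mul_simplePoles_pole (hξ : Function.Injective ξ) (i : ι) :
    Tendsto (fun ζ => (ζ - ξ i) * simplePoles c ξ ζ) (𝓝[≠] ξ i) (𝓝 (c i)) := by
  classical
  have h1 : ContinuousAt (fun ζ => (ζ - ξ i) * ∑ j ∈ Finset.univ.erase i, c j / (ζ - ξ j) + c i)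
      (ξ i) := by
    refine ((continuousAt_id.sub continuousAt_const).mul ?_).add continuousAt_const
    refine tendsto_finsetSum _ fun j hj => ?_
    exact (continuousAt_const.div (continuousAt_id.sub continuousAt_const)
      (sub_ne_zero.2 fun h => (Finset.ne_of_mem_erase hj) (hξ h.symm)))
  have h2 := h1.tendsto.mono_left (nhdsWithin_le_nhds (s := {ξ i}ᶜ))
  simp only [sub_self, zero_mul, zero_add] at h2
  refine h2.congr' ?_
  filter_upwards [self_mem_nhdsWithin] with ζ hζ
  have : ζ - ξ i ≠ 0 := sub_ne_zero.2 hζ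
  rw [simplePoles, ← Finset.add_sum_erase _ _ (Finset.mem_univ i)]
  field_simp
  ring

theorem disjoint_closedD1_D2 {ζ : ℂ} (h : ζ ∈ closedD1 P) : ζ ∉ D2 P := fun h2 =>
  absurd (mem_D2_iff.1 h2) h.2.2.not_gt

/-- Local boundedness only has to be checked at the branch points. -/
theorem bounded_of_continuousOn {H : ℂ → ℂ} (hc : ContinuousOn H (closedD1 P))
    (hb : ∀ z, z ≠ 0 → lam P z = 0 → ∃ C, ∀ᶠ ζ in 𝓝[closedD1 P] z, ‖H ζ‖ ≤ C) :
    ∀ z, z ≠ 0 → ∃ C, ∀ᶠ ζ in 𝓝[closedD1 P] z, ‖H ζ‖ ≤ C := by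
  intro z hz
  by_cases h1 : lam P z = 0
  · exact hb z hz h1
  by_cases h2 : z ∈ closedD1 P
  · exact ⟨‖H z‖ + 1, ((hc z h2).norm.eventually (gt_mem_nhds (lt_add_one _))).mono
      fun _ h => h.le⟩
  · have h3 : z ∈ D2 P := mem_D2_iff.2 (not_le.1 fun h => h2 ⟨hz, h1, h⟩)
    refine ⟨0, ?_⟩
    filter_upwards [self_mem_nhdsWithin, nhdsWithin_le_nhds (isOpen_D2.mem_nhds h3)] with ζ h4 h5
    exact absurd h5 (disjoint_closedD1_D2 h4)

theorem IsSectional.const_mul {S D : Set ℂ} {H : ℂ → ℂ} {k0 kInf : ℂ}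
    (h : IsSectional S D H k0 kInf) (w : ℂ) :
    IsSectional S D (fun ζ => w * H ζ) (w * k0) (w * kInf) := by
  refine ⟨continuousOn_const.mul h.cont, h.diff.const_mul w, fun z hz => ?_, ?_, ?_⟩
  · obtain ⟨C, hC⟩ := h.bounded z hz
    refine ⟨‖w‖ * C, hC.mono fun ζ hζ => ?_⟩
    rw [norm_mul]
    gcongr
  · exact (h.zero.const_mul w).congr fun ζ => by ring
  · exact (h.infty.const_mul w).congr fun ζ => by ring

theorem tendsto_conj_cobounded :
    Tendsto (fun ζ : ℂ => conj ζ) (Bornology.cobounded ℂ) (Bornology.cobounded ℂ) := by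
  refine tendsto_norm_atTop_iff_cobounded.1 ?_
  simpa using tendsto_norm_cobounded_atTop (E := ℂ)

/-- Schwarz reflection of a sectional function. -/
theorem IsSectional.schwarz {H : ℂ → ℂ} {k0 kInf : ℂ}
    (h : IsSectional (closedD1 P) (D1 P) H k0 kInf) :
    IsSectional (closedD2 P) (D2 P) (fun ζ => -conj (H (conj ζ))) (-conj k0) (-conj kInf) := by
  have hm : Set.MapsTo (fun ζ : ℂ => conj ζ) (closedD2 P) (closedD1 P) :=
    fun ζ hζ => conj_mem_closedD1.2 hζ
  have ht : ∀ z : ℂ, Tendsto (fun ζ : ℂ => conj ζ) (𝓝[closedD2 P] z) (𝓝[closedD1 P] (conj z)) :=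
    fun z => tendsto_nhdsWithin_iff.2
      ⟨(continuous_conj.tendsto z).mono_left nhdsWithin_le_nhds,
        eventually_mem_nhdsWithin.mono hm⟩
  refine ⟨?_, ?_, fun z hz => ?_, ?_, ?_⟩
  · exact (continuous_conj.comp_continuousOn
      (h.cont.comp continuous_conj.continuousOn hm)).neg
  · intro z hz
    have h1 : DifferentiableAt ℂ H (conj z) :=
      h.diff.differentiableAt (isOpen_D1.mem_nhds (conj_mem_D1.2 hz))
    have h2 : DifferentiableAt ℂ (conj ∘ H ∘ conj) z := differentiableAt_conj_conj_iff.2 h1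
    exact h2.neg.differentiableWithinAt
  · obtain ⟨C, hC⟩ := h.bounded (conj z) (by simpa using hz)
    refine ⟨C, ((ht z).eventually hC).mono fun ζ hζ => ?_⟩
    rwa [norm_neg, RCLike.norm_conj]
  · have h1 := ht 0
    rw [map_zero] at h1
    refine (tendsto_conj (h.zero.comp h1)).neg.congr fun ζ => ?_
    simp
  · have h1 : Tendsto (fun ζ : ℂ => conj ζ) (Bornology.cobounded ℂ ⊓ 𝓟 (closedD2 P))
        (Bornology.cobounded ℂ ⊓ 𝓟 (closedD1 P)) :=
      tendsto_inf.2 ⟨tendsto_conj_cobounded.mono_left inf_le_left,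
        tendsto_principal.2 (mem_inf_of_right hm)⟩
    refine (tendsto_conj (h.infty.comp h1)).neg.congr fun ζ => ?_
    simp

theorem tendsto_sharp_zero : Tendsto (sharp P) (𝓝[closedD1 P] 0) (atInftyD1 P) := by
  refine tendsto_inf.2 ⟨?_, tendsto_principal.2 ?_⟩
  · have h1 : Tendsto (fun ζ : ℂ => ζ⁻¹) (𝓝[closedD1 P] 0) (Bornology.cobounded ℂ) :=
      tendsto_inv₀_nhdsNE_zero.mono_left (nhdsWithin_mono _ fun ζ hζ => hζ.1)
    rw [← tendsto_norm_atTop_iff_cobounded] at h1 ⊢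
    have h2 := h1.const_mul_atTop (pow_pos P.q0_pos 2)
    refine h2.congr fun ζ => ?_
    rw [sharp, norm_neg, norm_div, norm_pow, norm_real, Real.norm_of_nonneg P.q0_pos.le,
      RCLike.norm_conj, norm_inv, div_eq_mul_inv]
  · exact eventually_mem_nhdsWithin.mono fun ζ hζ => sharp_mem_closedD1 hζ

/-- The asymptotics of a column at `ζ = 0`, from those at infinity and the second symmetry. -/
theorem IsColumn.tendsto_zero {p : ℝ → ℂ} {Q : ℂ} (hp : IsPotential P p Q) {f1 f2 : ℂ → ℝ → ℂ}
    (hf : ∀ ζ ∈ closedD1 P, IsColumn P p Q ζ (f1 ζ) (f2 ζ)) (x : ℝ) :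
    Tendsto (fun ζ => ζ * f1 ζ x) (𝓝[closedD1 P] 0)
      (𝓝 (-I * Q * exp (-(I * tail (tau P p) x)))) ∧
    ∃ L, Tendsto (fun ζ => f2 ζ x) (𝓝[closedD1 P] 0) (𝓝 L) := by
  obtain ⟨h2, h1⟩ := IsColumn.tendsto_atInfty hp hf x
  constructor
  · have h3 := (tendsto_conj (h2.comp tendsto_sharp_zero)).const_mul (-I * Q)
    refine (h3.congr' ?_).congr_right ?_
    · filter_upwards [self_mem_nhdsWithin] with ζ hζ
      have := hζ.1
      rw [(IsColumn.sharp_eq hp hf hζ x).1]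
      simp only [Function.comp]
      field_simp
    · rw [← exp_conj, map_mul, conj_I, conj_ofReal, neg_mul I (tail _ _ : ℂ)]
  · refine ⟨_, ((tendsto_conj (h1.comp tendsto_sharp_zero)).const_mul
      (-I * Q / P.q0 ^ 2)).congr' ?_⟩
    filter_upwards [self_mem_nhdsWithin] with ζ hζ
    have := hζ.1
    have := q0_ne_zero P
    rw [(IsColumn.sharp_eq hp hf hζ x).2]
    simp only [Function.comp, map_mul, conj_sharp]
    field_simp

end Sectional

/-! ### The discrete spectrum -/

/-- The standing hypotheses on the solution, its Jost solutions and their spectrum. -/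
structure IsScatteringSetting (P : Params) (S : Set ℝ) (q : ℝ → ℝ → ℂ)
    (ψp ψm : ℝ → ℝ → ℂ → Matrix (Fin 2) (Fin 2) ℂ) {N : ℕ} (ζs : Fin N → ℂ) : Prop where
  ordConnected : S.OrdConnected
  zero_mem : (0 : ℝ) ∈ S
  solution : IsSolution P S q
  nzbc : HasNZBC P S q
  jost : IsJost P S q ψp ψm
  spectrum : SimpleSpectrum P S ψp ψm ζs

/-- The zeros of `a` in `D₁`: the conjugates of the points `η̄_j`, that is the `ζ_j` and their
images under `ζ → -q₀² / ζ̄`. -/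
noncomputable def pole (P : Params) {N : ℕ} (ζs : Fin N → ℂ) (k : Fin N ⊕ Fin N) : ℂ :=
  conj (etaBar P ζs k)

/-- The residue of `μ_{-,21} / a` at a zero of `a`. -/
noncomputable def poleResidue (P : Params) (S : Set ℝ)
    (ψp ψm : ℝ → ℝ → ℂ → Matrix (Fin 2) (Fin 2) ℂ) {N : ℕ} (ζs : Fin N → ℂ) (x t : ℝ)
    (k : Fin N ⊕ Fin N) : ℂ :=
  mu P ψm x t (pole P ζs k) 1 0 / deriv (scatA P S ψp ψm) (pole P ζs k)

namespace IsScatteringSetting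

variable {P : Params} {S : Set ℝ} {q : ℝ → ℝ → ℂ} {ψp ψm : ℝ → ℝ → ℂ → Matrix (Fin 2) (Fin 2) ℂ}
  {N : ℕ} {ζs : Fin N → ℂ} {ζ : ℂ} {x t : ℝ}

theorem conj_qp (P : Params) : P.qp * conj P.qp = P.q0 ^ 2 := by
  rw [mul_conj, normSq_eq_norm_sq, P.norm_qp]; push_cast; rfl

theorem qp_ne_zero (P : Params) : P.qp ≠ 0 :=
  norm_pos_iff.1 (P.norm_qp.symm ▸ P.q0_pos)

theorem qm_ne_zero (P : Params) : P.qm ≠ 0 :=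
  norm_pos_iff.1 (P.norm_qm.symm ▸ P.q0_pos)

theorem conj_pole (k : Fin N ⊕ Fin N) : conj (pole P ζs k) = etaBar P ζs k :=
  Complex.conj_conj _

theorem pole_inl (j : Fin N) : pole P ζs (Sum.inl j) = ζs j := Complex.conj_conj _

theorem pole_inr (j : Fin N) : pole P ζs (Sum.inr j) = sharp P (ζs j) := by
  rw [pole, etaBar, ← conj_sharp, Complex.conj_conj]

theorem outer (h : IsScatteringSetting P S q ψp ψm ζs) (j : Fin N) :
    P.q0 < ‖ζs j‖ ∧ 0 < (ζs j).im ∧ scatA P S ψp ψm (ζs j) = 0 :=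
  (h.spectrum.zeros _).2 ⟨j, rfl⟩

theorem mem_D1 (h : IsScatteringSetting P S q ψp ψm ζs) (j : Fin N) : ζs j ∈ D1 P := by
  obtain ⟨h1, h2, -⟩ := h.outer j
  have := P.q0_pos
  exact mul_pos (by nlinarith) h2

theorem norm_sharp (P : Params) (ζ : ℂ) : ‖sharp P ζ‖ = P.q0 ^ 2 / ‖ζ‖ := by
  rw [sharp, norm_neg, norm_div, norm_pow, norm_real, Real.norm_of_nonneg P.q0_pos.le,
    RCLike.norm_conj]

theorem pole_mem_D1 (h : IsScatteringSetting P S q ψp ψm ζs) (k : Fin N ⊕ Fin N) :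
    pole P ζs k ∈ D1 P := by
  rcases k with j | j
  · rw [pole_inl]; exact h.mem_D1 j
  · rw [pole_inr]; exact sharp_mem_D1 (h.mem_D1 j)

theorem pole_ne_zero (h : IsScatteringSetting P S q ψp ψm ζs) (k : Fin N ⊕ Fin N) :
    pole P ζs k ≠ 0 :=
  (D1_subset (h.pole_mem_D1 k)).1

theorem pole_injective (h : IsScatteringSetting P S q ψp ψm ζs) :
    Function.Injective (pole P ζs) := by
  have hq := P.q0_pos
  -- The `ζ_j` lie outside the circle `|ζ| = q₀`, their images inside.
  have hs : ∀ i j, ζs i ≠ sharp P (ζs j) := by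
    intro i j e
    have h1 := (h.outer i).1
    have h2 := (h.outer j).1
    rw [e, norm_sharp, lt_div_iff₀ (hq.trans h2)] at h1
    nlinarith
  rintro (i | i) (j | j) e <;> simp only [pole_inl, pole_inr] at e
  · rw [h.spectrum.injective e]
  · exact absurd e (hs i j)
  · exact absurd e.symm (hs j i)
  · have := congrArg (sharp P) e
    rw [sharp_sharp (D1_subset (h.mem_D1 i)).1, sharp_sharp (D1_subset (h.mem_D1 j)).1] at this
    rw [h.spectrum.injective this]

theorem scatA_sharp (h : IsScatteringSetting P S q ψp ψm ζs) (hζ : ζ ∈ closedD1 P) :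
    scatA P S ψp ψm ζ = conj P.qm * P.qp / P.q0 ^ 2 * conj (scatA P S ψp ψm (sharp P ζ)) :=
  h.jost.scatA_sharp h.solution h.nzbc h.ordConnected h.zero_mem hζ

theorem scatA_pole (h : IsScatteringSetting P S q ψp ψm ζs) (k : Fin N ⊕ Fin N) :
    scatA P S ψp ψm (pole P ζs k) = 0 := by
  rcases k with j | j
  · rw [pole_inl]; exact (h.outer j).2.2
  · have h1 := D1_subset (h.mem_D1 j)
    rw [pole_inr, h.scatA_sharp (sharp_mem_closedD1 h1), sharp_sharp h1.1, (h.outer j).2.2]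
    simp

/-- The zeros of `a` in `D₁ ∪ Σ_Ω`. -/
theorem mem_range_pole (h : IsScatteringSetting P S q ψp ψm ζs) (hζ : ζ ∈ closedD1 P)
    (ha : scatA P S ψp ψm ζ = 0) : ζ ∈ Set.range (pole P ζs) := by
  have hq := P.q0_pos
  have hD : ζ ∈ D1 P := by
    rw [← D1_union_Sigma] at hζ
    exact hζ.resolve_right fun h1 => h.spectrum.ne_zero ζ h1 ha
  have hz : 0 < ‖ζ‖ := norm_pos_iff.2 hζ.1
  have key : ∀ z ∈ D1 P, P.q0 < ‖z‖ → scatA P S ψp ψm z = 0 → z ∈ Set.range ζs := by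
    intro z hz h1 h2
    refine (h.spectrum.zeros z).1 ⟨h1, ?_, h2⟩
    exact pos_of_mul_pos_right hz (by nlinarith)
  rcases lt_trichotomy ‖ζ‖ P.q0 with h1 | h1 | h1
  · have h2 : P.q0 < ‖sharp P ζ‖ := by
      rw [norm_sharp, lt_div_iff₀ hz]; nlinarith
    have h3 : scatA P S ψp ψm (sharp P ζ) = 0 := by
      rw [h.scatA_sharp (sharp_mem_closedD1 hζ), sharp_sharp hζ.1, ha]; simp
    obtain ⟨j, hj⟩ := key _ (sharp_mem_D1 hD) h2 h3
    exact ⟨Sum.inr j, by rw [pole_inr, hj, sharp_sharp hζ.1]⟩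
  · rw [D1, Set.mem_ofPred_eq, h1] at hD
    simp at hD
  · obtain ⟨j, hj⟩ := key ζ hD h1 ha
    exact ⟨Sum.inl j, by rw [pole_inl, hj]⟩

theorem differentiableAt_scatA (h : IsScatteringSetting P S q ψp ψm ζs) (hζ : ζ ∈ D1 P) :
    DifferentiableAt ℂ (scatA P S ψp ψm) ζ :=
  (h.jost.scatA_differentiableOn h.solution h.nzbc h.ordConnected h.zero_mem).differentiableAt
    (isOpen_D1.mem_nhds hζ)

/-- The derivative of `a` at `-q₀² / ζ̄`, by the second symmetry of `a`. -/
theorem conj_deriv_sharp (h : IsScatteringSetting P S q ψp ψm ζs) (hζ : ζ ∈ D1 P) :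
    conj (deriv (scatA P S ψp ψm) (sharp P ζ)) =
      P.qm * conj P.qp / P.q0 ^ 2 * (deriv (scatA P S ψp ψm) ζ * (ζ ^ 2 / P.q0 ^ 2)) := by
  have h0 := (D1_subset hζ).1
  have hs := sharp_mem_D1 hζ
  have hs0 : sharp P ζ ≠ 0 := (D1_subset hs).1
  have hq := q0_ne_zero P
  set A := scatA P S ψp ψm
  have e1 : ∀ w, conj (-((P.q0 : ℂ) ^ 2 / w)) = sharp P w := fun w => by simp [sharp]
  have d1 : HasDerivAt (conj ∘ A ∘ conj) (conj (deriv A ζ)) (conj ζ) := by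
    have := (h.differentiableAt_scatA hζ).hasDerivAt
    exact hasDerivAt_conj_conj_iff.2 (by simpa using this)
  have e2 : conj ζ = -((P.q0 : ℂ) ^ 2 / sharp P ζ) := by
    rw [← conj_sharp, sharp_sharp h0]
  have d2 : HasDerivAt (fun w : ℂ => -((P.q0 : ℂ) ^ 2 / w)) ((P.q0 : ℂ) ^ 2 / (sharp P ζ) ^ 2)
      (sharp P ζ) := by
    have := ((hasDerivAt_inv hs0).const_mul ((P.q0 : ℂ) ^ 2)).neg
    refine (this.congr_deriv (by ring)).congr_of_eventuallyEq (Eventually.of_forall fun w => ?_)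
    simp only [div_eq_mul_inv, Pi.neg_apply]
  rw [e2] at d1
  have d3 := (HasDerivAt.comp (h := fun w : ℂ => -((P.q0 : ℂ) ^ 2 / w)) (sharp P ζ) d1 d2).const_mul (conj P.qm * P.qp / P.q0 ^ 2)
  have d4 : HasDerivAt A _ (sharp P ζ) := d3.congr_of_eventuallyEq <| by
    filter_upwards [isOpen_D1.mem_nhds hs] with w hw
    simpa only [Function.comp, e1] using h.scatA_sharp (D1_subset hw)
  rw [d4.deriv]
  simp only [map_mul, map_div₀, map_pow, conj_ofReal, Complex.conj_conj, conj_sharp]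
  field_simp

theorem deriv_pole_ne_zero (h : IsScatteringSetting P S q ψp ψm ζs) (k : Fin N ⊕ Fin N) :
    deriv (scatA P S ψp ψm) (pole P ζs k) ≠ 0 := by
  rcases k with j | j
  · rw [pole_inl]; exact h.spectrum.simple j
  · rw [pole_inr]
    have h1 := h.conj_deriv_sharp (h.mem_D1 j)
    have := q0_ne_zero P
    have := (D1_subset (h.mem_D1 j)).1
    have := qm_ne_zero P
    have h2 : conj P.qp ≠ 0 := by simpa using qp_ne_zero P
    have := h.spectrum.simple j
    intro h3
    rw [h3, map_zero] at h1
    exact absurd h1.symm (by positivity)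

/-- The norming constants in terms of the residues of `μ_{-,21} / a`. -/
theorem cTilde_eq (h : IsScatteringSetting P S q ψp ψm ζs) (ht : t ∈ S) (x : ℝ)
    (k : Fin N ⊕ Fin N) :
    cTilde P S ψp ψm ζs k * exp (-2 * I * Theta P x t (etaBar P ζs k))
        * mu P ψp x t (etaBar P ζs k) 0 0 = -conj (poleResidue P S ψp ψm ζs x t k) := by
  rcases k with j | j
  -- At `ζ_j` this is the Schwarz symmetry.
  · have hD := D1_subset (h.mem_D1 j)
    have hb := h.jost.normBt_spec h.solution h.nzbc h.ordConnected h.zero_mem hD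
      (h.outer j).2.2 x t ht 0
    have hm := (h.jost.mu_minus_second h.solution h.nzbc ht hD x).1
    have hd : deriv (scatAt P S ψp ψm) (conj (ζs j)) = conj (deriv (scatA P S ψp ψm) (ζs j)) := by
      have h1 : HasDerivAt (conj ∘ scatA P S ψp ψm ∘ conj)
          (conj (deriv (scatA P S ψp ψm) (ζs j))) (conj (ζs j)) :=
        hasDerivAt_conj_conj_iff.2
          (by simpa using (h.differentiableAt_scatA (h.mem_D1 j)).hasDerivAt)
      refine (h1.congr_of_eventuallyEq ?_).deriv
      filter_upwards [isOpen_D2.mem_nhds (conj_mem_D2.2 (h.mem_D1 j))] with w hw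
      have := h.jost.scatAt_conj h.solution h.nzbc h.ordConnected h.zero_mem
        (D1_subset (conj_mem_D1.2 hw))
      rwa [Complex.conj_conj] at this
    rw [mu_one] at hm
    rw [poleResidue, pole_inl, etaBar, cTilde, map_div₀, ← neg_div, ← hm, hb, hd, exp_neg_two_Theta, mu_zero]
    have := exp_mul_exp_neg (I * Theta P x t (conj (ζs j)))
    linear_combination (normBt S ψp ψm (conj (ζs j)) / conj (deriv (scatA P S ψp ψm) (ζs j)) *
      ψp x t (conj (ζs j)) 0 0 * exp (-(I * Theta P x t (conj (ζs j))))) * this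
  -- At `-q₀² / ζ̄_j` both columns come from those at `ζ_j` by the second symmetry, and `Θ` changes
  -- its sign.
  · have hD := D1_subset (h.mem_D1 j)
    have hb := h.jost.normB_spec h.solution h.ordConnected h.zero_mem hD
      (h.outer j).2.2 x t ht 0
    have hf := (IsColumn.sharp_eq (isPotential_env h.solution h.nzbc ht)
      (h.jost.column_plus ht) (sharp_mem_closedD1 hD) x).2
    have hg := (IsColumn.sharp_eq (isPotential_reflEnv h.solution h.nzbc ht)
      (h.jost.column_minus ht) (sharp_mem_closedD1 hD) (-x)).1
    simp only [neg_neg] at hg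
    rw [sharp_sharp hD.1] at hf hg
    have hm := (h.jost.mu_plus_first h.solution h.nzbc ht (sharp_mem_closedD1 hD) x).1
    have hT : exp (-(I * Theta P x t (-((P.q0 : ℂ) ^ 2 / ζs j)))) = exp (I * Theta P x t (ζs j)) := by
      rw [Theta_neg_div hD.1, mul_neg, neg_neg]
    have hqp := conj_qp P
    have := q0_ne_zero P
    have := hD.1
    have := qm_ne_zero P
    have := h.spectrum.simple j
    have h2 : conj P.qp ≠ 0 := by simpa using qp_ne_zero P
    have hE := exp_mul_exp_neg (I * Theta P x t (ζs j))
    rw [conj_sharp] at hm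
    rw [poleResidue, pole_inr, etaBar, cTilde, map_div₀, h.conj_deriv_sharp (h.mem_D1 j),
      exp_neg_two_Theta, hT, hm, hf, hg, mu_zero, hb, mu_one]
    simp only [map_mul, map_div₀, map_neg, conj_I, conj_sharp, Complex.conj_conj, neg_neg]
    set E := exp (I * Theta P x t (ζs j))
    set E' := exp (-(I * Theta P x t (ζs j)))
    set B := normB S ψp ψm (ζs j)
    set a' := deriv (scatA P S ψp ψm) (ζs j)
    set u := ψp x t (ζs j) 0 1
    field_simp
    linear_combination (B * E * u) * hqp + (B * E * u * P.qp * conj P.qp) * hE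

end IsScatteringSetting

/-! ### The sectional functions and their jump -/

namespace IsScatteringSetting

variable {P : Params} {S : Set ℝ} {q : ℝ → ℝ → ℂ} {ψp ψm : ℝ → ℝ → ℂ → Matrix (Fin 2) (Fin 2) ℂ}
  {N : ℕ} {ζs : Fin N → ℂ} {ζ : ℂ} {x t : ℝ}

theorem tail_env (x t : ℝ) : tail (tau P fun y => env P q y t) x = omegaPlus P q x t := by
  simp only [tail, tau, norm_env, omegaPlus, integral_const_mul]

theorem plus_infty (h : IsScatteringSetting P S q ψp ψm ζs) (ht : t ∈ S) (x : ℝ) :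
    Tendsto (fun ζ => mu P ψp x t ζ 1 1) (atInftyD1 P) (𝓝 (exp (I * omegaPlus P q x t))) ∧
      Tendsto (fun ζ => ζ * mu P ψp x t ζ 0 1) (atInftyD1 P)
        (𝓝 (-I * env P q x t * exp (I * omegaPlus P q x t))) := by
  have := IsColumn.tendsto_atInfty (isPotential_env h.solution h.nzbc ht) (h.jost.column_plus ht) x
  rwa [tail_env] at this

theorem plus_zero (h : IsScatteringSetting P S q ψp ψm ζs) (ht : t ∈ S) (x : ℝ) :
    Tendsto (fun ζ => ζ * mu P ψp x t ζ 0 1) (𝓝[closedD1 P] 0)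
      (𝓝 (-I * P.qp * exp (-(I * omegaPlus P q x t)))) ∧
    ∃ L, Tendsto (fun ζ => mu P ψp x t ζ 1 1) (𝓝[closedD1 P] 0) (𝓝 L) := by
  have := IsColumn.tendsto_zero (isPotential_env h.solution h.nzbc ht) (h.jost.column_plus ht) x
  rwa [tail_env] at this

/-- `T ∫_{-∞}^x (|q|² - q₀²) dy`. -/
noncomputable def omegaMinus (P : Params) (q : ℝ → ℝ → ℂ) (x t : ℝ) : ℝ :=
  tail (tau P (reflEnv P q t)) (-x)

theorem minus_infty (h : IsScatteringSetting P S q ψp ψm ζs) (ht : t ∈ S) (x : ℝ) :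
    Tendsto (fun ζ => mu P ψm x t ζ 0 0) (atInftyD1 P) (𝓝 (exp (I * omegaMinus P q x t))) ∧
      Tendsto (fun ζ => ζ * mu P ψm x t ζ 1 0) (atInftyD1 P)
        (𝓝 (-I * conj (env P q x t) * exp (I * omegaMinus P q x t))) := by
  have := IsColumn.tendsto_atInfty (isPotential_reflEnv h.solution h.nzbc ht)
    (h.jost.column_minus ht) (-x)
  rw [← omegaMinus] at this
  simpa only [neg_neg, reflEnv] using this

theorem minus_zero (h : IsScatteringSetting P S q ψp ψm ζs) (ht : t ∈ S) (x : ℝ) :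
    Tendsto (fun ζ => ζ * mu P ψm x t ζ 1 0) (𝓝[closedD1 P] 0)
      (𝓝 (-I * conj P.qm * exp (-(I * omegaMinus P q x t)))) ∧
    ∃ L, Tendsto (fun ζ => mu P ψm x t ζ 0 0) (𝓝[closedD1 P] 0) (𝓝 L) := by
  have := IsColumn.tendsto_zero (isPotential_reflEnv h.solution h.nzbc ht)
    (h.jost.column_minus ht) (-x)
  rw [← omegaMinus] at this
  simpa only [neg_neg] using this

theorem scatA_infty (h : IsScatteringSetting P S q ψp ψm ζs) (ht : t ∈ S) (x : ℝ) :
    Tendsto (scatA P S ψp ψm) (atInftyD1 P)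
      (𝓝 (exp (I * omegaMinus P q x t) * exp (I * omegaPlus P q x t))) := by
  obtain ⟨f2, f1⟩ := h.plus_infty ht x
  obtain ⟨g2, g1⟩ := h.minus_infty ht x
  have h0 : Tendsto (fun ζ : ℂ => ζ⁻¹ ^ 2) (atInftyD1 P) (𝓝 0) := by
    have h1 : Tendsto (fun ζ : ℂ => ζ⁻¹) (atInftyD1 P) (𝓝 0) :=
      tendsto_inv₀_cobounded.mono_left inf_le_left
    simpa using h1.pow 2
  have h1 := ((g2.mul f2).sub ((g1.mul f1).mul h0)).div ((h0.const_mul ((P.q0 : ℂ) ^ 2)).const_add 1)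
    (by simp)
  rw [mul_zero, mul_zero, sub_zero, add_zero, div_one] at h1
  refine h1.congr' ?_
  filter_upwards [mem_inf_of_right (mem_principal_self _)] with ζ hζ
  have := hζ.1
  rw [h.jost.scatA_eq_mu h.ordConnected h.zero_mem hζ ht x]
  simp only [Pi.div_apply]
  congr 1 <;> field_simp

theorem scatA_zero (h : IsScatteringSetting P S q ψp ψm ζs) (ht : t ∈ S) (x : ℝ) :
    Tendsto (scatA P S ψp ψm) (𝓝[closedD1 P] 0) (𝓝 (conj P.qm * P.qp / P.q0 ^ 2 *
      (exp (-(I * omegaMinus P q x t)) * exp (-(I * omegaPlus P q x t))))) := by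
  have h1 := (tendsto_conj ((h.scatA_infty ht x).comp tendsto_sharp_zero)).const_mul
    (conj P.qm * P.qp / P.q0 ^ 2)
  refine (h1.congr' ?_).congr_right ?_
  · filter_upwards [self_mem_nhdsWithin] with ζ hζ using (h.scatA_sharp hζ).symm
  · simp only [map_mul, ← exp_conj, conj_I, conj_ofReal, neg_mul]

theorem quotient_infty (h : IsScatteringSetting P S q ψp ψm ζs) (ht : t ∈ S) (x : ℝ) :
    Tendsto (fun ζ => ζ * (mu P ψm x t ζ 1 0 / scatA P S ψp ψm ζ)) (atInftyD1 P)
      (𝓝 (-I * conj (env P q x t) * exp (-(I * omegaPlus P q x t)))) := by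
  refine (((h.minus_infty ht x).2.div (h.scatA_infty ht x)
    (mul_ne_zero (exp_ne_zero _) (exp_ne_zero _))).congr fun ζ => ?_).congr_right ?_
  · rw [Pi.div_apply, mul_div_assoc]
  · have e := exp_mul_exp_neg (I * omegaPlus P q x t)
    rw [div_eq_iff (mul_ne_zero (exp_ne_zero _) (exp_ne_zero _))]
    linear_combination (I * conj (env P q x t) * exp (I * omegaMinus P q x t)) * e

theorem scatA_zero_ne_zero (x t : ℝ) : conj P.qm * P.qp / P.q0 ^ 2 *
    (exp (-(I * omegaMinus P q x t)) * exp (-(I * omegaPlus P q x t))) ≠ 0 := by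
  have h1 : conj P.qm ≠ 0 := by simpa using qm_ne_zero P
  exact mul_ne_zero (div_ne_zero (mul_ne_zero h1 (qp_ne_zero P)) (pow_ne_zero 2 (q0_ne_zero P)))
    (mul_ne_zero (exp_ne_zero _) (exp_ne_zero _))

theorem quotient_zero (h : IsScatteringSetting P S q ψp ψm ζs) (ht : t ∈ S) (x : ℝ) :
    Tendsto (fun ζ => ζ * (mu P ψm x t ζ 1 0 / scatA P S ψp ψm ζ)) (𝓝[closedD1 P] 0)
      (𝓝 (-I * conj P.qp * exp (I * omegaPlus P q x t))) := by
  refine (((h.minus_zero ht x).1.div (h.scatA_zero ht x)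
    (scatA_zero_ne_zero (q := q) x t)).congr fun ζ => ?_).congr_right ?_
  · rw [Pi.div_apply, mul_div_assoc]
  · have e := exp_mul_exp_neg (I * omegaPlus P q x t)
    rw [div_eq_iff (scatA_zero_ne_zero (q := q) x t)]
    have := q0_ne_zero P
    have hq := conj_qp P
    field_simp
    linear_combination (conj P.qm * P.qp * conj P.qp) * e + conj P.qm * hq

theorem range_pole_subset (h : IsScatteringSetting P S q ψp ψm ζs) :
    Set.range (pole P ζs) ⊆ D1 P := by
  rintro _ ⟨k, rfl⟩; exact h.pole_mem_D1 k

theorem continuousOn_minus (h : IsScatteringSetting P S q ψp ψm ζs) (ht : t ∈ S) (x : ℝ) :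
    ContinuousOn (fun ζ => mu P ψm x t ζ 1 0) (closedD1 P) := by
  have := (IsColumn.continuousOn (isPotential_reflEnv h.solution h.nzbc ht)
    (h.jost.column_minus ht) (-x)).fst
  simpa only [neg_neg] using this

theorem differentiableOn_minus (h : IsScatteringSetting P S q ψp ψm ζs) (ht : t ∈ S) (x : ℝ) :
    DifferentiableOn ℂ (fun ζ => mu P ψm x t ζ 1 0) (D1 P) := by
  have := (IsColumn.differentiableOn (isPotential_reflEnv h.solution h.nzbc ht)
    (h.jost.column_minus ht) (-x) isOpen_D1 D1_subset).fst
  simpa only [neg_neg] using this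

/-- Near a branch point `μ_{-,21} / a` is bounded, because there is no spectral singularity. -/
theorem quotient_bounded (h : IsScatteringSetting P S q ψp ψm ζs) (ht : t ∈ S) (x : ℝ) {z : ℂ}
    (hz : z ≠ 0) (hl : lam P z = 0) :
    ∃ C, ∀ᶠ ζ in 𝓝[closedD1 P] z, ‖mu P ψm x t ζ 1 0 / scatA P S ψp ψm ζ‖ ≤ C := by
  obtain ⟨C, hC⟩ := IsColumn.locally_bounded (isPotential_reflEnv h.solution h.nzbc ht)
    (h.jost.column_minus ht) (-x) hz
  simp only [neg_neg] at hC
  obtain ⟨c, hc, δ, hδ, hb⟩ := h.spectrum.branch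
  have hn : ∀ᶠ ζ in 𝓝[closedD1 P] z, ‖ζ - I * P.q0‖ < δ ∨ ‖ζ + I * P.q0‖ < δ := by
    refine nhdsWithin_le_nhds ?_
    filter_upwards [Metric.ball_mem_nhds z hδ] with ζ hζ
    rw [Metric.mem_ball, dist_eq_norm] at hζ
    rcases (lam_eq_zero_iff hz).1 hl with rfl | rfl
    · exact Or.inl hζ
    · exact Or.inr (by rwa [sub_neg_eq_add] at hζ)
  refine ⟨C / c, ?_⟩
  filter_upwards [hC, hn, self_mem_nhdsWithin] with ζ h1 h2 h3
  rw [norm_div]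
  exact div_le_div₀ ((norm_nonneg _).trans h1.1) h1.1 hc (hb ζ (D1_union_Sigma.symm ▸ h3) h2)

/-- `μ_{-,21} / a` with its poles subtracted. -/
theorem exists_isSectional_minus (h : IsScatteringSetting P S q ψp ψm ζs) (ht : t ∈ S) (x : ℝ) :
    ∃ G : ℂ → ℂ, IsSectional (closedD1 P) (D1 P) G
      (-I * conj P.qp * exp (I * omegaPlus P q x t))
      (-I * conj (env P q x t) * exp (-(I * omegaPlus P q x t))
        - ∑ k, poleResidue P S ψp ψm ζs x t k) ∧
      ∀ ζ ∈ Sigma P, G ζ = mu P ψm x t ζ 1 0 / scatA P S ψp ψm ζ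
        - simplePoles (poleResidue P S ψp ψm ζs x t) (pole P ζs) ζ := by
  set A := scatA P S ψp ψm with hA
  set R := simplePoles (poleResidue P S ψp ψm ζs x t) (pole P ζs) with hR
  set F := Set.range (pole P ζs) with hF
  set g : ℂ → ℂ := fun ζ => mu P ψm x t ζ 1 0 with hg
  have hFfin : F.Finite := Set.finite_range _
  have hFD : F ⊆ D1 P := h.range_pole_subset
  have hFS : ∀ ζ, lam P ζ = 0 ∨ (lam P ζ).im = 0 → ζ ∉ F := by
    intro ζ hζ hF'
    have h1 := mem_D1_iff.1 (hFD hF')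
    rcases hζ with h2 | h2
    · rw [h2] at h1; exact lt_irrefl _ h1
    · exact h1.ne' h2
  have hAne : ∀ ζ ∈ closedD1 P, ζ ∉ F → A ζ ≠ 0 := fun ζ hζ hn h0 => hn (h.mem_range_pole hζ h0)
  have hd : DifferentiableOn ℂ (fun ζ => g ζ / A ζ - R ζ) (D1 P \ F) := by
    refine (((h.differentiableOn_minus ht x).mono Set.sdiff_subset).div
      (fun ζ hζ => (h.differentiableAt_scatA hζ.1).differentiableWithinAt)
      fun ζ hζ => hAne ζ (D1_subset hζ.1) hζ.2).sub fun ζ hζ => ?_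
    exact (differentiableAt_simplePoles hζ.2).differentiableWithinAt
  have h0 : ∀ c ∈ F, Tendsto (fun z => (z - c) * (g z / A z - R z)) (𝓝[≠] c) (𝓝 0) := by
    rintro _ ⟨k, rfl⟩
    have hk := h.pole_mem_D1 k
    have h1 := ((hasDerivAt_iff_tendsto_slope.1 (h.differentiableAt_scatA hk).hasDerivAt).inv₀
      (h.deriv_pole_ne_zero k))
    have h2 : Tendsto g (𝓝[≠] (pole P ζs k)) (𝓝 (g (pole P ζs k))) :=
      ((h.differentiableOn_minus ht x).differentiableAt
        (isOpen_D1.mem_nhds hk)).continuousAt.tendsto.mono_left nhdsWithin_le_nhds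
    have h3 := (h2.mul h1).sub (tendsto_mul_simplePoles_pole
      (c := poleResidue P S ψp ψm ζs x t) h.pole_injective k)
    refine (h3.congr fun z => ?_).congr_right ?_
    · rw [slope_def_field, h.scatA_pole k, sub_zero, inv_div]
      ring
    · rw [poleResidue, div_eq_mul_inv, sub_self]
  obtain ⟨G, hGd, hGe⟩ := exists_differentiableOn_of_tendsto_zero (isOpen_D1 (P := P)) hFfin hd h0
  have hGn : ∀ z, z ∉ F → G =ᶠ[𝓝 z] fun ζ => g ζ / A ζ - R ζ := fun z hz => by
    filter_upwards [hFfin.isClosed.isOpen_compl.mem_nhds hz] with ζ hζ using hGe ζ hζ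
  have hGc : ContinuousOn G (closedD1 P) := by
    intro ζ hζ
    by_cases hD : ζ ∈ D1 P
    · exact (hGd.differentiableAt (isOpen_D1.mem_nhds hD)).continuousAt.continuousWithinAt
    · have hn : ζ ∉ F := fun h' => hD (hFD h')
      have h1 : ContinuousWithinAt (fun ζ => g ζ / A ζ - R ζ) (closedD1 P) ζ :=
        ((h.continuousOn_minus ht x ζ hζ).div (h.jost.scatA_continuousOn h.solution h.nzbc
          h.ordConnected h.zero_mem ζ hζ) (hAne ζ hζ hn)).sub
          (differentiableAt_simplePoles hn).continuousAt.continuousWithinAt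
      exact h1.congr_of_eventuallyEq (nhdsWithin_le_nhds (hGn ζ hn)) (hGe ζ hn)
  refine ⟨G, ⟨hGc, hGd, bounded_of_continuousOn hGc ?_, ?_, ?_⟩,
    fun ζ hζ => hGe ζ (hFS ζ (Or.inr (mem_Sigma_iff.1 hζ).2.2))⟩
  · intro z hz hl
    have hn := hFS z (Or.inl hl)
    obtain ⟨C, hC⟩ := h.quotient_bounded ht x hz hl
    have h2 : ∀ᶠ ζ in 𝓝 z, ‖R ζ‖ < ‖R z‖ + 1 :=
      (differentiableAt_simplePoles hn).continuousAt.norm.eventually (gt_mem_nhds (lt_add_one _))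
    refine ⟨C + (‖R z‖ + 1), ?_⟩
    filter_upwards [hC, nhdsWithin_le_nhds h2, nhdsWithin_le_nhds (hGn z hn)] with ζ h3 h4 h5
    rw [h5]
    exact norm_sub_le_of_le h3 h4.le
  · have h1 := (h.quotient_zero ht x).sub
      ((tendsto_mul_simplePoles_zero (c := poleResidue P S ψp ψm ζs x t)
        h.pole_ne_zero).mono_left nhdsWithin_le_nhds)
    rw [sub_zero] at h1
    refine h1.congr' ?_
    filter_upwards [nhdsWithin_le_nhds (hGn 0 fun ⟨k, hk⟩ => h.pole_ne_zero k hk)] with ζ hζ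
    rw [hζ, mul_sub]
  · have h1 := (h.quotient_infty ht x).sub
      ((tendsto_mul_simplePoles_cobounded (c := poleResidue P S ψp ψm ζs x t)
        (ξ := pole P ζs)).mono_left inf_le_left)
    refine h1.congr' ?_
    filter_upwards [mem_inf_of_left (Bornology.isBounded_def.1 hFfin.isBounded)] with ζ hζ
    rw [hGe ζ hζ, mul_sub]

/-- `μ_{+,12}` with the poles of `μ_{-,12} / ã` subtracted. -/
theorem isSectional_plus (h : IsScatteringSetting P S q ψp ψm ζs) (ht : t ∈ S) (x : ℝ)
    (c : Fin N ⊕ Fin N → ℂ) :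
    IsSectional (closedD1 P) (D1 P)
      (fun ζ => mu P ψp x t ζ 0 1 - simplePoles c (etaBar P ζs) ζ)
      (-I * P.qp * exp (-(I * omegaPlus P q x t)))
      (-I * env P q x t * exp (I * omegaPlus P q x t) - ∑ k, c k) := by
  have hp := isPotential_env h.solution h.nzbc ht
  have hcol := h.jost.column_plus ht
  have hD2 : Set.range (etaBar P ζs) ⊆ D2 P := by
    rintro _ ⟨k, rfl⟩
    rw [← conj_pole]
    exact conj_mem_D2.2 (h.pole_mem_D1 k)
  have hn : ∀ ζ, 0 ≤ (lam P ζ).im → ζ ∉ Set.range (etaBar P ζs) := fun ζ h1 h2 =>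
    absurd (mem_D2_iff.1 (hD2 h2)) h1.not_gt
  have hne : ∀ k, etaBar P ζs k ≠ 0 := fun k => (D2_subset (hD2 ⟨k, rfl⟩)).1
  have hc : ContinuousOn (fun ζ => mu P ψp x t ζ 0 1 - simplePoles c (etaBar P ζs) ζ)
      (closedD1 P) := (IsColumn.continuousOn hp hcol x).fst.sub fun ζ hζ =>
    (differentiableAt_simplePoles (hn ζ hζ.2.2)).continuousAt.continuousWithinAt
  refine ⟨hc, ?_, bounded_of_continuousOn hc ?_, ?_, ?_⟩
  · exact (IsColumn.differentiableOn hp hcol x isOpen_D1 D1_subset).fst.sub fun ζ hζ =>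
      (differentiableAt_simplePoles (hn ζ (D1_subset hζ).2.2)).differentiableWithinAt
  · intro z hz hl
    obtain ⟨C, hC⟩ := IsColumn.locally_bounded hp hcol x hz
    have h2 : ∀ᶠ ζ in 𝓝 z, ‖simplePoles c (etaBar P ζs) ζ‖ <
        ‖simplePoles c (etaBar P ζs) z‖ + 1 :=
      (differentiableAt_simplePoles (hn z (by rw [hl, zero_im]))).continuousAt.norm.eventually
        (gt_mem_nhds (lt_add_one _))
    refine ⟨C + (‖simplePoles c (etaBar P ζs) z‖ + 1), ?_⟩
    filter_upwards [hC, nhdsWithin_le_nhds h2] with ζ h3 h4 using norm_sub_le_of_le h3.1 h4.le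
  · have h1 := (h.plus_zero ht x).1.sub
      ((tendsto_mul_simplePoles_zero (c := c) hne).mono_left nhdsWithin_le_nhds)
    rw [sub_zero] at h1
    exact h1.congr fun ζ => (mul_sub _ _ _).symm
  · have h1 := (h.plus_infty ht x).2.sub
      ((tendsto_mul_simplePoles_cobounded (c := c) (ξ := etaBar P ζs)).mono_left inf_le_left)
    exact h1.congr fun ζ => (mul_sub _ _ _).symm

theorem simplePoles_conj (c : Fin N ⊕ Fin N → ℂ) (ζ : ℂ) :
    conj (simplePoles c (pole P ζs) (conj ζ)) =
      simplePoles (fun k => conj (c k)) (etaBar P ζs) ζ := by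
  simp only [simplePoles, map_sum, map_div₀, map_sub, Complex.conj_conj, conj_pole]

theorem M2_mul_Jtilde (η : ℂ) : (M2 P S ψp ψm q x t η * Jtilde P S ψp ψm x t η) 0 1 =
    exp (I * omegaPlus P q x t) * mu P ψp x t η 0 0 *
      (conj (refl P S ψp ψm (conj η)) * exp (-2 * I * Theta P x t η)) := by
  simp [M2, Jtilde, expSigma3, Matrix.mul_apply, Fin.sum_univ_two]

/-- The integrand is the jump of `μ_{+,12}` against `μ_{-,12} / ã`. -/
theorem integrand_eq (h : IsScatteringSetting P S q ψp ψm ζs) (ht : t ∈ S) (x : ℝ)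
    (hζ : ζ ∈ Sigma P) : (M2 P S ψp ψm q x t ζ * Jtilde P S ψp ψm x t ζ) 0 1 =
    exp (I * omegaPlus P q x t) * (mu P ψp x t ζ 0 1
      - -conj (mu P ψm x t (conj ζ) 1 0 / scatA P S ψp ψm (conj ζ))) := by
  have hζ' := Sigma_subset_closedD1 (conj_mem_Sigma.2 hζ)
  have hA := h.jost.scatAt_conj h.solution h.nzbc h.ordConnected h.zero_mem hζ'
  have hm := (h.jost.mu_minus_second h.solution h.nzbc ht hζ' x).1
  rw [Complex.conj_conj] at hA hm
  have h11 : scatAt P S ψp ψm ζ = scat S ψp ψm ζ 1 1 := if_pos hζ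
  have hne : scat S ψp ψm ζ 1 1 ≠ 0 := by
    rw [← h11, hA, Ne, map_eq_zero]
    exact h.spectrum.ne_zero _ (conj_mem_Sigma.2 hζ)
  have hs := h.jost.scat_spec h.ordConnected h.zero_mem hζ x t ht
  have hs1 : ψm x t ζ 0 1 =
      ψp x t ζ 0 0 * scat S ψp ψm ζ 0 1 + ψp x t ζ 0 1 * scat S ψp ψm ζ 1 1 := by
    rw [hs, Matrix.mul_apply, Fin.sum_univ_two]
  rw [M2_mul_Jtilde, refl, map_div₀, h.jost.scat_conj h.solution h.nzbc h.ordConnected h.zero_mem hζ,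
    map_div₀, ← neg_div, ← hm, ← hA, h11, mu_one, mu_one, hs1, mu_zero, exp_neg_two_Theta]
  have hE := exp_mul_exp_neg (I * Theta P x t ζ)
  field_simp
  linear_combination (-ψp x t ζ 0 0 * scat S ψp ψm ζ 0 1) * hE

/-- The integrand is bounded on the real line near `0`, since `b(ζ) = O(ζ)` there. -/
theorem integrand_bounded (h : IsScatteringSetting P S q ψp ψm ζs) (ht : t ∈ S) (x : ℝ) :
    ∃ C, ∀ᶠ s : ℝ in 𝓝[≠] 0, ‖(M2 P S ψp ψm q x t s * Jtilde P S ψp ψm x t s) 0 1‖ ≤ C := by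
  have hr : Tendsto (fun s : ℝ => (s : ℂ)) (𝓝[≠] 0) (𝓝[closedD1 P] 0) := by
    refine tendsto_nhdsWithin_iff.2 ⟨?_, ?_⟩
    · simpa using (continuous_ofReal.tendsto 0).mono_left nhdsWithin_le_nhds
    · filter_upwards [self_mem_nhdsWithin] with s hs
      exact Sigma_subset_closedD1 (ofReal_mem_Sigma hs)
  obtain ⟨f1, L, f2⟩ := h.plus_zero ht x
  obtain ⟨g1, L', g2⟩ := h.minus_zero ht x
  have ha := h.scatA_zero ht x
  have hs : Tendsto (fun ζ : ℂ => ζ / (ζ ^ 2 + P.q0 ^ 2)) (𝓝[closedD1 P] 0) (𝓝 0) := by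
    have : ContinuousAt (fun ζ : ℂ => ζ / (ζ ^ 2 + P.q0 ^ 2)) 0 :=
      continuousAt_id.div (by fun_prop) (by simpa using q0_ne_zero P)
    simpa using this.tendsto.mono_left (nhdsWithin_le_nhds (s := closedD1 P))
  -- `ζ` times the Wronskian has a limit at `0`, and dividing by `ζ (1 + q₀² / ζ²)` gives `O(ζ)`.
  have hW := ((((tendsto_conj f2).mul g1).add ((tendsto_conj f1).mul g2)).mul hs).div ha
    (scatA_zero_ne_zero (q := q) x t)
  obtain ⟨C, hC⟩ := exists_gt (_ : ℝ)
  have hF := ((f2.norm.mul hW.norm).comp hr).eventually (gt_mem_nhds hC)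
  refine ⟨C, ?_⟩
  filter_upwards [hF, self_mem_nhdsWithin] with s hs1 hs2
  refine le_trans (le_of_eq ?_) hs1.le
  have hS : (s : ℂ) ∈ Sigma P := ofReal_mem_Sigma hs2
  have hζ := Sigma_subset_closedD1 hS
  have hm := h.jost.mu_plus_first h.solution h.nzbc ht hζ x
  have hb := (scat_wronskian (h.jost.scat_spec h.ordConnected h.zero_mem hS x t ht)).2.1
  rw [h.jost.wronskian_plus h.ordConnected hS ht x] at hb
  -- On the real line `Θ` is real, so the exponentials have modulus one.
  have hT : (Theta P x t s).im = 0 := by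
    rw [← conj_eq_iff_im, conj_Theta, conj_ofReal]
  have hnorm : ∀ r : ℝ, ‖exp (r * I * Theta P x t s)‖ = 1 := fun r => by
    have : Theta P x t s = ((Theta P x t s).re : ℂ) := by
      apply Complex.ext <;> simp [hT]
    rw [this, mul_assoc, mul_comm I, ← mul_assoc, ← ofReal_mul, norm_exp_ofReal_mul_I]
  have h1 : ‖exp (-2 * I * Theta P x t s)‖ = 1 := by simpa using hnorm (-2)
  have h2 : ‖exp (I * omegaPlus P q x t)‖ = 1 := by
    rw [mul_comm, norm_exp_ofReal_mul_I]
  have hd := one_add_ne_zero hζ.1 hζ.2.1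
  have hb' : scat S ψp ψm s 1 0 = ((conj (mu P ψp x t s 1 1) * (s * mu P ψm x t s 1 0) +
      conj (s * mu P ψp x t s 0 1) * mu P ψm x t s 0 0) * (s / (s ^ 2 + P.q0 ^ 2)))
      * exp (-2 * I * Theta P x t s) := by
    rw [conj_ofReal] at hm
    have hs0 : (s : ℂ) ≠ 0 := hζ.1
    have hd' : (s : ℂ) ^ 2 + P.q0 ^ 2 ≠ 0 := by
      intro h0
      apply hd
      field_simp
      linear_combination h0
    rw [wronskian, psi_zero (P := P) ψp, psi_zero (P := P) ψp, psi_zero (P := P) ψm,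
      psi_zero (P := P) ψm, hm.1, hm.2, ← eq_div_iff hd] at hb
    rw [hb, exp_neg_two_Theta, map_mul, conj_ofReal]
    field_simp
    ring
  rw [M2_mul_Jtilde, refl, conj_ofReal, norm_mul, norm_mul, norm_mul, h1, h2, RCLike.norm_conj, hb',
    norm_div, norm_mul, h1, ← conj_ofReal s, hm.1, RCLike.norm_conj, conj_ofReal]
  simp only [Function.comp, Pi.div_apply, norm_div, one_mul, mul_one]

end IsScatteringSetting

end KunduEckhaus

theorem proposition4 (P : Params) (S : Set ℝ) (hS : S.OrdConnected) (h0 : (0 : ℝ) ∈ S)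
    (q : ℝ → ℝ → ℂ) (hq : IsSolution P S q) (hbc : HasNZBC P S q)
    (ψp ψm : ℝ → ℝ → ℂ → Matrix (Fin 2) (Fin 2) ℂ) (hψ : IsJost P S q ψp ψm)
    (N : ℕ) (ζs : Fin N → ℂ) (hζ : SimpleSpectrum P S ψp ψm ζs)
    (x t : ℝ) (ht : t ∈ S) :
    ∃ J : ℂ,
      HasSigmaIntegral P (fun η => (M2 P S ψp ψm q x t η * Jtilde P S ψp ψm x t η) 0 1) J ∧
      q x t = exp (I * (Upsilon P x t - omegaPlus P q x t)) *
        (P.qp * exp (-I * omegaPlus P q x t)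
          + I * ∑ j : Fin N ⊕ Fin N, cTilde P S ψp ψm ζs j
              * exp (-2 * I * Theta P x t (etaBar P ζs j)) * mu P ψp x t (etaBar P ζs j) 0 0
          + exp (-I * omegaPlus P q x t) * (1 / (2 * Real.pi)) * J) := by
  have h : IsScatteringSetting P S q ψp ψm ζs := ⟨hS, h0, hq, hbc, hψ, hζ⟩
  obtain ⟨G, hG, hGe⟩ := h.exists_isSectional_minus ht x
  set w := exp (I * omegaPlus P q x t) with hw
  have h1 := (h.isSectional_plus ht x
    fun k => -conj (poleResidue P S ψp ψm ζs x t k)).const_mul w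
  rw [← hw] at h1
  have h2 := hG.schwarz.const_mul w
  -- The constants at `0` and `∞` of the two sectional functions agree.
  have hc : conj w = exp (-(I * omegaPlus P q x t)) := by
    rw [hw, ← exp_conj, map_mul, conj_I, conj_ofReal, neg_mul]
  have hc' : conj (exp (-(I * omegaPlus P q x t))) = w := by rw [← hc, Complex.conj_conj]
  have e0 : -conj (-I * conj P.qp * w) = -I * P.qp * exp (-(I * omegaPlus P q x t)) := by
    simp only [map_mul, map_neg, conj_I, Complex.conj_conj, hc]
    ring
  have eInf : -conj (-I * conj (env P q x t) * exp (-(I * omegaPlus P q x t))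
      - ∑ k, poleResidue P S ψp ψm ζs x t k) =
      -I * env P q x t * w - ∑ k, -conj (poleResidue P S ψp ψm ζs x t k) := by
    simp only [map_sub, map_mul, map_neg, conj_I, Complex.conj_conj, hc', map_sum,
      Finset.sum_neg_distrib]
    ring
  rw [e0, eInf] at h2
  refine ⟨_, hasSigmaIntegral_of_isSectional h1 h2 (fun ζ hζ => ?_) (h.integrand_bounded ht x), ?_⟩
  · rw [h.integrand_eq ht x hζ, hGe _ (conj_mem_Sigma.2 hζ), map_sub,
      IsScatteringSetting.simplePoles_conj]
    have : simplePoles (fun k => -conj (poleResidue P S ψp ψm ζs x t k)) (etaBar P ζs) ζ =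
        -simplePoles (fun k => conj (poleResidue P S ψp ψm ζs x t k)) (etaBar P ζs) ζ := by
      simp only [simplePoles, neg_div, Finset.sum_neg_distrib]
    rw [this]
    ring
  · simp only [h.cTilde_eq ht x]
    have e1 : exp (-I * omegaPlus P q x t) = exp (-(I * omegaPlus P q x t)) := by rw [neg_mul]
    have e2 : exp (I * (Upsilon P x t - omegaPlus P q x t)) =
        exp (I * Upsilon P x t) * exp (-(I * omegaPlus P q x t)) := by
      rw [← exp_add]; ring_nf
    have e3 := exp_mul_exp_neg (I * omegaPlus P q x t)
    have e4 := exp_mul_exp_neg (I * Upsilon P x t)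
    rw [e1, e2, env, neg_mul I (Upsilon P x t : ℂ)]
    rw [← hw] at e3
    set w' := exp (-(I * omegaPlus P q x t))
    set u := exp (I * Upsilon P x t)
    set u' := exp (-(I * Upsilon P x t))
    set s := ∑ k, -conj (poleResidue P S ψp ψm ζs x t k)
    have hpi : (Real.pi : ℂ) ≠ 0 := ofReal_ne_zero.2 Real.pi_ne_zero
    field_simp
    linear_combination (-u * w' * (I * (-(q x t * I * u' * w) - s + w' * P.qp * I))
      - q x t * u * u') * e3 - q x t * e4 - u * w' * (w' * P.qp - q x t * u' * w) * I_sq
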